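/- **Setting.** Consider caching with a cache of $k\ge 2$ pages: a request sequence $r_1,\dots,r_T$ is revealed online, after each request the requested page has to be in the cache, and the cost is the number of page loads (each load evicts a page). The algorithm and Belady's offline algorithm start with the same $k$ pages. Belady's algorithm changes its cache only at a page fault, where it evicts a page of its cache whose next request is furthest in the future, with ties between pages that are never requested again broken arbitrarily; let $B_t$ be its cache content after $r_t$ and $\mathrm{OPT}$ its number of page faults. A predictor has, for each time $t$, a predicted cache content $P_t$ (an arbitrary set of $k$ pages), whose error is $\eta_t=|B_t\setminus P_t|$. At any moment of time step $t$ the algorithm may query the predictor for some number $n$ of pages; the predictor reports $n$ pages of the algorithm's current cache that are not in $P_t$ (all such pages, if there are fewer than $n$), and the choice among them is arbitrary. The total prediction error $\eta$ of an execution is the sum of $\eta_t$ over the time steps $t$ in which the predictor is queried. The algorithm may be randomized; the request sequence, Belady's tie-breaking and the predictor are fixed in advance. **Theorem.** There is an absolute constant $C$ such that the following holds for every $k\ge 2$ and every strictly increasing convex function $f:[0,\infty)\to\mathbb{R}$ with $f(0)=0$ and $f(i)\le 2^i-1$ for all integers $i\ge 0$. There is a randomized online caching algorithm such that for every initial cache,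 every request sequence, every run of Belady's algorithm and every predictor: 1. (number of predictions) both the number of queries and the total number of pages reported by the predictor are always at most $C\,(1+f(\log_2 k))\cdot\mathrm{OPT}$; 2. ($1$-consistency) if the expected total error of the queried predictions is $0$, the expected cost is at most $\mathrm{OPT}$; 3. ($O(\log k)$-robustness) the expected cost is at most $C\log_2 k\cdot\mathrm{OPT}$, whatever the predictions are; 4. (smoothness) if the expected total error of the queried predictions is at most $\eta$, the expected cost is at most $C\,\bigl(1+f^{-1}(\eta/\mathrm{OPT})\bigr)\cdot\mathrm{OPT}$ (and the expected cost is $0$ if $\mathrm{OPT}=0$). -/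

import Mathlib

open scoped ENNReal NNReal

universe u

namespace Caching

/-!
Time convention: the requests are `r 0, …, r (T - 1)`. Serving `r t` leads from the state with
index `t` to the state with index `t + 1`; states with index `0` are initial states.
A state is the set of pages in the cache.
-/

section Belady

variable {Page : Type u} [DecidableEq Page]

/-- Among the pages of `A`, the page `q` is requested furthest in the future after the request
`r t`: before or at any later request to `q`, every page of `A` is requested. In particular every
page of `A` that is never requested again qualifies. -/
def FurthestInFuture (r : ℕ → Page) (T t : ℕ) (A : Finset Page) (q : Page) : Prop :=
  q ∈ A ∧ ∀ p ∈ A, ∀ s, t < s → s < T → r s = q → ∃ s', t < s' ∧ s' ≤ s ∧ r s' = p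

/-- `B 0, …, B T` are the cache contents of Belady's algorithm on the requests
`r 0, …, r (T - 1)` with initial cache `A₀`, for some way of breaking ties. -/
structure IsBeladyRun (r : ℕ → Page) (T : ℕ) (A₀ : Finset Page) (B : ℕ → Finset Page) :
    Prop where
  init : B 0 = A₀
  hit : ∀ t < T, r t ∈ B t → B (t + 1) = B t
  fault : ∀ t < T, r t ∉ B t →
    ∃ q, FurthestInFuture r T t (B t) q ∧ B (t + 1) = insert (r t) ((B t).erase q)

/-- The number of page faults of a sequence of cache contents `B`. -/
def faults (r : ℕ → Page) (T : ℕ) (B : ℕ → Finset Page) : ℕ :=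
  ((Finset.range T).filter fun t => r t ∉ B t).card

end Belady

/-- An action predictor for caches of size `k`: `state t` is the predicted cache content with
index `t`. A query made with cache content `A` for `n` pages is answered by `n` pages which are in
`A` but not in the predicted cache (by all such pages, if there are fewer than `n`); which of them
are reported is up to the predictor. -/
structure Predictor (Page : Type u) [DecidableEq Page] (k : ℕ) where
  state : ℕ → Finset Page
  card_state : ∀ t, (state t).card = k
  report : ℕ → Finset Page → ℕ → Finset Page
  report_subset : ∀ t A n, report t A n ⊆ A \ state t
  card_report : ∀ t A n, (report t A n).card = min n (A \ state t).card

/-- What an algorithm does in one time step: a finite interactive program. -/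
inductive Prog (Page : Type u) (Mem : Type u) : Type u
  /-- Finish the time step, keeping the memory `m`. -/
  | done (m : Mem) : Prog Page Mem
  /-- Load the page `p` in place of the page `q`. -/
  | swap (p q : Page) (next : Prog Page Mem) : Prog Page Mem
  /-- Ask the predictor for `n` pages of the own cache that are absent from the predicted cache,
  and continue depending on the reported pages. -/
  | query (n : ℕ) (next : Finset Page → Prog Page Mem) : Prog Page Mem
  /-- Draw a uniformly random element of `{0, …, n}`, and continue depending on it. -/
  | toss (n : ℕ) (next : Fin (n + 1) → Prog Page Mem) : Prog Page Mem

/-- A randomized online caching algorithm with access to a predictor. It learns the initial cache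
content, then the requests one by one, and about the predictions only the answers to its
queries. -/
structure OnlineAlgorithm (Page : Type u) where
  Mem : Type u
  init : Finset Page → Mem
  step : Mem → Page → Prog Page Mem

/-- The cache content and the bookkeeping of an execution. -/
structure Config (Page : Type u) where
  cache : Finset Page
  /-- number of pages loaded so far -/
  cost : ℕ
  /-- number of queries so far -/
  queries : ℕ
  /-- total number of pages reported by the predictor so far -/
  indices : ℕ
  /-- indices of the predictions that were queried so far -/
  queryTimes : Finset ℕ
  /-- number of requests so far that were not in the cache at the end of their time step -/
  unserved : ℕ

noncomputable section Execution

variable {Page : Type u} [DecidableEq Page] {k : ℕ}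

/-- Execute a program during the time step that leads to the state with index `t`. A swap is
carried out only if its first page is outside and its second page inside the cache. -/
def exec {Mem : Type u} (pred : Predictor Page k) (t : ℕ) :
    Prog Page Mem → Config Page → PMF (Mem × Config Page)
  | .done m, c => PMF.pure (m, c)
  | .swap p q next, c =>
      exec pred t next
        (if p ∉ c.cache ∧ q ∈ c.cache then
          { c with cache := insert p (c.cache.erase q), cost := c.cost + 1 }
        else c)
  | .query n next, c =>
      exec pred t (next (pred.report t c.cache n))
        { c with
          queries := c.queries + 1
          indices := c.indices + (pred.report t c.cache n).card
          queryTimes := insert t c.queryTimes }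
  | .toss n next, c =>
      (PMF.uniformOfFintype (Fin (n + 1))).bind fun i => exec pred t (next i) c

/-- Joint distribution of the memory and the configuration after the first `t` requests. -/
def OnlineAlgorithm.run (alg : OnlineAlgorithm Page) (pred : Predictor Page k)
    (A₀ : Finset Page) (r : ℕ → Page) : ℕ → PMF (alg.Mem × Config Page)
  | 0 => PMF.pure (alg.init A₀, ⟨A₀, 0, 0, 0, ∅, 0⟩)
  | t + 1 => (OnlineAlgorithm.run alg pred A₀ r t).bind fun x =>
      (exec pred (t + 1) (alg.step x.1 (r t)) x.2).map fun y =>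
        (y.1, { y.2 with unserved := y.2.unserved + if r t ∈ y.2.cache then 0 else 1 })

/-- Distribution of the configuration after the first `T` requests. -/
def OnlineAlgorithm.outcome (alg : OnlineAlgorithm Page) (pred : Predictor Page k)
    (A₀ : Finset Page) (r : ℕ → Page) (T : ℕ) : PMF (Config Page) :=
  (alg.run pred A₀ r T).map Prod.snd

/-- Expectation of a natural-number-valued quantity. -/
def expect {α : Type u} (μ : PMF α) (X : α → ℕ) : ℝ≥0∞ :=
  ∑' a, μ a * (X a : ℝ≥0∞)

/-- Total error, with respect to the states `B`, of the predictions that were queried. The error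
of a single prediction is the number of pages in `B t` absent from the predicted cache. -/
def receivedError (pred : Predictor Page k) (B : ℕ → Finset Page) (c : Config Page) : ℕ :=
  ∑ t ∈ c.queryTimes, (B t \ pred.state t).card

end Execution

end Caching

/-! The proof compares the algorithm's cache A with Belady's cache B along the phases of the marking
algorithm. Whether Belady faults at the current request is known online: cutting the input after
this request leaves a valid Belady run, and by optimality all runs on the cut input fault at the
same requests (`IsBeladyRun.dominates`, `IsBeladyRun.fault_iff`, `beladyFaults_eq`). Belady's faults
in this phase and twice those in the previous one bound |A \ B|; this bound, `quota`, is the number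
of pages asked for at the start of a window. Windows follow the levels ⌊f(log₂ m)⌋, where m is the
number of pages still to be marked, so a phase has at most 1 + f(log₂ k) of them. Belady faults
inside a window are answered by further queries of size at most twice their number. This bounds the
number of predictions.

A fault evicts a random reported candidate. If there is none, or if the requested page was itself
dropped as a candidate and Belady does not fault, a random unmarked page is evicted instead. The
cost is bounded by a potential `W` whose expectation never increases. Its main part is a sum over
slots: requests that are the first to their page in the phase and hits for Belady. When m pages
remain to be marked, Belady holds at least m fresh pages, so a random eviction that might remove the
slot's page is much more likely to remove some other fresh page. Hence a slot can prepay its fault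
with weight 2/m for each further fresh page that may go missing, up to a cap θ
(`slotPot_evict_random`). With g the total quota of the phase, slots with m < 2g simply receive
potential 1; there are at most 2g per phase.

For the other slots the cap is g if m < μ, and otherwise the minimum of g and six times the error of
the window's queries. If more pages than six times the error are misplaced, at least half of the
candidates are absent from B, so evicting a random candidate lowers the term 6|A \ B| by at least 3
in expectation, which pays for the fault (`MidInv.sum_W_le`).

Summing the prepayments gives a cost of O((1 + H)·OPT + w·error) in `expect_cost_le`, where H bounds
the harmonic sum below μ and w the harmonic sum over one level above μ. For μ = ⌈2^a⌉, H = 1 + a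
works, and convexity together with f(i) ≤ 2^i - 1 gives w = 3a/f(a) (`sum_one_div_level_le`). The
threshold μ occurs only in the analysis: a = f⁻¹(η/OPT) yields smoothness, and μ = k + 1 with w = 0
yields robustness for the same algorithm. Consistency is an invariant of single executions: as long
as the queried predictions are correct, A = B. -/

namespace Caching

/-! ### Optimality of Belady's algorithm, and online detection of its faults -/

section BeladyOptimality

variable {Page : Type u} [DecidableEq Page]

/-- The pages of `A` that are requested at some time in `[t, x]`. -/
def requestedIn (r : ℕ → Page) (t x : ℕ) (A : Finset Page) : Finset Page :=
  A.filter fun p => p ∈ (Finset.Icc t x).image r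

theorem mem_requestedIn {r : ℕ → Page} {t x : ℕ} {A : Finset Page} {p : Page} :
    p ∈ requestedIn r t x A ↔ p ∈ A ∧ ∃ s, t ≤ s ∧ s ≤ x ∧ r s = p := by
  simp [requestedIn, and_assoc]

theorem card_requestedIn_hit {r : ℕ → Page} {t x : ℕ} (hx : t ≤ x) {A : Finset Page}
    (h : r t ∈ A) :
    (requestedIn r (t + 1) x A).card + 1 =
      (requestedIn r t x A).card + if r t ∈ requestedIn r (t + 1) x {r t} then 1 else 0 := by
  have key : requestedIn r t x A = insert (r t) (requestedIn r (t + 1) x A) := by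
    ext p
    simp only [Finset.mem_insert, mem_requestedIn]
    constructor
    · rintro ⟨hp, s, hs, hsx, rfl⟩
      rcases hs.eq_or_lt with rfl | hs
      · exact Or.inl rfl
      · exact Or.inr ⟨hp, s, hs, hsx, rfl⟩
    · rintro (rfl | ⟨hp, s, hs, hsx, rfl⟩)
      · exact ⟨h, t, le_rfl, hx, rfl⟩
      · exact ⟨hp, s, by omega, hsx, rfl⟩
  by_cases hr : r t ∈ requestedIn r (t + 1) x A
  · have : r t ∈ requestedIn r (t + 1) x {r t} := by
      simp only [mem_requestedIn, Finset.mem_singleton] at hr ⊢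
      exact ⟨trivial, hr.2⟩
    rw [if_pos this, key, Finset.insert_eq_self.2 hr]
  · have : r t ∉ requestedIn r (t + 1) x {r t} := by
      simp only [mem_requestedIn, Finset.mem_singleton] at hr ⊢
      exact fun h' => hr ⟨h, h'.2⟩
    rw [if_neg this, key, Finset.card_insert_of_notMem hr]

/-- Evicting q loses a useful page exactly if q is requested up to the horizon x, and loading r t
gains one exactly if r t is requested again by then. -/
theorem card_requestedIn_fault {r : ℕ → Page} {t x : ℕ} {A : Finset Page} {q : Page}
    (h : r t ∉ A) :
    (requestedIn r (t + 1) x (insert (r t) (A.erase q))).card +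
        (if q ∈ requestedIn r (t + 1) x A then 1 else 0) =
      (requestedIn r t x A).card + if r t ∈ requestedIn r (t + 1) x {r t} then 1 else 0 := by
  have h1 : requestedIn r t x A = requestedIn r (t + 1) x A := by
    ext p
    simp only [mem_requestedIn]
    refine and_congr_right fun hp => ⟨?_, ?_⟩
    · rintro ⟨s, hs, hsx, rfl⟩
      rcases hs.eq_or_lt with rfl | hs
      · exact absurd hp h
      · exact ⟨s, hs, hsx, rfl⟩
    · rintro ⟨s, hs, hsx, rfl⟩
      exact ⟨s, by omega, hsx, rfl⟩
  have h2 : (requestedIn r (t + 1) x (A.erase q)).card +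
      (if q ∈ requestedIn r (t + 1) x A then 1 else 0) = (requestedIn r (t + 1) x A).card := by
    have : requestedIn r (t + 1) x (A.erase q) = (requestedIn r (t + 1) x A).erase q := by
      ext p
      simp only [mem_requestedIn, Finset.mem_erase]
      tauto
    rw [this]
    split_ifs with hq'
    · exact Finset.card_erase_add_one hq'
    · rw [Finset.erase_eq_of_notMem hq']; rfl
  have h3 : (requestedIn r (t + 1) x (insert (r t) (A.erase q))).card =
      (requestedIn r (t + 1) x (A.erase q)).card +
        if r t ∈ requestedIn r (t + 1) x {r t} then 1 else 0 := by
    unfold requestedIn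
    rw [Finset.filter_insert]
    have hn : r t ∉ A.erase q := fun h' => h (Finset.mem_of_mem_erase h')
    split_ifs with h4 h5 h5
    · rw [Finset.card_insert_of_notMem (fun h' => hn (Finset.mem_filter.1 h').1)]
    · exact absurd (Finset.mem_filter.2 ⟨Finset.mem_singleton_self _, h4⟩) h5
    · exact absurd (Finset.mem_filter.1 h5).2 h4
    · rfl
  rw [h1, h3, ← h2]
  omega

theorem card_requestedIn_le {r : ℕ → Page} {t x : ℕ} {A : Finset Page} (h : r t ∈ A) :
    (requestedIn r (t + 1) x A).card + 1 ≤
      A.card + if r t ∈ requestedIn r (t + 1) x {r t} then 1 else 0 := by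
  split_ifs with h1
  · exact Nat.succ_le_succ (Finset.card_le_card (Finset.filter_subset _ _))
  · have : requestedIn r (t + 1) x A ⊆ A.erase (r t) := by
      intro p hp
      refine Finset.mem_erase.2 ⟨?_, (Finset.mem_filter.1 hp).1⟩
      rintro rfl
      exact h1 (Finset.mem_filter.2 ⟨Finset.mem_singleton_self _, (Finset.mem_filter.1 hp).2⟩)
    have := Finset.card_le_card this
    rw [Finset.card_erase_of_mem h] at this
    have : 0 < A.card := Finset.card_pos.2 ⟨_, h⟩
    omega

/-- Cache contents that change only at faults, where some page makes room for the request. -/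
structure IsLazyRun (r : ℕ → Page) (T : ℕ) (A₀ : Finset Page) (S : ℕ → Finset Page) : Prop where
  init : S 0 = A₀
  hit : ∀ t < T, r t ∈ S t → S (t + 1) = S t
  fault : ∀ t < T, r t ∉ S t → ∃ q ∈ S t, S (t + 1) = insert (r t) ((S t).erase q)

theorem IsBeladyRun.isLazyRun {r : ℕ → Page} {T : ℕ} {A₀ : Finset Page} {B : ℕ → Finset Page}
    (h : IsBeladyRun r T A₀ B) : IsLazyRun r T A₀ B :=
  ⟨h.init, h.hit, fun t ht hr => let ⟨q, hq, e⟩ := h.fault t ht hr; ⟨q, hq.1, e⟩⟩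

namespace IsLazyRun

variable {r : ℕ → Page} {T : ℕ} {A₀ : Finset Page} {S : ℕ → Finset Page}

theorem card_eq (h : IsLazyRun r T A₀ S) : ∀ t ≤ T, (S t).card = A₀.card
  | 0, _ => by rw [h.init]
  | t + 1, ht => by
    have ih := h.card_eq t (by omega)
    by_cases hr : r t ∈ S t
    · rw [h.hit t ht hr, ih]
    · obtain ⟨q, hq, e⟩ := h.fault t ht hr
      rw [e, Finset.card_insert_of_notMem (fun h' => hr (Finset.mem_of_mem_erase h')),
        Finset.card_erase_add_one hq, ih]

theorem mem_succ (h : IsLazyRun r T A₀ S) {t : ℕ} (ht : t < T) : r t ∈ S (t + 1) := by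
  by_cases hr : r t ∈ S t
  · rwa [h.hit t ht hr]
  · obtain ⟨q, hq, e⟩ := h.fault t ht hr
    rw [e]; exact Finset.mem_insert_self _ _

theorem succ_subset (h : IsLazyRun r T A₀ S) {t : ℕ} (ht : t < T) :
    S (t + 1) ⊆ insert (r t) (S t) := by
  by_cases hr : r t ∈ S t
  · rw [h.hit t ht hr]; exact Finset.subset_insert _ _
  · obtain ⟨q, hq, e⟩ := h.fault t ht hr
    rw [e]; exact Finset.insert_subset_insert _ (Finset.erase_subset _ _)

theorem card_sdiff_succ_le (h : IsLazyRun r T A₀ S) {t : ℕ} (ht : t < T) :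
    (S t \ S (t + 1)).card ≤ (decide (r t ∉ S t)).toNat := by
  by_cases hr : r t ∈ S t
  · simp [h.hit t ht hr]
  · obtain ⟨q, hq, e⟩ := h.fault t ht hr
    have : S t \ S (t + 1) ⊆ {q} := by
      intro x hx
      rw [e] at hx
      simp only [Finset.mem_sdiff, Finset.mem_insert, Finset.mem_erase, not_or, not_and] at hx
      by_contra hne
      exact hx.2.2 (by simpa using hne) hx.1
    simpa [hr] using Finset.card_le_card this

end IsLazyRun

theorem faults_succ (r : ℕ → Page) (t : ℕ) (B : ℕ → Finset Page) :
    faults r (t + 1) B = faults r t B + (decide (r t ∉ B t)).toNat := by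
  unfold faults
  rw [Finset.range_add_one, Finset.filter_insert]
  split_ifs with h
  · simp [h]
  · rw [Finset.card_insert_of_notMem (by simp)]; simp [h]

theorem requestedIn_self {r : ℕ → Page} {t : ℕ} {A : Finset Page} :
    (requestedIn r t t A).card = if r t ∈ A then 1 else 0 := by
  have : requestedIn r t t A = A.filter fun p => p = r t := by
    simp [requestedIn]
  rw [this, Finset.filter_eq']
  split_ifs <;> simp

/-- Comparing fault counts alone is not inductive. The strengthened claim says that, for every
horizon x, a lead of S in pages that will be used by time x has been bought with at least as many
additional faults. Horizons stay below T because ties are defined by the requests before T. -/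
theorem IsBeladyRun.dominates {r : ℕ → Page} {T : ℕ} {A₀ : Finset Page} {B S : ℕ → Finset Page}
    (hB : IsBeladyRun r T A₀ B) (hS : IsLazyRun r T A₀ S) :
    ∀ t ≤ T, faults r t B ≤ faults r t S ∧ ∀ x, t ≤ x → x < T →
      faults r t B + (requestedIn r t x (S t)).card ≤
        faults r t S + (requestedIn r t x (B t)).card
  | 0, _ => by
    have : S 0 = B 0 := by rw [hB.init, hS.init]
    simp [faults, this]
  | t + 1, ht => by
    obtain ⟨ih1, ih2⟩ := IsBeladyRun.dominates hB hS t (by omega)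
    have htT : t < T := ht
    -- Horizon t: if Belady faults where S hits, then S already has strictly more faults.
    have hself := ih2 t le_rfl htT
    rw [requestedIn_self, requestedIn_self] at hself
    have hcB := hB.isLazyRun.card_eq t (by omega)
    have hcS := hS.card_eq (t + 1) ht
    rw [faults_succ, faults_succ]
    by_cases hb : r t ∈ B t <;> by_cases hs : r t ∈ S t
    all_goals simp only [hb, hs, not_true_eq_false, not_false_eq_true, decide_true, decide_false,
      Bool.toNat_true, Bool.toNat_false, if_true, if_false] at hself ⊢
    all_goals refine ⟨by omega, fun x hx hxT => ?_⟩
    all_goals have ih := ih2 x (by omega) hxT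
    · rw [hB.hit t htT hb, hS.hit t htT hs]
      have e1 := card_requestedIn_hit (x := x) (by omega) hb
      have e2 := card_requestedIn_hit (x := x) (by omega) hs
      omega
    · obtain ⟨q, hq, e⟩ := hS.fault t htT hs
      rw [hB.hit t htT hb, e]
      have e1 := card_requestedIn_hit (x := x) (by omega) hb
      have e2 := card_requestedIn_fault (x := x) (q := q) hs
      omega
    all_goals
      obtain ⟨p, hp, e⟩ := hB.fault t htT hb
      have e1 := card_requestedIn_fault (x := x) (q := p) hb
      rw [← e] at e1
      have e3 := card_requestedIn_le (x := x) (hS.mem_succ htT)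
      -- If the evicted page is used by time x, the furthest-in-future rule makes every page of B t
      -- used by then. So B (t + 1) attains the bound that `card_requestedIn_le` imposes on S (t +
      -- 1). If p is not used by time x, its eviction loses nothing for this horizon.
      have e4 : p ∈ requestedIn r (t + 1) x (B t) →
          (requestedIn r t x (B t)).card = A₀.card := by
        intro h
        obtain ⟨-, s, h1, h2, h3⟩ := mem_requestedIn.1 h
        have : requestedIn r t x (B t) = B t := by
          ext y
          refine ⟨fun hy => (mem_requestedIn.1 hy).1, fun hy => mem_requestedIn.2 ⟨hy, ?_⟩⟩
          obtain ⟨s', h4, h5, h6⟩ := hp.2 y hy s (by omega) (by omega) h3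
          exact ⟨s', by omega, by omega, h6⟩
        rw [this, hcB]
    · have e2 := card_requestedIn_hit (x := x) (by omega) hs
      rw [← hS.hit t htT hs] at e2
      by_cases hpr : p ∈ requestedIn r (t + 1) x (B t)
      · have := e4 hpr
        rw [if_pos hpr] at e1
        omega
      · rw [if_neg hpr] at e1
        rw [hS.hit t htT hs] at e2 ⊢
        omega
    · obtain ⟨q, hq, e'⟩ := hS.fault t htT hs
      have e2 := card_requestedIn_fault (x := x) (q := q) hs
      rw [← e'] at e2
      by_cases hpr : p ∈ requestedIn r (t + 1) x (B t)
      · have := e4 hpr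
        rw [if_pos hpr] at e1
        omega
      · rw [if_neg hpr] at e1
        omega

/-- Shortening the horizon only removes requests that could rule out an eviction, so former choices
remain admissible, possibly as ties. -/
theorem IsBeladyRun.mono {r : ℕ → Page} {T T' : ℕ} {A₀ : Finset Page} {B : ℕ → Finset Page}
    (h : IsBeladyRun r T A₀ B) (hT : T' ≤ T) : IsBeladyRun r T' A₀ B where
  init := h.init
  hit t ht := h.hit t (by omega)
  fault t ht hr := by
    obtain ⟨q, hq, e⟩ := h.fault t (by omega) hr
    exact ⟨q, ⟨hq.1, fun p hp s h1 h2 h3 => hq.2 p hp s h1 (by omega) h3⟩, e⟩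

theorem IsBeladyRun.congr {r r' : ℕ → Page} {T : ℕ} {A₀ : Finset Page} {B : ℕ → Finset Page}
    (h : IsBeladyRun r T A₀ B) (hr : ∀ t < T, r' t = r t) : IsBeladyRun r' T A₀ B where
  init := h.init
  hit t ht h' := h.hit t ht (hr t ht ▸ h')
  fault t ht h' := by
    rw [hr t ht] at h' ⊢
    obtain ⟨q, hq, e⟩ := h.fault t ht h'
    refine ⟨q, ⟨hq.1, fun p hp s h1 h2 h3 => ?_⟩, e⟩
    obtain ⟨s', h4, h5, h6⟩ := hq.2 p hp s h1 h2 (hr s h2 ▸ h3)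
    exact ⟨s', h4, h5, by rw [hr s' (by omega), h6]⟩

/-- Whether Belady's algorithm faults at a request does not depend on how it breaks ties. -/
theorem IsBeladyRun.fault_iff {r : ℕ → Page} {t : ℕ} {A₀ : Finset Page} {B B' : ℕ → Finset Page}
    (h : IsBeladyRun r (t + 1) A₀ B) (h' : IsBeladyRun r (t + 1) A₀ B') :
    r t ∉ B t ↔ r t ∉ B' t := by
  have h1 := (h.dominates h'.isLazyRun t (by omega)).1
  have h2 := (h'.dominates h.isLazyRun t (by omega)).1
  have h3 := (h.dominates h'.isLazyRun (t + 1) le_rfl).1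
  have h4 := (h'.dominates h.isLazyRun (t + 1) le_rfl).1
  rw [faults_succ, faults_succ] at h3 h4
  by_cases hb : r t ∈ B t <;> by_cases hb' : r t ∈ B' t <;> simp_all <;> omega

open Classical in
/-- Whether Belady's algorithm, started with `A₀`, faults at the request `p` that follows the
requests `hist`. -/
noncomputable def beladyFaults (A₀ : Finset Page) (hist : List Page) (p : Page) : Bool :=
  decide (∃ B, IsBeladyRun (fun i => hist.getD i p) (hist.length + 1) A₀ B ∧ p ∉ B hist.length)

/-- The actual run, cut after request t, is a run on the known prefix, and by
`IsBeladyRun.fault_iff` every other run on this prefix agrees with it on request t. -/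
theorem beladyFaults_eq {r : ℕ → Page} {T t : ℕ} {A₀ : Finset Page} {B : ℕ → Finset Page}
    (h : IsBeladyRun r T A₀ B) (ht : t < T) :
    beladyFaults A₀ ((List.range t).map r) (r t) = decide (r t ∉ B t) := by
  -- The default value of `getD` supplies the current request at position t, just past the history.
  have hr : ∀ i < t + 1, ((List.range t).map r).getD i (r t) = r i := by
    intro i hi
    rcases Nat.lt_succ_iff_lt_or_eq.1 hi with hi | rfl
    · simp [List.getD, hi]
    · simp [List.getD]
  have h' := h.mono (T' := t + 1) ht
  unfold beladyFaults
  rw [decide_eq_decide]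
  simp only [List.length_map, List.length_range]
  constructor
  · rintro ⟨B', hB', hn⟩
    exact (h'.fault_iff (hB'.congr fun i hi => (hr i hi).symm)).2 hn
  · exact fun hn => ⟨B, h'.congr hr, hn⟩

end BeladyOptimality

/-! ### Marking phases, windows and slots; harmonic sums over slots -/

section Phases

variable {Page : Type u} [DecidableEq Page]

/-- Bookkeeping of the marking phases. A phase ends when `k` pages are marked and an unmarked page
is requested. Phases are subdivided into windows. -/
structure Phase (Page : Type u) where
  /-- pages requested in the current phase -/
  marked : Finset Page
  /-- number of Belady's faults in the previous phase -/
  prev : ℕ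
  /-- number of Belady's faults in the current phase so far -/
  cur : ℕ
  /-- number of the current phase -/
  idx : ℕ
  /-- number of the current window -/
  win : ℕ

namespace Phase

variable (k : ℕ) (lev : ℕ → ℕ) (φ : Phase Page) (p : Page)

/-- The request `p` starts a new phase. -/
def Starts : Prop := p ∉ φ.marked ∧ φ.marked.card = k

instance : Decidable (φ.Starts k p) := inferInstanceAs (Decidable (_ ∧ _))

/-- The marked pages after the request `p`. -/
def mark : Finset Page := if φ.Starts k p then {p} else insert p φ.marked

/-- The request `p` starts a new window: it is the first request of a phase, or the level of the
number of pages that remain to be marked drops. -/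
def StartsWindow : Prop :=
  p ∉ φ.marked ∧ ((φ.mark k p).card = 1 ∨
    lev (k + 1 - (φ.mark k p).card) < lev (k + 2 - (φ.mark k p).card))

instance : Decidable (φ.StartsWindow k lev p) := inferInstanceAs (Decidable (_ ∧ _))

/-- The bookkeeping after the request `p`, at which Belady's algorithm faults if `flt`. -/
def next (flt : Bool) : Phase Page where
  marked := φ.mark k p
  prev := if φ.Starts k p then φ.cur else φ.prev
  cur := (if φ.Starts k p then 0 else φ.cur) + flt.toNat
  idx := if φ.Starts k p then φ.idx + 1 else φ.idx
  win := if φ.StartsWindow k lev p then φ.win + 1 else φ.win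

end Phase

/-- A request sequence with a run of Belady's algorithm and a predictor. -/
structure Scenario (Page : Type u) [DecidableEq Page] where
  k : ℕ
  lev : ℕ → ℕ
  r : ℕ → Page
  T : ℕ
  A₀ : Finset Page
  B : ℕ → Finset Page
  pred : Predictor Page k
  two_le : 2 ≤ k
  card_init : A₀.card = k
  belady : IsBeladyRun r T A₀ B
  lev_mono : ∀ m n, 1 ≤ m → m ≤ n → lev m ≤ lev n

namespace Scenario

variable (X : Scenario Page)

/-- Belady's algorithm faults at request `t`. -/
def flt (t : ℕ) : Bool := decide (X.r t ∉ X.B t)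

/-- Number of Belady's faults. -/
def opt : ℕ := faults X.r X.T X.B

/-- Error of the prediction with index `t`. -/
def err (t : ℕ) : ℕ := (X.B t \ X.pred.state t).card

/-- The phase bookkeeping after `t` requests. -/
def ph : ℕ → Phase Page
  | 0 => ⟨∅, 0, 0, 0, 0⟩
  | t + 1 => (ph t).next X.k X.lev (X.r t) (X.flt t)

/-- Marked pages after `t` requests. -/
def M (t : ℕ) : Finset Page := (X.ph t).marked

/-- Request `t` starts a phase. -/
def Starts (t : ℕ) : Prop := (X.ph t).Starts X.k (X.r t)

instance (t : ℕ) : Decidable (X.Starts t) := inferInstanceAs (Decidable (Phase.Starts _ _ _))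

/-- Request `t` starts a window. -/
def StartsWindow (t : ℕ) : Prop := (X.ph t).StartsWindow X.k X.lev (X.r t)

instance (t : ℕ) : Decidable (X.StartsWindow t) :=
  inferInstanceAs (Decidable (Phase.StartsWindow _ _ _ _))

/-- The phase of request `s`. -/
def idx (s : ℕ) : ℕ := (X.ph (s + 1)).idx

/-- The window of request `s`. -/
def win (s : ℕ) : ℕ := (X.ph (s + 1)).win

/-- Number of pages that remained to be marked in the phase just before the request `s`, if this
request marks a page. -/
def rem (s : ℕ) : ℕ := X.k + 1 - (X.M (s + 1)).card

/-- Upper bound, known at time `t`, on the number of pages by which the caches differ. -/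
def quota (t : ℕ) : ℕ := 2 * (X.ph (t + 1)).prev + (X.ph (t + 1)).cur

/-- At request `t` a window starts, and the predictor is queried for this reason. -/
def Sync (t : ℕ) : Prop := X.StartsWindow t ∧ 0 < X.quota t

instance (t : ℕ) : Decidable (X.Sync t) := inferInstanceAs (Decidable (_ ∧ _))

/-- Belady's pages just before request `s` that have not been requested in the phase. -/
def fresh (s : ℕ) : Finset Page := X.B s \ (if X.Starts s then ∅ else X.M s)

/-- Requests from time `t` on that are the first ones to their page in the phase and that are not
faults of Belady's algorithm. -/
def slots (t : ℕ) : Finset ℕ := (Finset.Ico t X.T).filter fun s => X.r s ∈ X.fresh s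

/-- Total quota of a phase. -/
def g (i : ℕ) : ℕ :=
  2 * ((Finset.range X.T).filter fun τ => X.flt τ ∧ X.idx τ + 1 = i).card +
    ((Finset.range X.T).filter fun τ => X.flt τ ∧ X.idx τ = i).card

/-- Error of the query made at the start of the window of request `s`. -/
def base (s : ℕ) : ℕ :=
  ∑ τ ∈ (Finset.range X.T).filter (fun τ => X.Sync τ ∧ X.win τ = X.win s), X.err (τ + 1)

/-- Total error of the queries made at the starts of the windows. -/
def syncErr : ℕ := ∑ τ ∈ (Finset.range X.T).filter X.Sync, X.err (τ + 1)

theorem lazyRun : IsLazyRun X.r X.T X.A₀ X.B := X.belady.isLazyRun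

theorem card_B {t : ℕ} (ht : t ≤ X.T) : (X.B t).card = X.k := by
  rw [X.lazyRun.card_eq t ht, X.card_init]

variable {X}

theorem M_succ_of_starts {t : ℕ} (h : X.Starts t) : X.M (t + 1) = {X.r t} := by
  have h' : (X.ph t).Starts X.k (X.r t) := h
  simp [M, ph, Phase.next, Phase.mark, h']

theorem M_succ_of_not {t : ℕ} (h : ¬X.Starts t) : X.M (t + 1) = insert (X.r t) (X.M t) := by
  have h' : ¬(X.ph t).Starts X.k (X.r t) := h
  simp [M, ph, Phase.next, Phase.mark, h']

theorem mem_M_succ (t : ℕ) : X.r t ∈ X.M (t + 1) := by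
  by_cases h : X.Starts t
  · simp [M_succ_of_starts h]
  · simp [M_succ_of_not h]

theorem card_M_le (t : ℕ) : (X.M t).card ≤ X.k := by
  induction t with
  | zero => simp [M, ph]
  | succ t ih =>
    by_cases h : X.Starts t
    · rw [M_succ_of_starts h]; simpa using le_trans (by norm_num) X.two_le
    · rw [M_succ_of_not h]
      by_cases hm : X.r t ∈ X.M t
      · rwa [Finset.insert_eq_self.2 hm]
      · rw [Finset.card_insert_of_notMem hm]
        have : (X.M t).card ≠ X.k := fun h' => h ⟨hm, h'⟩
        omega

theorem card_M_succ_pos (t : ℕ) : 0 < (X.M (t + 1)).card :=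
  Finset.card_pos.2 ⟨_, mem_M_succ t⟩

theorem rem_pos (s : ℕ) : 1 ≤ X.rem s := by
  have := card_M_le (X := X) (s + 1)
  unfold rem; omega

theorem rem_le (s : ℕ) : X.rem s ≤ X.k := by
  have := card_M_succ_pos (X := X) s
  unfold rem; omega

theorem ph_idx_succ (t : ℕ) :
    (X.ph (t + 1)).idx = if X.Starts t then (X.ph t).idx + 1 else (X.ph t).idx := rfl

theorem ph_win_succ (t : ℕ) :
    (X.ph (t + 1)).win = if X.StartsWindow t then (X.ph t).win + 1 else (X.ph t).win := rfl

theorem ph_prev_succ (t : ℕ) :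
    (X.ph (t + 1)).prev = if X.Starts t then (X.ph t).cur else (X.ph t).prev := rfl

theorem ph_cur_succ (t : ℕ) :
    (X.ph (t + 1)).cur = (if X.Starts t then 0 else (X.ph t).cur) + (X.flt t).toNat := rfl

theorem ph_idx_mono : Monotone fun t => (X.ph t).idx :=
  monotone_nat_of_le_succ fun t => by simp only [ph_idx_succ]; split_ifs <;> omega

theorem ph_win_mono : Monotone fun t => (X.ph t).win :=
  monotone_nat_of_le_succ fun t => by simp only [ph_win_succ]; split_ifs <;> omega

theorem Starts.startsWindow {t : ℕ} (h : X.Starts t) : X.StartsWindow t := by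
  refine ⟨h.1, Or.inl ?_⟩
  have := M_succ_of_starts h
  simp only [M, ph, Phase.next] at this
  rw [this]; simp

theorem not_starts_of_idx {t : ℕ} (h : (X.ph (t + 1)).idx = (X.ph t).idx) : ¬X.Starts t := by
  intro h'
  rw [ph_idx_succ, if_pos h'] at h
  omega

/-- Induction along the requests of one phase. -/
theorem phase_induction {t : ℕ} {P : ℕ → Prop} (h0 : P t)
    (h1 : ∀ s, t ≤ s → (X.ph s).idx = (X.ph t).idx → ¬X.Starts s → P s → P (s + 1)) :
    ∀ s, t ≤ s → (X.ph s).idx = (X.ph t).idx → P s := by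
  intro s hs
  induction s, hs using Nat.le_induction with
  | base => exact fun _ => h0
  | succ s hs ih =>
    intro h
    have h2 : (X.ph t).idx ≤ (X.ph s).idx := ph_idx_mono hs
    have h3 : (X.ph s).idx ≤ (X.ph (s + 1)).idx := ph_idx_mono (Nat.le_succ s)
    have h4 : (X.ph s).idx = (X.ph t).idx := by omega
    exact h1 s hs h4 (not_starts_of_idx (by omega)) (ih h4)

theorem M_subset {t s : ℕ} (hts : t ≤ s) (h : (X.ph s).idx = (X.ph t).idx) : X.M t ⊆ X.M s :=
  phase_induction (P := fun s => X.M t ⊆ X.M s) (Finset.Subset.refl _)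
    (fun s _ _ hn ih => by
      rw [M_succ_of_not hn]
      exact ih.trans (Finset.subset_insert _ _)) s hts h

theorem B_succ_sdiff_subset {t : ℕ} (ht : t < X.T) : X.B (t + 1) \ X.M (t + 1) ⊆ X.fresh t := by
  intro x hx
  rw [Finset.mem_sdiff] at hx
  have hne : x ≠ X.r t := fun h => hx.2 (h ▸ mem_M_succ t)
  have h1 := Finset.mem_insert.1 (X.lazyRun.succ_subset ht hx.1)
  refine Finset.mem_sdiff.2 ⟨h1.resolve_left hne, ?_⟩
  split_ifs with h
  · simp
  · intro h2
    exact hx.2 (by rw [M_succ_of_not h]; exact Finset.mem_insert_of_mem h2)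

theorem fresh_of_not {t : ℕ} (h : ¬X.Starts t) : X.fresh t = X.B t \ X.M t := by
  simp [fresh, h]

theorem B_sdiff_subset {t s : ℕ} (hts : t ≤ s) (hs : s ≤ X.T)
    (h : (X.ph s).idx = (X.ph t).idx) : X.B s \ X.M s ⊆ X.B t \ X.M t :=
  phase_induction (P := fun s => s ≤ X.T → X.B s \ X.M s ⊆ X.B t \ X.M t)
    (fun _ => Finset.Subset.refl _)
    (fun s _ _ hn ih hs => by
      have := B_succ_sdiff_subset hs
      rw [fresh_of_not hn] at this
      exact this.trans (ih (by omega))) s hts h hs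

/-- The pages that are fresh later in the phase are among Belady's unmarked pages now. -/
theorem fresh_subset {t s : ℕ} (hts : t ≤ s) (hs : s < X.T)
    (h : X.idx s = (X.ph t).idx) : X.fresh s ⊆ X.B t \ X.M t := by
  have h2 : (X.ph t).idx ≤ (X.ph s).idx := ph_idx_mono hts
  have h3 : (X.ph s).idx ≤ (X.ph (s + 1)).idx := ph_idx_mono (Nat.le_succ s)
  unfold idx at h
  rw [fresh_of_not (not_starts_of_idx (by omega))]
  exact B_sdiff_subset hts hs.le (by omega)

/-- Within a phase fresh pages only disappear: Belady loads nothing but requested pages, and those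
become marked. -/
theorem fresh_subset_erase {t s : ℕ} (hts : t < s) (hs : s < X.T) (h : X.idx s = X.idx t) :
    X.fresh s ⊆ (X.fresh t).erase (X.r t) := by
  have h1 := fresh_subset (t := t + 1) hts hs h
  intro x hx
  refine Finset.mem_erase.2 ⟨?_, B_succ_sdiff_subset (by omega) (h1 hx)⟩
  rintro rfl
  exact (Finset.mem_sdiff.1 (h1 hx)).2 (mem_M_succ t)

theorem not_mem_M_of_fresh {s : ℕ} (h : X.r s ∈ X.fresh s) (hn : ¬X.Starts s) :
    X.r s ∉ X.M s := by
  rw [fresh_of_not hn] at h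
  exact (Finset.mem_sdiff.1 h).2

/-- Belady holds k pages, and at most as many of them are marked as there are marked pages. This is
what makes 2 / `rem` a sufficient weight in the slot potential. -/
theorem rem_le_card_fresh {s : ℕ} (hs : s < X.T) (h : X.r s ∈ X.fresh s) :
    X.rem s ≤ (X.fresh s).card := by
  by_cases hn : X.Starts s
  · rw [rem, M_succ_of_starts hn, fresh, if_pos hn, Finset.sdiff_empty, X.card_B hs.le]
    simp
  · have hm := not_mem_M_of_fresh h hn
    rw [rem, M_succ_of_not hn, fresh_of_not hn, Finset.card_insert_of_notMem hm]
    have := Finset.le_card_sdiff (X.M s) (X.B s)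
    rw [X.card_B hs.le] at this
    omega

theorem rem_lt_rem {s s' : ℕ} (hss : s < s') (h : X.idx s' = X.idx s)
    (hm : X.r s' ∉ X.M s') : X.rem s' < X.rem s := by
  have h2 : (X.ph (s + 1)).idx ≤ (X.ph s').idx := ph_idx_mono hss
  have h3 : (X.ph s').idx ≤ (X.ph (s' + 1)).idx := ph_idx_mono (Nat.le_succ s')
  unfold idx at h
  have h4 := Finset.card_le_card (M_subset (X := X) (t := s + 1) (s := s') hss (by omega))
  have hn : ¬X.Starts s' := not_starts_of_idx (by omega)
  have := card_M_le (X := X) (s' + 1)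
  unfold rem
  rw [M_succ_of_not hn, Finset.card_insert_of_notMem hm] at *
  omega

theorem rem_lt_rem_of_fresh {s s' : ℕ} (hss : s < s') (h : X.idx s' = X.idx s)
    (hm : X.r s' ∈ X.fresh s') : X.rem s' < X.rem s := by
  refine rem_lt_rem hss h (not_mem_M_of_fresh hm ?_)
  have h2 : (X.ph (s + 1)).idx ≤ (X.ph s').idx := ph_idx_mono hss
  have h3 : (X.ph s').idx ≤ (X.ph (s' + 1)).idx := ph_idx_mono (Nat.le_succ s')
  unfold idx at h
  exact not_starts_of_idx (by omega)

theorem idx_le_of_lt {τ t : ℕ} (h : τ < t) : X.idx τ ≤ (X.ph t).idx := ph_idx_mono h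

theorem cur_eq (t : ℕ) :
    (X.ph t).cur =
      ((Finset.range t).filter fun τ => X.flt τ ∧ X.idx τ = (X.ph t).idx).card := by
  induction t with
  | zero => rfl
  | succ t ih =>
    rw [Finset.range_add_one, Finset.filter_insert, ph_cur_succ]
    have e : X.idx t = (X.ph (t + 1)).idx := rfl
    by_cases hs : X.Starts t
    · have : (Finset.range t).filter (fun τ => X.flt τ ∧ X.idx τ = (X.ph (t + 1)).idx) = ∅ := by
        refine Finset.filter_eq_empty_iff.2 fun τ hτ h => ?_
        have := idx_le_of_lt (X := X) (Finset.mem_range.1 hτ)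
        rw [h.2, ph_idx_succ, if_pos hs] at this
        omega
      rw [this]
      cases hf : X.flt t <;> simp [e, hs]
    · have e2 : (X.ph (t + 1)).idx = (X.ph t).idx := by rw [ph_idx_succ, if_neg hs]
      rw [e2, if_neg hs, ih]
      cases hf : X.flt t <;> simp [e, e2]

theorem prev_eq (t : ℕ) :
    (X.ph t).prev =
      ((Finset.range t).filter fun τ => X.flt τ ∧ X.idx τ + 1 = (X.ph t).idx).card := by
  induction t with
  | zero => rfl
  | succ t ih =>
    rw [Finset.range_add_one, Finset.filter_insert, ph_prev_succ]
    have e : ¬(X.idx t + 1 = (X.ph (t + 1)).idx) := by unfold idx; omega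
    rw [if_neg (fun h : X.flt t ∧ X.idx t + 1 = (X.ph (t + 1)).idx => e h.2)]
    by_cases hs : X.Starts t
    · rw [if_pos hs, cur_eq]
      simp only [ph_idx_succ, if_pos hs, Nat.add_right_cancel_iff]
    · simp only [ph_idx_succ, if_neg hs]
      exact ih

theorem quota_le_g {t : ℕ} (ht : t < X.T) : X.quota t ≤ X.g (X.idx t) := by
  have hsub : ∀ P : ℕ → Prop, [DecidablePred P] →
      ((Finset.range (t + 1)).filter P).card ≤ ((Finset.range X.T).filter P).card :=
    fun P _ => Finset.card_le_card
      (Finset.filter_subset_filter _ (Finset.range_subset_range.2 ht))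
  unfold quota g
  rw [cur_eq, prev_eq]
  exact add_le_add (Nat.mul_le_mul_left _ (hsub _)) (hsub _)

/-- A requested page is in Belady's cache right after its request, and each Belady fault of the
phase removes only one page. -/
theorem card_M_sdiff_B {t : ℕ} (ht : t ≤ X.T) : (X.M t \ X.B t).card ≤ (X.ph t).cur := by
  induction t with
  | zero => simp [M, ph]
  | succ t ih =>
    have hr := X.lazyRun.mem_succ ht
    rw [ph_cur_succ]
    by_cases hs : X.Starts t
    · rw [M_succ_of_starts hs, Finset.sdiff_eq_empty_iff_subset.2 (by simpa using hr)]
      simp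
    · have : X.M (t + 1) \ X.B (t + 1) ⊆ (X.M t \ X.B t) ∪ (X.B t \ X.B (t + 1)) := by
        intro x hx
        rw [M_succ_of_not hs] at hx
        simp only [Finset.mem_sdiff, Finset.mem_insert, Finset.mem_union] at hx ⊢
        rcases hx with ⟨rfl | h1, h2⟩
        · exact absurd hr h2
        · by_cases h3 : x ∈ X.B t <;> simp_all
      have h1 := (Finset.card_le_card this).trans (Finset.card_union_le _ _)
      have h2 := X.lazyRun.card_sdiff_succ_le (t := t) ht
      have h3 := ih (by omega)
      rw [if_neg hs]
      unfold flt
      omega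

theorem lev_rem_succ {t : ℕ} (h : ¬X.StartsWindow (t + 1)) :
    X.lev (X.rem (t + 1)) = X.lev (X.rem t) := by
  have hn : ¬X.Starts (t + 1) := fun h' => h h'.startsWindow
  have hM := M_succ_of_not hn
  by_cases hm : X.r (t + 1) ∈ X.M (t + 1)
  · rw [Finset.insert_eq_self.2 hm] at hM
    rw [rem, hM, rem]
  · have hc : ((X.ph (t + 1)).mark X.k (X.r (t + 1))).card = (X.M (t + 1)).card + 1 := by
      have : (X.ph (t + 1)).mark X.k (X.r (t + 1)) = X.M (t + 1 + 1) := rfl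
      rw [this, hM, Finset.card_insert_of_notMem hm]
    have h' : ¬(_ ∨ _) := fun h' => h ⟨hm, h'⟩
    rw [hc, not_or, not_lt] at h'
    have hle := card_M_le (X := X) (t + 1 + 1)
    rw [hM, Finset.card_insert_of_notMem hm] at hle
    unfold rem
    rw [hM, Finset.card_insert_of_notMem hm]
    refine le_antisymm (X.lev_mono _ _ (by omega) (by omega)) ?_
    -- The offset 2 in `Phase.StartsWindow` recovers the value of `rem` before the present marking.
    have e : X.k + 2 - ((X.M (t + 1)).card + 1) = X.k + 1 - (X.M (t + 1)).card := by omega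
    rw [← e]
    exact h'.2

/-- A change of phase or of level would have started a new window in between. -/
theorem of_win_eq {s s' : ℕ} (hss : s ≤ s') (h : X.win s' = X.win s) :
    X.idx s' = X.idx s ∧ X.lev (X.rem s') = X.lev (X.rem s) := by
  induction s', hss using Nat.le_induction with
  | base => exact ⟨rfl, rfl⟩
  | succ t ht ih =>
    have h2 : X.win s ≤ X.win t := ph_win_mono (Nat.succ_le_succ ht)
    have h3 : X.win t ≤ X.win (t + 1) := ph_win_mono (Nat.le_succ _)
    have hw : ¬X.StartsWindow (t + 1) := by
      intro h'
      have : X.win (t + 1) = X.win t + 1 := by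
        unfold win; rw [ph_win_succ, if_pos h']
      omega
    obtain ⟨h4, h5⟩ := ih (by omega)
    refine ⟨?_, (lev_rem_succ hw).trans h5⟩
    rw [← h4]
    unfold idx
    rw [ph_idx_succ (t + 1), if_neg (fun h' => hw h'.startsWindow)]

theorem mem_slots {t s : ℕ} : s ∈ X.slots t ↔ (t ≤ s ∧ s < X.T) ∧ X.r s ∈ X.fresh s := by
  simp [slots]

/-- Every slot marks a new page, so `rem` strictly decreases along the slots of a phase. Sums over
slots thereby become sums over distinct integers. -/
theorem rem_injOn (i : ℕ) : Set.InjOn X.rem {s | X.r s ∈ X.fresh s ∧ X.idx s = i} := by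
  intro s hs s' hs' h
  by_contra hne
  rcases lt_or_gt_of_ne hne with hlt | hlt
  · exact absurd h (rem_lt_rem_of_fresh hlt (hs'.2.trans hs.2.symm) hs'.1).ne'
  · exact absurd h (rem_lt_rem_of_fresh hlt (hs.2.trans hs'.2.symm) hs.1).ne

/-- A sum over slots of one phase is at most the corresponding sum over the numbers of
remaining pages. -/
theorem sum_slots_le (i : ℕ) (S : Finset ℕ) (hS : ∀ s ∈ S, X.r s ∈ X.fresh s ∧ X.idx s = i)
    (R : Finset ℕ) (hR : ∀ s ∈ S, X.rem s ∈ R) (F : ℕ → ℝ) (hF : ∀ m, 0 ≤ F m) :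
    ∑ s ∈ S, F (X.rem s) ≤ ∑ m ∈ R, F m := by
  rw [← Finset.sum_image (f := F) (g := X.rem) (s := S)
    (fun a ha b hb h => rem_injOn i (hS a ha) (hS b hb) h)]
  exact Finset.sum_le_sum_of_subset_of_nonneg
    (fun m hm => by obtain ⟨s, hs, rfl⟩ := Finset.mem_image.1 hm; exact hR s hs)
    (fun m _ _ => hF m)

/-- The slots of a window share their phase and their level, and their `rem` values are distinct; so
the harmonic sum over a single level suffices. -/
theorem sum_window_le {μ : ℕ} {w : ℝ} (v : ℕ)
    (hw : ∀ n, ∑ m ∈ (Finset.Icc 1 X.k).filter (fun m => μ ≤ m ∧ X.lev m = n), (1 / m : ℝ) ≤ w)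
    (hw0 : 0 ≤ w) (S : Finset ℕ)
    (hS : ∀ s ∈ S, X.r s ∈ X.fresh s ∧ X.win s = v ∧ μ ≤ X.rem s) :
    ∑ s ∈ S, (1 / X.rem s : ℝ) ≤ w := by
  rcases S.eq_empty_or_nonempty with rfl | ⟨s₀, h₀⟩
  · simpa using hw0
  have key : ∀ s ∈ S, X.idx s = X.idx s₀ ∧ X.lev (X.rem s) = X.lev (X.rem s₀) := by
    intro s hs
    rcases le_total s₀ s with h | h
    · exact of_win_eq h ((hS s hs).2.1.trans (hS s₀ h₀).2.1.symm)
    · have := of_win_eq h ((hS s₀ h₀).2.1.trans (hS s hs).2.1.symm)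
      exact ⟨this.1.symm, this.2.symm⟩
  refine (sum_slots_le (X.idx s₀) S (fun s hs => ⟨(hS s hs).1, (key s hs).1⟩) _
    (fun s hs => ?_) (fun m => (1 / m : ℝ)) (fun m => by positivity)).trans
    (hw (X.lev (X.rem s₀)))
  simp only [Finset.mem_filter, Finset.mem_Icc]
  exact ⟨⟨rem_pos s, rem_le s⟩, (hS s hs).2.2, (key s hs).2⟩

theorem sum_phase_le {μ : ℕ} {H : ℝ} (i : ℕ)
    (hH : ∑ m ∈ (Finset.Icc 1 X.k).filter (fun m => m < μ), (1 / m : ℝ) ≤ H) (S : Finset ℕ)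
    (hS : ∀ s ∈ S, X.r s ∈ X.fresh s ∧ X.idx s = i ∧ X.rem s < μ) :
    ∑ s ∈ S, (1 / X.rem s : ℝ) ≤ H := by
  refine (sum_slots_le i S (fun s hs => ⟨(hS s hs).1, (hS s hs).2.1⟩) _
    (fun s hs => ?_) (fun m => (1 / m : ℝ)) (fun m => by positivity)).trans hH
  simp only [Finset.mem_filter, Finset.mem_Icc]
  exact ⟨⟨rem_pos s, rem_le s⟩, (hS s hs).2.2⟩

theorem opt_eq : X.opt = ((Finset.range X.T).filter fun τ => X.flt τ).card := by
  simp [opt, faults, flt]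

/-- A sum over requests weighted with the total quota of their phases. -/
theorem sum_mul_g_le {c : ℝ} (F : ℕ → ℝ) (S : Finset ℕ)
    (h : ∀ i, ∑ s ∈ S.filter (fun s => X.idx s = i), F s ≤ c) :
    ∑ s ∈ S, F s * X.g (X.idx s) ≤ 3 * c * X.opt := by
  -- A Belady fault counts once in the quota of its own phase and twice in that of the next.
  -- Exchanging the sums therefore charges it c + 2c.
  have e : ∀ s, (X.g (X.idx s) : ℝ) =
      ∑ τ ∈ (Finset.range X.T).filter (fun τ => X.flt τ),
        (2 * (if X.idx s = X.idx τ + 1 then 1 else 0) + if X.idx s = X.idx τ then 1 else 0) := by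
    intro s
    rw [Finset.sum_add_distrib, ← Finset.mul_sum, Finset.sum_boole, Finset.sum_boole,
      Finset.filter_filter, Finset.filter_filter]
    simp only [g, Nat.cast_add, Nat.cast_mul, Nat.cast_ofNat, eq_comm (a := X.idx s)]
  calc ∑ s ∈ S, F s * X.g (X.idx s)
      = ∑ τ ∈ (Finset.range X.T).filter (fun τ => X.flt τ),
        (2 * ∑ s ∈ S.filter (fun s => X.idx s = X.idx τ + 1), F s +
          ∑ s ∈ S.filter (fun s => X.idx s = X.idx τ), F s) := by
        simp_rw [e, Finset.mul_sum]
        rw [Finset.sum_comm]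
        refine Finset.sum_congr rfl fun τ _ => ?_
        rw [Finset.sum_filter, Finset.sum_filter, ← Finset.sum_add_distrib]
        refine Finset.sum_congr rfl fun s _ => ?_
        split_ifs <;> ring
    _ ≤ ∑ τ ∈ (Finset.range X.T).filter (fun τ => X.flt τ), 3 * c :=
        Finset.sum_le_sum fun τ _ => by linarith [h (X.idx τ + 1), h (X.idx τ)]
    _ = 3 * c * X.opt := by rw [Finset.sum_const, opt_eq, nsmul_eq_mul, mul_comm]

/-- Along the window starts of a phase the level of `rem` strictly decreases, and it lies between 0
and the level of k. -/
theorem card_startsWindow_le (i : ℕ) :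
    ((Finset.range X.T).filter fun τ => X.StartsWindow τ ∧ X.idx τ = i).card ≤ X.lev X.k + 1 := by
  have key : ∀ s s', s < s' → X.StartsWindow s' → X.idx s' = X.idx s →
      X.lev (X.rem s') < X.lev (X.rem s) := by
    intro s s' hss hw hi
    have h1 := rem_lt_rem hss hi hw.1
    rcases hw.2 with h2 | h2
    -- A single marked page after s' would mean that `rem` is k again, although it has dropped since
    -- s.
    · exfalso
      have : X.rem s' = X.k := by
        have : (X.M (s' + 1)).card = 1 := h2
        unfold rem; omega
      have := rem_le (X := X) s
      omega
    · refine lt_of_lt_of_le h2 (X.lev_mono _ _ ?_ ?_)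
      · have : ((X.ph s').mark X.k (X.r s')).card ≤ X.k := card_M_le (X := X) (s' + 1)
        omega
      · have e : X.rem s' = X.k + 1 - ((X.ph s').mark X.k (X.r s')).card := rfl
        have : ((X.ph s').mark X.k (X.r s')).card ≤ X.k := card_M_le (X := X) (s' + 1)
        omega
  rw [← Finset.card_range (X.lev X.k + 1)]
  refine Finset.card_le_card_of_injOn (fun s => X.lev (X.rem s)) ?_ ?_
  · intro s _
    simp only [Finset.coe_range, Set.mem_Iio]
    exact Nat.lt_succ_of_le (X.lev_mono _ _ (rem_pos s) (rem_le s))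
  · intro s hs s' hs' h
    simp only [Finset.coe_filter, Set.mem_ofPred_eq] at hs hs'
    by_contra hne
    rcases lt_or_gt_of_ne hne with hlt | hlt
    · exact absurd h (key _ _ hlt hs'.2.1 (hs'.2.2.trans hs.2.2.symm)).ne'
    · exact absurd h (key _ _ hlt hs.2.1 (hs.2.2.trans hs'.2.2.symm)).ne

/-- The total number of pages asked for at the starts of the windows. -/
theorem sum_quota_le :
    ∑ τ ∈ (Finset.range X.T).filter X.Sync, (X.quota τ : ℝ) ≤ 3 * (X.lev X.k + 1) * X.opt := by
  refine (Finset.sum_le_sum (g := fun τ => (1 : ℝ) * X.g (X.idx τ)) fun τ hτ => ?_).trans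
    (sum_mul_g_le (fun _ => 1) _ fun i => ?_)
  · rw [one_mul]
    exact_mod_cast quota_le_g (Finset.mem_range.1 (Finset.mem_filter.1 hτ).1)
  · rw [Finset.sum_const, nsmul_eq_mul, mul_one, Finset.filter_filter]
    have h : ((Finset.range X.T).filter fun τ => X.Sync τ ∧ X.idx τ = i).card ≤ X.lev X.k + 1 :=
      (Finset.card_le_card fun τ hτ => by
        simp only [Finset.mem_filter] at hτ ⊢
        exact ⟨hτ.1, hτ.2.1.1, hτ.2.2⟩).trans (card_startsWindow_le i)
    exact_mod_cast h

variable (X) in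
/-- The potential allotted to a slot of a future phase. -/
noncomputable def fund (μ s : ℕ) : ℝ :=
  if X.rem s < 2 * X.g (X.idx s) then 1
  else 2 / X.rem s * (if X.rem s < μ then X.g (X.idx s) else 6 * X.base s : ℕ)

theorem fund_nonneg (μ s : ℕ) : 0 ≤ X.fund μ s := by
  unfold fund; split_ifs <;> positivity

/-- By injectivity of `rem`, a phase with total quota g has at most 2g slots below 2g. Writing 1 as
(1/g)·g makes this an instance of `sum_mul_g_le` with c = 2. -/
theorem card_low_slots_le :
    (((X.slots 0).filter fun s => X.rem s < 2 * X.g (X.idx s)).card : ℝ) ≤ 6 * X.opt := by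
  have hpos : ∀ s ∈ (X.slots 0).filter fun s => X.rem s < 2 * X.g (X.idx s),
      (1 : ℝ) = 1 / X.g (X.idx s) * X.g (X.idx s) := by
    intro s hs
    have : 0 < X.g (X.idx s) := by
      by_contra h
      have h2 := (Finset.mem_filter.1 hs).2
      omega
    have : (X.g (X.idx s) : ℝ) ≠ 0 := by positivity
    field_simp
  rw [Finset.card_eq_sum_ones, Nat.cast_sum, Nat.cast_one, Finset.sum_congr rfl hpos]
  have := sum_mul_g_le (X := X) (c := 2) (fun s => (1 / X.g (X.idx s) : ℝ))
    ((X.slots 0).filter fun s => X.rem s < 2 * X.g (X.idx s)) ?_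
  · linarith
  intro i
  have h1 : ∀ s ∈ ((X.slots 0).filter fun s => X.rem s < 2 * X.g (X.idx s)).filter
      (fun s => X.idx s = i), (1 / X.g (X.idx s) : ℝ) = (1 / X.g i : ℝ) := by
    intro s hs
    rw [(Finset.mem_filter.1 hs).2]
  rw [Finset.sum_congr rfl h1, Finset.sum_const, nsmul_eq_mul]
  have h2 : (((X.slots 0).filter fun s => X.rem s < 2 * X.g (X.idx s)).filter
      (fun s => X.idx s = i)).card ≤ 2 * X.g i := by
    conv_rhs => rw [← Finset.card_range (2 * X.g i)]
    refine Finset.card_le_card_of_injOn X.rem ?_ ?_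
    · intro s hs
      simp only [Finset.coe_filter, Set.mem_ofPred_eq, Finset.mem_filter] at hs
      simp only [Finset.coe_range, Set.mem_Iio]
      rw [← hs.2]; exact hs.1.2
    · refine (rem_injOn i).mono fun s hs => ?_
      simp only [Finset.coe_filter, Set.mem_ofPred_eq, Finset.mem_filter, mem_slots] at hs
      exact ⟨hs.1.1.2, hs.2⟩
  rcases Nat.eq_zero_or_pos (X.g i) with h0 | h0
  · simp [h0]
  · rw [mul_one_div, div_le_iff₀ (by exact_mod_cast h0)]
    exact_mod_cast h2

/-- The three terms stem from the slots with `rem` < 2g, from those below μ, where the cap is the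
total quota of the phase, and from those above μ, where the cap comes from the error of the window's
first query. -/
theorem sum_fund_le {μ : ℕ} {H w : ℝ} (hw0 : 0 ≤ w)
    (hH : ∑ m ∈ (Finset.Icc 1 X.k).filter (fun m => m < μ), (1 / m : ℝ) ≤ H)
    (hw : ∀ n, ∑ m ∈ (Finset.Icc 1 X.k).filter (fun m => μ ≤ m ∧ X.lev m = n), (1 / m : ℝ) ≤ w) :
    ∑ s ∈ X.slots 0, X.fund μ s ≤ 6 * X.opt + 6 * H * X.opt + 12 * w * X.syncErr := by
  have h1 : ∀ s ∈ X.slots 0, X.fund μ s ≤ (if X.rem s < 2 * X.g (X.idx s) then 1 else 0) +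
      (if X.rem s < μ then 2 * (1 / X.rem s : ℝ) else 0) * X.g (X.idx s) +
      (if μ ≤ X.rem s then 12 * (1 / X.rem s : ℝ) * X.base s else 0) := by
    intro s _
    unfold fund
    have ha : (0 : ℝ) ≤ 1 / X.rem s := by positivity
    by_cases h : X.rem s < 2 * X.g (X.idx s)
    · rw [if_pos h, if_pos h]
      have : 0 ≤ (if X.rem s < μ then 2 * (1 / X.rem s : ℝ) else 0) * X.g (X.idx s) := by
        split_ifs <;> positivity
      have : 0 ≤ (if μ ≤ X.rem s then 12 * (1 / X.rem s : ℝ) * X.base s else 0) := by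
        split_ifs <;> positivity
      linarith
    · rw [if_neg h, if_neg h]
      by_cases h' : X.rem s < μ
      · rw [if_pos h', if_pos h', if_neg (by omega)]
        apply le_of_eq; ring
      · rw [if_neg h', if_neg h', if_pos (by omega)]
        apply le_of_eq; push_cast; ring
  refine (Finset.sum_le_sum h1).trans ?_
  rw [Finset.sum_add_distrib, Finset.sum_add_distrib]
  refine add_le_add (add_le_add ?_ ?_) ?_
  · rw [Finset.sum_boole]
    exact card_low_slots_le
  · refine (sum_mul_g_le (c := 2 * H) _ _ fun i => ?_).trans
      (le_of_eq (by ring))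
    rw [← Finset.sum_filter, ← Finset.mul_sum]
    refine mul_le_mul_of_nonneg_left ?_ (by norm_num)
    refine sum_phase_le i hH _ fun s hs => ?_
    simp only [Finset.mem_filter, mem_slots] at hs
    exact ⟨hs.1.1.2, hs.1.2, hs.2⟩
  -- Exchanging the sums attaches to each window query the slots of its window, whose harmonic
  -- weight is at most w.
  · have e : ∀ s, (X.base s : ℝ) = ∑ τ ∈ (Finset.range X.T).filter X.Sync,
        if X.win s = X.win τ then (X.err (τ + 1) : ℝ) else 0 := by
      intro s
      rw [← Finset.sum_filter, Finset.filter_filter]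
      simp only [base, Nat.cast_sum, eq_comm (a := X.win s)]
    rw [← Finset.sum_filter]
    simp_rw [e, Finset.mul_sum]
    rw [Finset.sum_comm, syncErr, Nat.cast_sum, Finset.mul_sum]
    refine Finset.sum_le_sum fun τ _ => ?_
    simp_rw [mul_ite, mul_zero]
    rw [← Finset.sum_filter, ← Finset.sum_mul, ← Finset.mul_sum]
    refine mul_le_mul_of_nonneg_right ?_ (by positivity)
    refine mul_le_mul_of_nonneg_left ?_ (by norm_num)
    refine sum_window_le (X.win τ) hw hw0 _ fun s hs => ?_
    simp only [Finset.mem_filter, mem_slots] at hs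
    exact ⟨hs.1.1.2, hs.2, hs.1.2⟩

end Scenario

end Phases

/-! ### The algorithm, and expectations over its executions -/

section Algorithm

variable {Page : Type u} [DecidableEq Page]

/-- The memory of the algorithm. -/
structure Memory (Page : Type u) where
  /-- initial cache content -/
  init : Finset Page
  /-- requests so far -/
  hist : List Page
  phase : Phase Page
  /-- own cache content -/
  cache : Finset Page
  /-- candidates for eviction, as reported by the predictor -/
  cand : Finset Page
  /-- candidates that were evicted in this phase and not loaded again -/
  dropped : Finset Page
  /-- number of Belady's faults since the last query -/
  pending : ℕ
  /-- index of the prediction and number of requested pages, for the queries of this window -/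
  log : List (ℕ × ℕ)
  /-- whether there was a fault in this phase that Belady's algorithm avoided -/
  bad : Bool

namespace Memory

/-- Evict `q` in favour of the request `p`. -/
def evict (m : Memory Page) (p q : Page) (dropped : Finset Page) (flt : Bool) : Memory Page :=
  { m with
    cache := insert p (m.cache.erase q)
    cand := m.cand.erase q
    dropped := dropped
    bad := m.bad || !flt }

/-- Bookkeeping before the request `p` is served. A new phase that follows a phase with avoidable
faults starts with the pages requested in the latter. -/
def advance (k : ℕ) (lev : ℕ → ℕ) (m : Memory Page) (p : Page) (flt : Bool) : Memory Page :=
  { m with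
    hist := m.hist ++ [p]
    phase := m.phase.next k lev p flt
    cache := if m.phase.Starts k p ∧ m.bad = true then m.phase.marked else m.cache
    cand := m.cand.erase p
    dropped := if m.phase.Starts k p then ∅ else m.dropped
    pending := m.pending + flt.toNat
    bad := if m.phase.Starts k p then false else m.bad }

/-- Replace the candidates for eviction. -/
def refresh (m : Memory Page) (cand : Finset Page) (log : List (ℕ × ℕ)) : Memory Page :=
  { m with cand := cand, pending := 0, log := log }

/-- Number of pages to ask for at the start of a window. -/
def quota (m : Memory Page) : ℕ := 2 * m.phase.prev + m.phase.cur

/-- An additional query is due because of Belady's faults since the last query. -/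
def NeedsPatch (m : Memory Page) (p : Page) : Prop :=
  p ∉ m.cache ∧ 1 ≤ m.pending ∧ m.cand.card ≤ m.pending

instance (m : Memory Page) (p : Page) : Decidable (m.NeedsPatch p) :=
  inferInstanceAs (Decidable (_ ∧ _))

/-- The request `p` is served by evicting a candidate. -/
def UsesCand (m : Memory Page) (p : Page) (flt : Bool) : Prop :=
  m.cand.Nonempty ∧ (flt = true ∨ p ∉ m.dropped)

instance (m : Memory Page) (p : Page) (flt : Bool) : Decidable (m.UsesCand p flt) :=
  inferInstanceAs (Decidable (_ ∧ _))

/-- The pages among which the page to be evicted is chosen. -/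
def victims (m : Memory Page) (p : Page) (flt : Bool) : Finset Page :=
  if m.UsesCand p flt then m.cand else m.cache \ m.phase.marked

/-- The memory after the request `p` was served by evicting `q`. -/
def serveBy (m : Memory Page) (p : Page) (flt : Bool) (q : Page) : Memory Page :=
  m.evict p q
    (if m.UsesCand p flt then insert q (m.dropped.erase p) else m.dropped.erase p) flt

end Memory

variable {Mem : Type u}

/-- Continue with a uniformly random element of `S`. -/
noncomputable def draw (S : Finset Page) (next : Page → Prog Page Mem) (d : Prog Page Mem) :
    Prog Page Mem :=
  if h : S.Nonempty then
    .toss (S.card - 1) fun i =>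
      next (S.equivFin.symm (Fin.cast (Nat.sub_add_cancel (Finset.card_pos.2 h)) i))
  else d

/-- Perform the given swaps. -/
def swapAll (l : List (Page × Page)) (next : Prog Page Mem) : Prog Page Mem :=
  l.foldr (fun x acc => .swap x.1 x.2 acc) next

/-- Serve the request `p`. -/
noncomputable def serve (m : Memory Page) (p : Page) (flt : Bool) : Prog Page (Memory Page) :=
  if p ∈ m.cache then .done m
  else draw (m.victims p flt) (fun q => .swap p q (.done (m.serveBy p flt q))) (.done m)

/-- The swaps that make `M` the cache content. -/
noncomputable def cleanup (A M : Finset Page) : List (Page × Page) :=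
  List.zip (M \ A).toList (A \ M).toList

/-- Query the predictor if necessary, and serve the request `p`. -/
noncomputable def queryAndServe (lead : Bool) (m : Memory Page) (p : Page) (flt : Bool) :
    Prog Page (Memory Page) :=
  if lead = true then
    if m.quota = 0 then serve (m.refresh ∅ []) p flt
    else .query m.quota fun R => serve (m.refresh R [(m.hist.length, m.quota)]) p flt
  else if m.NeedsPatch p then
    .query (m.cand.card + m.pending) fun R =>
      serve (m.refresh R ((m.hist.length, m.cand.card + m.pending) :: m.log)) p flt
  else serve m p flt

/-- The caching algorithm for `k` pages; `lev` determines the windows. -/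
noncomputable def follower (Page : Type u) [DecidableEq Page] (k : ℕ) (lev : ℕ → ℕ) :
    OnlineAlgorithm Page where
  Mem := Memory Page
  init A₀ := ⟨A₀, [], ⟨∅, 0, 0, 0, 0⟩, A₀, ∅, ∅, 0, [], false⟩
  step m p :=
    swapAll (if m.phase.Starts k p ∧ m.bad = true then cleanup m.cache m.phase.marked else [])
      (queryAndServe (decide (m.phase.StartsWindow k lev p))
        (m.advance k lev p (beladyFaults m.init m.hist p)) p (beladyFaults m.init m.hist p))

/-- Expectation of a quantity with values in `[0, ∞]`. -/
noncomputable def mean {α : Type u} (μ : PMF α) (φ : α → ℝ≥0∞) : ℝ≥0∞ := ∑' a, μ a * φ a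

theorem mean_pure {α : Type u} (a : α) (φ : α → ℝ≥0∞) : mean (PMF.pure a) φ = φ a := by
  classical
  unfold mean
  rw [tsum_eq_single a (fun b hb => by simp [PMF.pure_apply, hb])]
  simp

theorem mean_bind {α β : Type u} (μ : PMF α) (ν : α → PMF β) (φ : β → ℝ≥0∞) :
    mean (μ.bind ν) φ = mean μ fun a => mean (ν a) φ := by
  unfold mean
  simp_rw [PMF.bind_apply, ← ENNReal.tsum_mul_right, ← ENNReal.tsum_mul_left]
  rw [ENNReal.tsum_comm]
  simp_rw [mul_assoc]

theorem mean_map {α β : Type u} (μ : PMF α) (h : α → β) (φ : β → ℝ≥0∞) :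
    mean (μ.map h) φ = mean μ fun a => φ (h a) := by
  rw [← PMF.bind_pure_comp, mean_bind]
  simp [mean_pure]

theorem mean_congr {α : Type u} {μ : PMF α} {φ ψ : α → ℝ≥0∞} (h : ∀ a ∈ μ.support, φ a = ψ a) :
    mean μ φ = mean μ ψ := by
  refine tsum_congr fun a => ?_
  by_cases ha : μ a = 0
  · simp [ha]
  · rw [h a ((PMF.mem_support_iff _ _).2 ha)]

theorem mean_mono {α : Type u} {μ : PMF α} {φ ψ : α → ℝ≥0∞} (h : ∀ a ∈ μ.support, φ a ≤ ψ a) :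
    mean μ φ ≤ mean μ ψ := by
  refine ENNReal.tsum_le_tsum fun a => ?_
  by_cases ha : μ a = 0
  · simp [ha]
  · exact mul_le_mul_right (h a ((PMF.mem_support_iff _ _).2 ha)) _

theorem mean_const {α : Type u} (μ : PMF α) (c : ℝ≥0∞) : mean μ (fun _ => c) = c := by
  simp [mean, ENNReal.tsum_mul_right, μ.tsum_coe]

theorem mean_add {α : Type u} (μ : PMF α) (φ ψ : α → ℝ≥0∞) :
    mean μ (fun a => φ a + ψ a) = mean μ φ + mean μ ψ := by
  simp only [mean, mul_add, ENNReal.tsum_add]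

theorem mean_const_mul {α : Type u} (μ : PMF α) (c : ℝ≥0∞) (φ : α → ℝ≥0∞) :
    mean μ (fun a => c * φ a) = c * mean μ φ := by
  unfold mean
  rw [← ENNReal.tsum_mul_left]
  simp_rw [mul_left_comm]

variable {k : ℕ} (pred : Predictor Page k) (t : ℕ)

theorem mean_exec_draw {S : Finset Page} (hS : S.Nonempty) (next : Page → Prog Page Mem)
    (d : Prog Page Mem) (c : Config Page) (φ : Mem × Config Page → ℝ≥0∞) :
    mean (exec pred t (draw S next d) c) φ =
      (∑ q ∈ S, mean (exec pred t (next q) c) φ) / S.card := by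
  have hc : S.card - 1 + 1 = S.card := Nat.sub_add_cancel (Finset.card_pos.2 hS)
  have h1 : ∀ (n : ℕ) (nx : Fin (n + 1) → Prog Page Mem),
      mean (exec pred t (.toss n nx) c) φ =
        (∑ i, mean (exec pred t (nx i) c) φ) / (n + 1 : ℕ) := by
    intro n nx
    rw [exec]
    unfold mean
    simp_rw [PMF.bind_apply, ← ENNReal.tsum_mul_right]
    rw [ENNReal.tsum_comm, tsum_fintype]
    simp_rw [PMF.uniformOfFintype_apply, mul_assoc, ENNReal.tsum_mul_left]
    rw [← Finset.mul_sum, Fintype.card_fin, mul_comm, ENNReal.div_eq_inv_mul, mul_comm]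
  unfold draw
  rw [dif_pos hS, h1]
  congr 1
  swap
  · rw [hc]
  rw [← Finset.sum_coe_sort S]
  exact Fintype.sum_equiv ((finCongr hc).trans S.equivFin.symm) _ _ fun i => rfl

theorem mem_support_exec_draw {S : Finset Page} (hS : S.Nonempty) (next : Page → Prog Page Mem)
    (d : Prog Page Mem) (c : Config Page) {y : Mem × Config Page}
    (hy : y ∈ (exec pred t (draw S next d) c).support) :
    ∃ q ∈ S, y ∈ (exec pred t (next q) c).support := by
  unfold draw at hy
  rw [dif_pos hS, exec, PMF.mem_support_bind_iff] at hy
  obtain ⟨i, -, hy⟩ := hy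
  exact ⟨_, Subtype.property _, hy⟩

theorem exec_swapAll (l : List (Page × Page)) (next : Prog Page Mem) (c : Config Page)
    (h1 : (l.map Prod.fst).Nodup) (h2 : (l.map Prod.snd).Nodup)
    (h3 : ∀ x ∈ l, x.1 ∉ c.cache) (h4 : ∀ x ∈ l, x.2 ∈ c.cache) :
    exec pred t (swapAll l next) c = exec pred t next
      { c with
        cache := (c.cache \ (l.map Prod.snd).toFinset) ∪ (l.map Prod.fst).toFinset
        cost := c.cost + l.length } := by
  induction l generalizing c with
  | nil => simp [swapAll]
  | cons x l ih =>
    have e : swapAll (x :: l) next = .swap x.1 x.2 (swapAll l next) := rfl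
    rw [e, exec, if_pos ⟨h3 x (by simp), h4 x (by simp)⟩]
    simp only [List.map_cons, List.nodup_cons] at h1 h2
    rw [ih _ h1.2 h2.2]
    · congr 2
      · ext y
        simp only [List.map_cons, List.toFinset_cons, Finset.mem_union, Finset.mem_sdiff,
          Finset.mem_insert, Finset.mem_erase, List.mem_toFinset]
        by_cases hy : y = x.1
        · subst hy
          by_cases hl : x.1 ∈ l.map Prod.snd
          · obtain ⟨z, hz, hz'⟩ := List.mem_map.1 hl
            exact absurd (hz' ▸ h4 z (by simp [hz])) (h3 x (by simp))
          · simp [hl]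
        · simp only [hy, false_or]; tauto
      · simp only [List.length_cons]; omega
    · intro y hy hm
      rcases Finset.mem_insert.1 hm with h | h
      · exact h1.1 (h ▸ List.mem_map_of_mem hy)
      · exact h3 y (by simp [hy]) (Finset.mem_of_mem_erase h)
    · intro y hy
      refine Finset.mem_insert_of_mem (Finset.mem_erase.2 ⟨?_, h4 y (by simp [hy])⟩)
      intro h
      exact h2.1 (h ▸ List.mem_map_of_mem hy)

theorem exec_cleanup {A M : Finset Page} (hc : M.card = A.card) (next : Prog Page Mem)
    (c : Config Page) (hA : c.cache = A) :
    exec pred t (swapAll (cleanup A M) next) c =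
      exec pred t next { c with cache := M, cost := c.cost + (M \ A).card } := by
  -- Equal sizes of the two differences ensure that `List.zip` truncates nothing.
  have hl : (M \ A).card = (A \ M).card := Finset.card_sdiff_comm hc
  have e1 : (cleanup A M).map Prod.fst = (M \ A).toList :=
    List.map_fst_zip (by simp [hl])
  have e2 : (cleanup A M).map Prod.snd = (A \ M).toList :=
    List.map_snd_zip (by simp [hl])
  rw [exec_swapAll]
  · rw [e1, e2, hA, Finset.toList_toFinset, Finset.toList_toFinset]
    have : (cleanup A M).length = (M \ A).card := by
      rw [← List.length_map (f := Prod.fst), e1, Finset.length_toList]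
    rw [this]
    congr 2
    ext x
    simp only [Finset.mem_union, Finset.mem_sdiff]
    tauto
  · rw [e1]; exact Finset.nodup_toList _
  · rw [e2]; exact Finset.nodup_toList _
  · intro x hx
    have : x.1 ∈ (cleanup A M).map Prod.fst := List.mem_map_of_mem hx
    rw [e1, Finset.mem_toList, Finset.mem_sdiff] at this
    rw [hA]; exact this.2
  · intro x hx
    have : x.2 ∈ (cleanup A M).map Prod.snd := List.mem_map_of_mem hx
    rw [e2, Finset.mem_toList, Finset.mem_sdiff] at this
    rw [hA]; exact this.1

end Algorithm

/-! ### The slot potential and its behaviour under evictions, queries and new phases -/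

section Potential

variable {Page : Type u} [DecidableEq Page]

namespace Scenario

variable (X : Scenario Page)

/-- Potential of the slot `s` in the current phase for the cache content `A`. -/
noncomputable def slotPot (s : ℕ) (A L : Finset Page) (θ : ℕ) : ℝ :=
  if X.rem s < 2 * X.g (X.idx s) then 1
  else if (X.fresh s \ A).card ≤ θ then
    (if X.r s ∉ A ∧ X.r s ∉ L then 1 else 0) + 2 / X.rem s * (θ - (X.fresh s \ A).card)
  else 0

/-- The number of misplaced pages up to which faults at the slot `s` are paid for in advance. -/
def cap (μ s cw e : ℕ) : ℕ :=
  if X.rem s < μ then X.g (X.idx s)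
  else min (X.g (X.idx s)) (6 * if X.win s = cw then e else X.base s)

/-- Potential of the slots from time `t` on, in phase `cp` and window `cw`. -/
noncomputable def pot (μ t cp cw : ℕ) (A L : Finset Page) (e : ℕ) : ℝ :=
  ∑ s ∈ X.slots t, if X.idx s = cp then X.slotPot s A L (X.cap μ s cw e) else X.fund μ s

variable {X}

theorem slotPot_nonneg (s : ℕ) (A L : Finset Page) (θ : ℕ) : 0 ≤ X.slotPot s A L θ := by
  unfold slotPot
  split_ifs with h1 h2 h3
  · norm_num
  all_goals
    try have : (0 : ℝ) ≤ θ - (X.fresh s \ A).card := sub_nonneg.2 (by exact_mod_cast h2)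
    positivity

theorem cap_le_g (μ s cw e : ℕ) : X.cap μ s cw e ≤ X.g (X.idx s) := by
  unfold cap; split_ifs
  · exact le_rfl
  all_goals exact min_le_left _ _

theorem slotPot_mono {s : ℕ} {A L : Finset Page} {θ θ' : ℕ} (h : θ ≤ θ') :
    X.slotPot s A L θ ≤ X.slotPot s A L θ' := by
  by_cases h2 : (X.fresh s \ A).card ≤ θ
  · unfold slotPot
    rw [if_pos h2, if_pos (h2.trans h)]
    split_ifs
    all_goals first | exact le_rfl | gcongr
  · have := slotPot_nonneg (X := X) s A L θ'
    unfold slotPot at this ⊢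
    rw [if_neg h2]
    split_ifs at this ⊢ <;> linarith

/-- Ignoring the misplaced pages, the linear part is at most the fund, and the indicator costs at
most 1, only if the slot's page is missing. This is the price of a slot's phase becoming the current
one. -/
theorem slotPot_le_fund {s : ℕ} {A L : Finset Page} (μ cw e : ℕ) (h : cw = X.win s → e ≤ X.base s) :
    X.slotPot s A L (X.cap μ s cw e) ≤ (if X.r s ∉ A then 1 else 0) + X.fund μ s := by
  have h0 : (0 : ℝ) ≤ if X.r s ∉ A then 1 else 0 := by split_ifs <;> norm_num
  have hcap : X.cap μ s cw e ≤ if X.rem s < μ then X.g (X.idx s) else 6 * X.base s := by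
    unfold cap
    split_ifs with h1 h2
    · exact le_rfl
    · exact (min_le_right _ _).trans (Nat.mul_le_mul_left _ (h h2.symm))
    · exact min_le_right _ _
  have hf := fund_nonneg (X := X) μ s
  unfold slotPot fund at *
  by_cases hlow : X.rem s < 2 * X.g (X.idx s)
  · rw [if_pos hlow, if_pos hlow]; linarith
  rw [if_neg hlow] at *
  rw [if_neg hlow]
  by_cases hc : (X.fresh s \ A).card ≤ X.cap μ s cw e
  · rw [if_pos hc]
    refine add_le_add ?_ (mul_le_mul_of_nonneg_left ?_ (by positivity))
    · split_ifs <;> simp_all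
    · have : (X.cap μ s cw e : ℝ) ≤
          ((if X.rem s < μ then X.g (X.idx s) else 6 * X.base s : ℕ) : ℝ) := by
        exact_mod_cast hcap
      have h3 : (0 : ℝ) ≤ ((X.fresh s \ A).card : ℝ) := by positivity
      linarith
  · rw [if_neg hc]; linarith

theorem fresh_sdiff_evict {s : ℕ} {A : Finset Page} {x q : Page} (hx : x ∉ X.fresh s)
    (hq : q ∈ A) : (X.fresh s \ insert x (A.erase q)).card =
      (X.fresh s \ A).card + if q ∈ X.fresh s then 1 else 0 := by
  split_ifs with h
  · have : X.fresh s \ insert x (A.erase q) = insert q (X.fresh s \ A) := by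
      ext y
      simp only [Finset.mem_sdiff, Finset.mem_insert, Finset.mem_erase, not_or, not_and]
      by_cases hyq : y = q
      · subst hyq
        have : y ≠ x := fun h' => hx (h' ▸ h)
        simp [h, this]
      · by_cases hyx : y = x
        · subst hyx; simp [hx, hyq]
        · simp [hyq, hyx]
    rw [this, Finset.card_insert_of_notMem (by simp [hq])]
  · congr 1
    ext y
    simp only [Finset.mem_sdiff, Finset.mem_insert, Finset.mem_erase, not_or, not_and]
    by_cases hyq : y = q
    · subst hyq; simp [h]
    · by_cases hyx : y = x
      · subst hyx; simp [hx]
      · simp [hyq, hyx]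

/-- The evicted page is recorded as dropped, so the indicator is not switched on, and the number of
missing fresh pages does not fall. A later fault on the dropped page is paid for by the separate
term counting dropped pages. -/
theorem slotPot_evict_cand {s : ℕ} {A L L' : Finset Page} {x q : Page} {θ : ℕ}
    (hs : X.r s ∈ X.fresh s) (hx : x ∉ X.fresh s) (hq : q ∈ A) (hqL : q ∈ L')
    (hL : L.erase x ⊆ L') :
    X.slotPot s (insert x (A.erase q)) L' θ ≤ X.slotPot s A L θ := by
  have hc := fresh_sdiff_evict hx hq
  have hne : X.r s ≠ x := fun h => hx (h ▸ hs)
  have h0 := slotPot_nonneg (X := X) s A L θ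
  unfold slotPot at *
  by_cases hlow : X.rem s < 2 * X.g (X.idx s)
  · rw [if_pos hlow, if_pos hlow]
  rw [if_neg hlow] at *
  rw [if_neg hlow]
  by_cases h1 : (X.fresh s \ insert x (A.erase q)).card ≤ θ
  · have h2 : (X.fresh s \ A).card ≤ θ := by omega
    rw [if_pos h1, if_pos h2]
    refine add_le_add ?_ (mul_le_mul_of_nonneg_left ?_ (by positivity))
    · split_ifs with h3 h4 h4
      · exact le_rfl
      · exfalso
        apply h4
        have hrq : X.r s ≠ q := fun h => h3.2 (h ▸ hqL)
        refine ⟨fun h => h3.1 (Finset.mem_insert_of_mem (Finset.mem_erase.2 ⟨hrq, h⟩)),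
          fun h => h3.2 (hL (Finset.mem_erase.2 ⟨hne, h⟩))⟩
      · norm_num
      · exact le_rfl
    · have : ((X.fresh s \ A).card : ℝ) ≤ (X.fresh s \ insert x (A.erase q)).card := by
        rw [hc]; push_cast; split_ifs <;> norm_num
      linarith
  · rw [if_neg h1]; exact h0

/-- A uniform eviction from U switches on the indicator for only one choice of u, but uses up one of
the θ permitted missing fresh pages for many choices. Thus the average of the slot potential does
not rise. -/
theorem slotPot_evict_random {s : ℕ} {A L U : Finset Page} {x : Page} {θ : ℕ}
    (hs : X.r s ∈ X.fresh s) (hsT : s < X.T) (hx : x ∉ X.fresh s) (hUA : U ⊆ A)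
    (hU : X.fresh s ∩ A ⊆ U) (hθ : θ ≤ X.g (X.idx s)) :
    ∑ u ∈ U, X.slotPot s (insert x (A.erase u)) (L.erase x) θ ≤ U.card * X.slotPot s A L θ := by
  have hne : X.r s ≠ x := fun h => hx (h ▸ hs)
  rw [← nsmul_eq_mul, ← Finset.sum_const]
  by_cases hlow : X.rem s < 2 * X.g (X.idx s)
  · refine Finset.sum_le_sum fun u _ => ?_
    unfold slotPot
    rw [if_pos hlow, if_pos hlow]
  have hX : ∀ u ∈ U, (if X.r s ∉ insert x (A.erase u) ∧ X.r s ∉ L.erase x then (1 : ℝ) else 0) ≤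
      (if X.r s ∉ A ∧ X.r s ∉ L then 1 else 0) + if u = X.r s then 1 else 0 := by
    intro u _
    by_cases hu : u = X.r s
    · rw [if_pos hu]; split_ifs <;> norm_num
    · have : (X.r s ∉ insert x (A.erase u) ∧ X.r s ∉ L.erase x) ↔ (X.r s ∉ A ∧ X.r s ∉ L) := by
        simp only [Finset.mem_insert, Finset.mem_erase, hne, false_or, ne_eq, not_false_eq_true,
          true_and]
        have : X.r s ≠ u := fun h => hu h.symm
        simp [this]
      simp only [this, if_neg hu, add_zero, le_refl]
  rcases lt_trichotomy (X.fresh s \ A).card θ with hlt | heq | hgt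
  · have key : ∀ u ∈ U, X.slotPot s (insert x (A.erase u)) (L.erase x) θ ≤
        X.slotPot s A L θ + ((if u = X.r s then 1 else 0) -
          2 / X.rem s * if u ∈ X.fresh s then 1 else 0) := by
      intro u hu
      have hc := fresh_sdiff_evict hx (hUA hu)
      have hcr : ((X.fresh s \ insert x (A.erase u)).card : ℝ) =
          (X.fresh s \ A).card + if u ∈ X.fresh s then 1 else 0 := by
        rw [hc]; push_cast; rfl
      unfold slotPot
      rw [if_neg hlow, if_neg hlow, if_pos hlt.le, if_pos (by rw [hc]; split_ifs <;> omega), hcr]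
      have := hX u hu
      linarith
    refine (Finset.sum_le_sum key).trans ?_
    rw [Finset.sum_add_distrib]
    -- At least half of `rem` pages in U are fresh: there are at least `rem` fresh pages in all, and
    -- fewer than θ ≤ g ≤ `rem`/2 of them are missing. The weight 2/`rem` then makes up for the one
    -- bad choice.
    have h1 : ∑ u ∈ U, ((if u = X.r s then (1 : ℝ) else 0) -
        2 / X.rem s * if u ∈ X.fresh s then 1 else 0) ≤ 0 := by
      rw [Finset.sum_sub_distrib, ← Finset.mul_sum, Finset.sum_boole, Finset.sum_boole]
      have h2 : ((U.filter fun u => u = X.r s).card : ℝ) ≤ 1 := by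
        have : (U.filter fun u => u = X.r s).card ≤ 1 :=
          (Finset.card_le_card (fun u hu => by simpa using (Finset.mem_filter.1 hu).2 :
            _ ⊆ ({X.r s} : Finset Page))).trans (by simp)
        exact_mod_cast this
      have h3 : X.fresh s ∩ A ⊆ U.filter fun u => u ∈ X.fresh s := fun y hy =>
        Finset.mem_filter.2 ⟨hU hy, (Finset.mem_inter.1 hy).1⟩
      have h4 := Finset.card_le_card h3
      have h5 := Finset.card_inter_add_card_sdiff (X.fresh s) A
      have h6 := rem_le_card_fresh hsT hs
      have h7 : X.rem s ≤ 2 * (U.filter fun u => u ∈ X.fresh s).card := by omega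
      have h8 : (X.rem s : ℝ) ≤ 2 * ((U.filter fun u => u ∈ X.fresh s).card : ℝ) := by
        exact_mod_cast h7
      have h9 : (0 : ℝ) < X.rem s := by exact_mod_cast rem_pos s
      have : (1 : ℝ) ≤ 2 / X.rem s * ((U.filter fun u => u ∈ X.fresh s).card : ℝ) := by
        rw [div_mul_eq_mul_div, le_div_iff₀ h9]; linarith
      linarith
    linarith
  -- At the cap, evicting a fresh page voids the potential of the slot, and evicting any other page
  -- does not affect the slot's page.
  · refine Finset.sum_le_sum fun u hu => ?_
    have hc := fresh_sdiff_evict hx (hUA hu)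
    by_cases hf : u ∈ X.fresh s
    · have h0 := slotPot_nonneg (X := X) s A L θ
      rw [if_pos hf] at hc
      refine le_trans (le_of_eq ?_) h0
      unfold slotPot
      rw [if_neg hlow, if_neg (by omega)]
    · rw [if_neg hf, add_zero] at hc
      have hu' : u ≠ X.r s := fun h => hf (h ▸ hs)
      have := hX u hu
      rw [if_neg hu'] at this
      unfold slotPot
      rw [if_neg hlow, if_neg hlow, hc, if_pos heq.le, if_pos heq.le]
      linarith
  · refine Finset.sum_le_sum fun u hu => ?_
    have hc := fresh_sdiff_evict hx (hUA hu)
    unfold slotPot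
    rw [if_neg hlow, if_neg hlow, if_neg (by omega), if_neg (by omega)]

/-- Besides the linear cost of the higher cap, the indicator has to be funded for slots that only
now fall below the cap. -/
theorem slotPot_raise {s : ℕ} {A L : Finset Page} {θ θ' : ℕ} (h : θ ≤ θ') :
    X.slotPot s A L θ' ≤ X.slotPot s A L θ + 2 / X.rem s * (θ' - θ : ℕ) +
      if X.r s ∉ A ∧ θ < (X.fresh s \ A).card ∧ (X.fresh s \ A).card ≤ θ' then 1 else 0 := by
  have h1 : (0 : ℝ) ≤ 2 / X.rem s * ((θ' - θ : ℕ) : ℝ) := by positivity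
  have h2 : (0 : ℝ) ≤ if X.r s ∉ A ∧ θ < (X.fresh s \ A).card ∧ (X.fresh s \ A).card ≤ θ'
      then 1 else 0 := by split_ifs <;> norm_num
  have h0 := slotPot_nonneg (X := X) s A L θ
  unfold slotPot at *
  by_cases hlow : X.rem s < 2 * X.g (X.idx s)
  · rw [if_pos hlow, if_pos hlow]; linarith
  rw [if_neg hlow] at *
  rw [if_neg hlow]
  by_cases h3 : (X.fresh s \ A).card ≤ θ
  · rw [if_pos h3, if_pos (h3.trans h)]
    rw [Nat.cast_sub h] at *
    nlinarith
  rw [if_neg h3]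
  by_cases h4 : (X.fresh s \ A).card ≤ θ'
  · rw [if_pos h4]
    have h5 : (2 : ℝ) / X.rem s * (θ' - (X.fresh s \ A).card) ≤ 2 / X.rem s * (θ' - θ : ℕ) := by
      refine mul_le_mul_of_nonneg_left ?_ (by positivity)
      rw [Nat.cast_sub h]
      have : (θ : ℝ) ≤ (X.fresh s \ A).card := by exact_mod_cast (by omega)
      linarith
    have h6 : (if X.r s ∉ A ∧ X.r s ∉ L then (1 : ℝ) else 0) ≤
        if X.r s ∉ A ∧ θ < (X.fresh s \ A).card ∧ (X.fresh s \ A).card ≤ θ' then 1 else 0 := by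
      split_ifs with h7 h8
      · exact le_rfl
      · exact absurd ⟨h7.1, by omega, h4⟩ h8
      · norm_num
      · norm_num
    linarith
  · rw [if_neg h4]; linarith

theorem pot_nonneg (μ t cp cw : ℕ) (A L : Finset Page) (e : ℕ) : 0 ≤ X.pot μ t cp cw A L e :=
  Finset.sum_nonneg fun s _ => by
    split_ifs
    · exact slotPot_nonneg _ _ _ _
    · exact fund_nonneg _ _

theorem slots_succ_subset (t : ℕ) : X.slots (t + 1) ⊆ X.slots t := fun s hs => by
  rw [mem_slots] at hs ⊢
  exact ⟨⟨by omega, hs.1.2⟩, hs.2⟩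

theorem pot_succ_le (μ t cp cw : ℕ) (A L : Finset Page) (e : ℕ) :
    X.pot μ (t + 1) cp cw A L e ≤ X.pot μ t cp cw A L e :=
  Finset.sum_le_sum_of_subset_of_nonneg (slots_succ_subset t) fun s _ _ => by
    split_ifs
    · exact slotPot_nonneg _ _ _ _
    · exact fund_nonneg _ _

/-- A slot releases its potential at its own request; this is the payment for a prepaid fault. -/
theorem pot_succ_add_le {μ t cw : ℕ} (A L : Finset Page) (e : ℕ) (ht : t ∈ X.slots t) :
    X.pot μ (t + 1) (X.idx t) cw A L e + X.slotPot t A L (X.cap μ t cw e) ≤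
      X.pot μ t (X.idx t) cw A L e := by
  have hn : t ∉ X.slots (t + 1) := fun h => by
    have := (mem_slots.1 h).1.1
    omega
  unfold pot
  have e1 : X.slotPot t A L (X.cap μ t cw e) =
      if X.idx t = X.idx t then X.slotPot t A L (X.cap μ t cw e) else X.fund μ t := by simp
  rw [e1, add_comm, ← Finset.sum_insert (f := fun s => if X.idx s = X.idx t then
    X.slotPot s A L (X.cap μ s cw e) else X.fund μ s) hn]
  refine Finset.sum_le_sum_of_subset_of_nonneg ?_ fun s _ _ => ?_
  · exact Finset.insert_subset ht (slots_succ_subset t)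
  · split_ifs
    · exact slotPot_nonneg _ _ _ _
    · exact fund_nonneg _ _

theorem not_mem_fresh_of_later {t s : ℕ} (hs : s ∈ X.slots (t + 1)) (hi : X.idx s = X.idx t) :
    X.r t ∉ X.fresh s := fun h => by
  obtain ⟨⟨h1, h2⟩, -⟩ := mem_slots.1 hs
  exact (Finset.mem_erase.1 (fresh_subset_erase h1 h2 hi h)).1 rfl

theorem pot_evict_cand {μ t cw e : ℕ} {A L L' : Finset Page} {q : Page}
    (hq : q ∈ A) (hqL : q ∈ L') (hL : L.erase (X.r t) ⊆ L') :
    X.pot μ (t + 1) (X.idx t) cw (insert (X.r t) (A.erase q)) L' e ≤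
      X.pot μ (t + 1) (X.idx t) cw A L e := by
  refine Finset.sum_le_sum fun s hs => ?_
  split_ifs with hi
  · exact slotPot_evict_cand (mem_slots.1 hs).2 (not_mem_fresh_of_later hs hi) hq hqL hL
  · exact le_rfl

theorem pot_evict_random {μ t cw e : ℕ} {A L U : Finset Page}
    (hU : U = A \ X.M (t + 1)) :
    ∑ u ∈ U, X.pot μ (t + 1) (X.idx t) cw (insert (X.r t) (A.erase u)) (L.erase (X.r t)) e ≤
      U.card * X.pot μ (t + 1) (X.idx t) cw A L e := by
  unfold pot
  rw [Finset.sum_comm, Finset.mul_sum]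
  refine Finset.sum_le_sum fun s hs => ?_
  split_ifs with hi
  · obtain ⟨⟨h1, h2⟩, h3⟩ := mem_slots.1 hs
    refine slotPot_evict_random h3 h2 (not_mem_fresh_of_later hs hi)
      (hU ▸ Finset.sdiff_subset) ?_ (cap_le_g _ _ _ _)
    intro y hy
    rw [Finset.mem_inter] at hy
    have := fresh_subset (t := t + 1) h1 h2 hi hy.1
    rw [Finset.mem_sdiff] at this
    exact hU ▸ Finset.mem_sdiff.2 ⟨hy.2, this.2⟩
  · rw [Finset.sum_const, nsmul_eq_mul]

/-- No later slot belongs to the window that ends, so all remaining caps above μ already use the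
anticipated error `base`. Inserting the actual error of the new window's first query raises none of
them. -/
theorem pot_refresh_le {μ t cp cw cw' e e' : ℕ} {A L : Finset Page}
    (h : ∀ s, t ≤ s → X.win s ≠ cw) (he : ∀ s, X.win s = cw' → e' ≤ X.base s) :
    X.pot μ t cp cw' A L e' ≤ X.pot μ t cp cw A L e := by
  refine Finset.sum_le_sum fun s hs => ?_
  split_ifs with hi
  · refine slotPot_mono ?_
    unfold cap
    rw [if_neg (h s (mem_slots.1 hs).1.1)]
    split_ifs with h1 h2
    · exact le_rfl
    · have := he s h2
      exact min_le_min le_rfl (by omega)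
    · exact le_rfl
  · exact le_rfl

/-- Slots of the new phase keep their fund as the linear part; only the indicators are new. Distinct
slots of a phase request distinct pages, all of them in B t, so at most |B t \ A'| indicators are
switched on. -/
theorem pot_new_phase_le {μ t cp cp' cw cw' e e' : ℕ} {A L A' L' : Finset Page}
    (h : ∀ s, t ≤ s → X.idx s ≠ cp) (he : ∀ s, t ≤ s → X.win s = cw' → e' ≤ X.base s)
    (hB : ∀ s ∈ X.slots t, X.idx s = cp' → X.r s ∈ X.B t) :
    X.pot μ t cp' cw' A' L' e' ≤ X.pot μ t cp cw A L e + (X.B t \ A').card := by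
  have h1 : X.pot μ t cp' cw' A' L' e' ≤
      ∑ s ∈ X.slots t, ((if X.idx s = cp' ∧ X.r s ∉ A' then 1 else 0) + X.fund μ s) := by
    refine Finset.sum_le_sum fun s hs => ?_
    by_cases hi : X.idx s = cp'
    · rw [if_pos hi]
      simp only [hi, true_and]
      exact slotPot_le_fund μ cw' e' (fun h => he s (mem_slots.1 hs).1.1 h.symm)
    · simp [hi]
  have h2 : X.pot μ t cp cw A L e = ∑ s ∈ X.slots t, X.fund μ s :=
    Finset.sum_congr rfl fun s hs => if_neg (h s (mem_slots.1 hs).1.1)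
  rw [h2]
  rw [Finset.sum_add_distrib, Finset.sum_boole] at h1
  have h3 : ((X.slots t).filter fun s => X.idx s = cp' ∧ X.r s ∉ A').card ≤
      (X.B t \ A').card := by
    refine Finset.card_le_card_of_injOn X.r ?_ ?_
    · intro s hs
      simp only [Finset.coe_filter, Set.mem_ofPred_eq] at hs
      exact Finset.mem_coe.2 (Finset.mem_sdiff.2 ⟨hB s hs.1 hs.2.1, hs.2.2⟩)
    · have key : ∀ s s', s < s' → s' < X.T → X.idx s' = X.idx s → X.r s' ∈ X.fresh s' →
          X.r s ≠ X.r s' := fun s s' h1 h2 h3 h4 h5 =>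
        (Finset.mem_erase.1 (fresh_subset_erase h1 h2 h3 h4)).1 h5.symm
      intro s hs s' hs' heq
      simp only [Finset.coe_filter, Set.mem_ofPred_eq, mem_slots] at hs hs'
      by_contra hne
      rcases lt_or_gt_of_ne hne with hlt | hlt
      · exact key _ _ hlt hs'.1.1.2 (hs'.2.1.trans hs.2.1.symm) hs'.1.2 heq
      · exact key _ _ hlt hs.1.1.2 (hs.2.1.trans hs'.2.1.symm) hs.1.2 heq.symm
  have h4 : (((X.slots t).filter fun s => X.idx s = cp' ∧ X.r s ∉ A').card : ℝ) ≤
      (X.B t \ A').card := by exact_mod_cast h3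
  linarith

/-- An additional error d raises the caps of the current window by at most 6d. The linear parts grow
by at most 2w·6d in total, and at most 6d slots come under their cap for the first time. -/
theorem pot_raise_le {μ t cw e d : ℕ} {w : ℝ} {A L : Finset Page} (cp : ℕ)
    (hw : ∀ n, ∑ m ∈ (Finset.Icc 1 X.k).filter (fun m => μ ≤ m ∧ X.lev m = n), (1 / m : ℝ) ≤ w)
    (hw0 : 0 ≤ w) :
    X.pot μ t cp cw A L (e + d) ≤ X.pot μ t cp cw A L e + 6 * d * (1 + 2 * w) := by
  set S := (X.slots t).filter fun s => X.idx s = cp ∧ X.win s = cw ∧ μ ≤ X.rem s with hS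
  set θ := min (X.g cp) (6 * e) with hθ
  set θ' := min (X.g cp) (6 * (e + d)) with hθ'
  have hle : θ ≤ θ' := min_le_min le_rfl (by omega)
  have hd : θ' - θ ≤ 6 * d := by omega
  have hd' : ((θ' - θ : ℕ) : ℝ) ≤ 6 * d := by exact_mod_cast hd
  have h1 : X.pot μ t cp cw A L (e + d) ≤ ∑ s ∈ X.slots t,
      ((if X.idx s = cp then X.slotPot s A L (X.cap μ s cw e) else X.fund μ s) +
        if X.idx s = cp ∧ X.win s = cw ∧ μ ≤ X.rem s then
          2 / X.rem s * ((θ' - θ : ℕ) : ℝ) + (if X.r s ∉ A ∧ θ < (X.fresh s \ A).card ∧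
            (X.fresh s \ A).card ≤ θ' then 1 else 0) else 0) := by
    refine Finset.sum_le_sum fun s _ => ?_
    by_cases hi : X.idx s = cp
    · by_cases hc : X.win s = cw ∧ μ ≤ X.rem s
      · rw [if_pos hi, if_pos hi, if_pos ⟨hi, hc⟩]
        have e1 : X.cap μ s cw e = θ := by
          unfold cap; rw [if_neg (by omega), if_pos hc.1, hi]
        have e2 : X.cap μ s cw (e + d) = θ' := by
          unfold cap; rw [if_neg (by omega), if_pos hc.1, hi]
        rw [e1, e2, ← add_assoc]
        exact slotPot_raise hle
      · rw [if_pos hi, if_pos hi, if_neg (fun h => hc h.2), add_zero]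
        refine slotPot_mono (le_of_eq ?_)
        unfold cap
        by_cases hμ : X.rem s < μ
        · rw [if_pos hμ, if_pos hμ]
        · have : X.win s ≠ cw := fun h => hc ⟨h, by omega⟩
          rw [if_neg hμ, if_neg hμ, if_neg this, if_neg this]
    · rw [if_neg hi, if_neg hi, if_neg (fun h => hi h.1), add_zero]
  rw [Finset.sum_add_distrib, ← Finset.sum_filter, ← hS, Finset.sum_add_distrib,
    Finset.sum_boole] at h1
  have h2 : ∑ s ∈ S, (2 / X.rem s * ((θ' - θ : ℕ) : ℝ)) ≤ 2 * w * (6 * d) := by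
    have e1 : ∀ s ∈ S, (2 / X.rem s * ((θ' - θ : ℕ) : ℝ)) =
        (1 / X.rem s : ℝ) * (2 * ((θ' - θ : ℕ) : ℝ)) := fun s _ => by ring
    rw [Finset.sum_congr rfl e1, ← Finset.sum_mul]
    have h3 : ∑ s ∈ S, (1 / X.rem s : ℝ) ≤ w := by
      refine sum_window_le cw hw hw0 S fun s hs => ?_
      simp only [hS, Finset.mem_filter, mem_slots] at hs
      exact ⟨hs.1.2, hs.2.2⟩
    calc (∑ s ∈ S, (1 / X.rem s : ℝ)) * (2 * ((θ' - θ : ℕ) : ℝ))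
        ≤ w * (2 * (6 * d)) := by gcongr
      _ = 2 * w * (6 * d) := by ring
  -- For these slots |fresh \ A| is strictly decreasing, because the missing page of a slot is no
  -- longer fresh at later ones. The sizes are thus distinct elements of (θ, θ'].
  have h3 : (S.filter fun s => X.r s ∉ A ∧ θ < (X.fresh s \ A).card ∧
      (X.fresh s \ A).card ≤ θ').card ≤ θ' - θ := by
    rw [← Nat.card_Ioc]
    refine Finset.card_le_card_of_injOn (fun s => (X.fresh s \ A).card) ?_ ?_
    · intro s hs
      simp only [Finset.coe_filter, Set.mem_ofPred_eq] at hs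
      simp only [Finset.coe_Ioc, Set.mem_Ioc]
      exact hs.2.2
    · have key : ∀ s s', s < s' → s' < X.T → X.idx s' = X.idx s → X.r s ∈ X.fresh s →
          X.r s ∉ A → (X.fresh s' \ A).card < (X.fresh s \ A).card := by
        intro s s' h1 h2 h3 h4 h5
        have hsub := fresh_subset_erase h1 h2 h3
        refine Finset.card_lt_card ((Finset.ssubset_iff_of_subset fun y hy => ?_).2
          ⟨X.r s, Finset.mem_sdiff.2 ⟨h4, h5⟩, fun h => ?_⟩)
        · rw [Finset.mem_sdiff] at hy ⊢
          exact ⟨Finset.mem_of_mem_erase (hsub hy.1), hy.2⟩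
        · exact (Finset.mem_erase.1 (hsub (Finset.mem_sdiff.1 h).1)).1 rfl
      intro s hs s' hs' heq
      simp only [hS, Finset.coe_filter, Set.mem_ofPred_eq, Finset.mem_filter, mem_slots] at hs hs'
      by_contra hne
      rcases lt_or_gt_of_ne hne with hlt | hlt
      · exact absurd heq (key _ _ hlt hs'.1.1.1.2 (hs'.1.2.1.trans hs.1.2.1.symm) hs.1.1.2
          hs.2.1).ne'
      · exact absurd heq (key _ _ hlt hs.1.1.1.2 (hs.1.2.1.trans hs'.1.2.1.symm) hs'.1.1.2
          hs'.2.1).ne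
  have h4 : ((S.filter fun s => X.r s ∉ A ∧ θ < (X.fresh s \ A).card ∧
      (X.fresh s \ A).card ≤ θ').card : ℝ) ≤ 6 * d := le_trans (by exact_mod_cast h3) hd'
  unfold pot at h1 ⊢
  linarith

end Scenario

end Potential

/-! ### Invariants of an execution, and the potential before a request is served -/

section Invariants

variable {Page : Type u} [DecidableEq Page]

namespace Scenario

variable (X : Scenario Page)

/-- Total error of logged queries, where the error of a query is capped by its size. -/
def logErr (l : List (ℕ × ℕ)) : ℕ := (l.map fun x => min (X.err x.1) x.2).sum

/-- Total error of the predictions that were not queried. -/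
def credit (c : Config Page) : ℕ := ∑ τ ∈ Finset.Icc 1 X.T \ c.queryTimes, X.err τ

/-- Number of Belady's faults from time `t` on. -/
def faultsFrom (t : ℕ) : ℕ := ((Finset.Ico t X.T).filter fun τ => X.flt τ).card

/-- Number of pages asked for at the starts of the windows until time `t`. -/
def asked (t : ℕ) : ℕ := ∑ τ ∈ (Finset.range t).filter X.Sync, X.quota τ

/-- The invariant of an execution after `t` requests. -/
structure Inv (t : ℕ) (m : Memory Page) (c : Config Page) : Prop where
  init : m.init = X.A₀
  hist : m.hist = (List.range t).map X.r
  phase : m.phase = X.ph t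
  cache : c.cache = m.cache
  card : m.cache.card = X.k
  cand : m.cand ⊆ m.cache
  marked : X.M t \ m.cache ⊆ m.dropped
  diff : (m.cache \ X.B t).card ≤ 2 * (X.ph t).prev + (X.ph t).cur
  missed : ((m.cache \ X.B t) \ m.cand).card ≤ m.pending + X.logErr m.log
  wrong : (m.cand ∩ X.B t).card ≤ X.logErr m.log
  good : m.bad = false → (X.M t \ m.cache).card ≤ (X.ph t).cur
  times : c.queryTimes ⊆ Finset.Icc 1 t
  log : ∀ x ∈ m.log, x.1 ∈ c.queryTimes
  syncs : ∀ τ < t, X.Sync τ → τ + 1 ∈ c.queryTimes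
  served : c.unserved = 0
  queries : c.queries + m.pending ≤ X.asked t + faults X.r t X.B
  indices : c.indices + 2 * m.pending ≤ X.asked t + 2 * faults X.r t X.B
  exact : receivedError X.pred X.B c = 0 →
    m.cache = X.B t ∧ c.cost = faults X.r t X.B ∧ m.bad = false

/-- What holds after the bookkeeping for request `t`. -/
structure AdvInv (t : ℕ) (m : Memory Page) (c : Config Page) : Prop where
  init : m.init = X.A₀
  hist : m.hist = (List.range (t + 1)).map X.r
  phase : m.phase = X.ph (t + 1)
  cache : c.cache = m.cache
  card : m.cache.card = X.k
  cand : ¬X.StartsWindow t → m.cand ⊆ m.cache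
  marked : (X.M (t + 1)).erase (X.r t) \ m.cache ⊆ m.dropped
  again : ¬X.Starts t → X.r t ∈ X.M t → X.r t ∉ m.cache → X.r t ∈ m.dropped
  diff : (m.cache \ X.B (t + 1)).card ≤ X.quota t
  missed : ¬X.StartsWindow t →
    ((m.cache \ X.B (t + 1)) \ m.cand).card ≤ m.pending + X.logErr m.log
  wrong : ¬X.StartsWindow t → (m.cand ∩ X.B (t + 1)).card ≤ X.logErr m.log
  good : m.bad = false →
    ((X.M (t + 1)).erase (X.r t) \ m.cache).card + (X.flt t).toNat ≤ (X.ph (t + 1)).cur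
  times : c.queryTimes ⊆ Finset.Icc 1 t
  log : ∀ x ∈ m.log, x.1 ∈ c.queryTimes
  syncs : ∀ τ < t, X.Sync τ → τ + 1 ∈ c.queryTimes
  served : c.unserved = 0
  pending : (X.flt t).toNat ≤ m.pending
  queries : c.queries + m.pending ≤ X.asked t + faults X.r (t + 1) X.B
  indices : c.indices + 2 * m.pending ≤ X.asked t + 2 * faults X.r (t + 1) X.B
  exact : receivedError X.pred X.B c = 0 →
    m.cache = X.B t ∧ c.cost = faults X.r t X.B ∧ m.bad = false ∧
      (¬X.StartsWindow t → m.cand = ∅)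

/-- What holds just before request `t` is served. -/
structure MidInv (t : ℕ) (m : Memory Page) (c : Config Page) : Prop where
  init : m.init = X.A₀
  hist : m.hist = (List.range (t + 1)).map X.r
  phase : m.phase = X.ph (t + 1)
  cache : c.cache = m.cache
  card : m.cache.card = X.k
  cand : m.cand ⊆ m.cache
  marked : (X.M (t + 1)).erase (X.r t) \ m.cache ⊆ m.dropped
  again : ¬X.Starts t → X.r t ∈ X.M t → X.r t ∉ m.cache → X.r t ∈ m.dropped
  diff : (m.cache \ X.B (t + 1)).card ≤ X.quota t
  missed : ((m.cache \ X.B (t + 1)) \ m.cand).card ≤ m.pending + X.logErr m.log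
  wrong : (m.cand ∩ X.B (t + 1)).card ≤ X.logErr m.log
  good : m.bad = false →
    ((X.M (t + 1)).erase (X.r t) \ m.cache).card + (X.flt t).toNat ≤ (X.ph (t + 1)).cur
  times : c.queryTimes ⊆ Finset.Icc 1 (t + 1)
  log : ∀ x ∈ m.log, x.1 ∈ c.queryTimes
  syncs : ∀ τ < t + 1, X.Sync τ → τ + 1 ∈ c.queryTimes
  served : c.unserved = 0
  pending : X.r t ∉ m.cache → m.pending ≤ m.cand.card
  queries : c.queries + m.pending ≤ X.asked (t + 1) + faults X.r (t + 1) X.B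
  indices : c.indices + 2 * m.pending ≤ X.asked (t + 1) + 2 * faults X.r (t + 1) X.B
  exact : receivedError X.pred X.B c = 0 →
    m.cache = X.B t ∧ c.cost = faults X.r t X.B ∧ m.bad = false ∧
      (X.flt t = true → m.cand.Nonempty ∧ m.cand ⊆ X.B t \ X.B (t + 1))

/-- The potential after `t` requests, including the cost so far. -/
noncomputable def W (μ : ℕ) (w : ℝ) (t : ℕ) (m : Memory Page) (c : Config Page) : ℝ :=
  c.cost + 6 * (m.cache \ X.B t).card + m.dropped.card + (X.M t \ m.cache).card +
    36 * m.pending + 18 * (X.ph t).cur +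
    3 * X.pot μ t (X.ph t).idx (X.ph t).win m.cache m.dropped (X.logErr m.log) +
    36 * w * X.credit c + 63 * X.faultsFrom t

/-- The potential while request `t` is processed. -/
noncomputable def WMid (μ : ℕ) (w : ℝ) (t cw : ℕ) (m : Memory Page) (c : Config Page) : ℝ :=
  c.cost + 6 * (m.cache \ X.B (t + 1)).card + m.dropped.card +
    ((X.M (t + 1)).erase (X.r t) \ m.cache).card +
    36 * m.pending + 18 * (X.ph (t + 1)).cur +
    3 * X.pot μ t (X.idx t) cw m.cache m.dropped (X.logErr m.log) +
    36 * w * X.credit c + 63 * X.faultsFrom (t + 1) + 3 * (X.flt t).toNat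

variable {X}

theorem faultsFrom_eq {t : ℕ} (ht : t < X.T) :
    X.faultsFrom t = X.faultsFrom (t + 1) + (X.flt t).toNat := by
  unfold faultsFrom
  rw [← Finset.insert_Ico_succ_left_eq_Ico ht, Finset.filter_insert]
  cases h : X.flt t
  · simp
  · simp

theorem asked_succ (t : ℕ) :
    X.asked (t + 1) = X.asked t + if X.Sync t then X.quota t else 0 := by
  unfold asked
  rw [Finset.range_add_one, Finset.filter_insert]
  split_ifs with h
  · rw [Finset.sum_insert (by simp), add_comm]
  · rfl

theorem card_sdiff_B_succ_le {t : ℕ} (ht : t < X.T) (A : Finset Page) :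
    (A \ X.B (t + 1)).card ≤ (A \ X.B t).card + (X.flt t).toNat := by
  have : A \ X.B (t + 1) ⊆ (A \ X.B t) ∪ (X.B t \ X.B (t + 1)) := by
    intro x hx
    simp only [Finset.mem_sdiff, Finset.mem_union] at hx ⊢
    tauto
  exact (Finset.card_le_card this).trans ((Finset.card_union_le _ _).trans
    (Nat.add_le_add_left (X.lazyRun.card_sdiff_succ_le ht) _))

theorem idx_ne_of_starts {t s : ℕ} (h : X.Starts t) (hs : t ≤ s) : X.idx s ≠ (X.ph t).idx := by
  have h1 : X.idx t ≤ X.idx s := ph_idx_mono (Nat.succ_le_succ hs)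
  have h2 : X.idx t = (X.ph t).idx + 1 := by unfold idx; rw [ph_idx_succ, if_pos h]
  omega

theorem win_ne_of_startsWindow {t s : ℕ} (h : X.StartsWindow t) (hs : t ≤ s) :
    X.win s ≠ (X.ph t).win := by
  have h1 : X.win t ≤ X.win s := ph_win_mono (Nat.succ_le_succ hs)
  have h2 : X.win t = (X.ph t).win + 1 := by unfold win; rw [ph_win_succ, if_pos h]
  omega

theorem flt_eq_false_iff {t : ℕ} : X.flt t = false ↔ X.r t ∈ X.B t := by
  simp [flt]

theorem receivedError_eq (c : Config Page) :
    receivedError X.pred X.B c = ∑ τ ∈ c.queryTimes, X.err τ := rfl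

theorem logErr_eq_zero {l : List (ℕ × ℕ)} (h : ∀ x ∈ l, X.err x.1 = 0) : X.logErr l = 0 := by
  unfold logErr
  rw [List.sum_eq_zero]
  intro n hn
  obtain ⟨x, hx, rfl⟩ := List.mem_map.1 hn
  simp [h x hx]

/-- At the end of a phase A and M both have k pages, so |A \ M| = |M \ A|. Without avoidable faults
this is at most `cur`, and so is |M \ B|. A phase with avoidable faults is handled by replacing A
with M. -/
theorem Inv.card_start {t : ℕ} {m : Memory Page} {c : Config Page} (h : X.Inv t m c)
    (ht : t < X.T) (hs : X.Starts t) (hb : m.bad = false) :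
    (m.cache \ X.B t).card ≤ 2 * (X.ph t).cur := by
  have h1 : m.cache \ X.B t ⊆ (m.cache \ X.M t) ∪ (X.M t \ X.B t) := by
    intro x hx
    simp only [Finset.mem_sdiff, Finset.mem_union] at hx ⊢
    tauto
  have h2 := (Finset.card_le_card h1).trans (Finset.card_union_le _ _)
  have h3 : (m.cache \ X.M t).card = (X.M t \ m.cache).card :=
    Finset.card_sdiff_comm (h.card.trans hs.2.symm)
  have h4 := h.good hb
  have h5 := card_M_sdiff_B (X := X) ht.le
  omega

/-- The memory after the bookkeeping for request `t`. -/
noncomputable def adv (X : Scenario Page) (t : ℕ) (m : Memory Page) : Memory Page :=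
  m.advance X.k X.lev (X.r t) (X.flt t)

/-- The configuration after the bookkeeping for request `t`. -/
def advCfg (X : Scenario Page) (t : ℕ) (m : Memory Page) (c : Config Page) : Config Page :=
  if X.Starts t ∧ m.bad = true then
    { c with cache := X.M t, cost := c.cost + (X.M t \ m.cache).card } else c

theorem Inv.adv_cache {t : ℕ} {m : Memory Page} {c : Config Page} (h : X.Inv t m c) :
    (X.adv t m).cache = if X.Starts t ∧ m.bad = true then X.M t else m.cache := by
  simp only [adv, Memory.advance, h.phase]; rfl

theorem Inv.adv_dropped {t : ℕ} {m : Memory Page} {c : Config Page} (h : X.Inv t m c) :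
    (X.adv t m).dropped = if X.Starts t then ∅ else m.dropped := by
  simp only [adv, Memory.advance, h.phase]; rfl

theorem Inv.adv_bad {t : ℕ} {m : Memory Page} {c : Config Page} (h : X.Inv t m c) :
    (X.adv t m).bad = if X.Starts t then false else m.bad := by
  simp only [adv, Memory.advance, h.phase]; rfl

theorem Inv.advCfg_queryTimes (t : ℕ) (m : Memory Page) (c : Config Page) :
    (X.advCfg t m c).queryTimes = c.queryTimes ∧ (X.advCfg t m c).queries = c.queries ∧
    (X.advCfg t m c).indices = c.indices ∧ (X.advCfg t m c).unserved = c.unserved := by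
  unfold advCfg; split_ifs <;> simp

theorem Inv.adv_card_start {t : ℕ} {m : Memory Page} {c : Config Page} (h : X.Inv t m c)
    (ht : t < X.T) (hs : X.Starts t) :
    ((X.adv t m).cache \ X.B t).card ≤ 2 * (X.ph t).cur := by
  rw [h.adv_cache]
  split_ifs with hb
  · have := card_M_sdiff_B (X := X) ht.le
    omega
  · exact h.card_start ht hs (by simpa [hs] using hb)

theorem Inv.advInv {t : ℕ} {m : Memory Page} {c : Config Page} (h : X.Inv t m c)
    (ht : t < X.T) : X.AdvInv t (X.adv t m) (X.advCfg t m c) := by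
  obtain ⟨hq1, hq2, hq3, hq4⟩ := Inv.advCfg_queryTimes (X := X) t m c
  have hns : ¬X.StartsWindow t → ¬X.Starts t := fun h1 h2 => h1 h2.startsWindow
  have hcache : ¬X.Starts t → (X.adv t m).cache = m.cache := fun hn => by
    rw [h.adv_cache, if_neg (fun h' => hn h'.1)]
  have hMsub : ¬X.Starts t → (X.M (t + 1)).erase (X.r t) \ m.cache ⊆ X.M t \ m.cache := by
    intro hn x hx
    rw [M_succ_of_not hn] at hx
    simp only [Finset.mem_sdiff, Finset.mem_erase, Finset.mem_insert] at hx ⊢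
    exact ⟨hx.1.2.resolve_left hx.1.1, hx.2⟩
  have hMstart : X.Starts t → (X.M (t + 1)).erase (X.r t) = ∅ := fun hs => by
    rw [M_succ_of_starts hs]; simp
  have hr := X.lazyRun.mem_succ ht
  refine
    { init := h.init
      hist := ?_
      phase := ?_
      cache := ?_
      card := ?_
      cand := fun hw => ?_
      marked := ?_
      again := fun hs h1 h2 => ?_
      diff := ?_
      missed := fun hw => ?_
      wrong := fun hw => ?_
      good := fun hb => ?_
      times := by rw [hq1]; exact h.times
      log := by rw [hq1]; exact h.log
      syncs := by rw [hq1]; exact h.syncs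
      served := by rw [hq4]; exact h.served
      pending := Nat.le_add_left _ _
      queries := ?_
      indices := ?_
      exact := fun he => ?_ }
  · simp only [adv, Memory.advance, h.hist, List.range_succ, List.map_append, List.map_cons,
      List.map_nil]
  · simp only [adv, Memory.advance, h.phase]; rfl
  · rw [h.adv_cache, advCfg]
    split_ifs
    · rfl
    · exact h.cache
  · rw [h.adv_cache]
    split_ifs with hb
    · exact hb.1.2
    · exact h.card
  · rw [hcache (hns hw)]
    exact (Finset.erase_subset _ _).trans h.cand
  · by_cases hs : X.Starts t
    · simp [hMstart hs]
    · rw [hcache hs, h.adv_dropped, if_neg hs]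
      exact (hMsub hs).trans h.marked
  · rw [hcache hs] at h2
    rw [h.adv_dropped, if_neg hs]
    exact h.marked (Finset.mem_sdiff.2 ⟨h1, h2⟩)
  · refine (card_sdiff_B_succ_le ht _).trans ?_
    unfold quota
    rw [ph_prev_succ, ph_cur_succ]
    by_cases hs : X.Starts t
    · have := h.adv_card_start ht hs
      rw [if_pos hs, if_pos hs]
      omega
    · have := h.diff
      rw [hcache hs, if_neg hs, if_neg hs]
      omega
  · rw [hcache (hns hw)]
    have h1 : (m.cache \ X.B (t + 1)) \ (X.adv t m).cand ⊆
        ((m.cache \ X.B t) \ m.cand) ∪ (X.B t \ X.B (t + 1)) := by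
      intro x hx
      simp only [adv, Memory.advance, Finset.mem_sdiff, Finset.mem_union, Finset.mem_erase,
        not_and] at hx ⊢
      have hne : x ≠ X.r t := fun e => hx.1.2 (e ▸ hr)
      have := hx.2 hne
      tauto
    have h2 := (Finset.card_le_card h1).trans (Finset.card_union_le _ _)
    have h3 := X.lazyRun.card_sdiff_succ_le (t := t) ht
    have h4 := h.missed
    have e1 : (X.adv t m).pending = m.pending + (X.flt t).toNat := rfl
    have e2 : (X.adv t m).log = m.log := rfl
    rw [e1, e2]
    unfold flt
    omega
  · refine (Finset.card_le_card fun x hx => ?_).trans h.wrong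
    simp only [adv, Memory.advance, Finset.mem_inter, Finset.mem_erase] at hx ⊢
    exact ⟨hx.1.2, (Finset.mem_insert.1 (X.lazyRun.succ_subset ht hx.2)).resolve_left hx.1.1⟩
  · rw [ph_cur_succ]
    by_cases hs : X.Starts t
    · simp [hMstart hs]
    · rw [h.adv_bad, if_neg hs] at hb
      rw [hcache hs, if_neg hs]
      have h1 := Finset.card_le_card (hMsub hs)
      have h2 := h.good hb
      omega
  · have h1 := h.queries
    have e1 : (X.adv t m).pending = m.pending + (X.flt t).toNat := rfl
    rw [hq2, e1, faults_succ]
    unfold flt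
    omega
  · have h1 := h.indices
    have e1 : (X.adv t m).pending = m.pending + (X.flt t).toNat := rfl
    rw [hq3, e1, faults_succ]
    unfold flt
    omega
  · have he' : receivedError X.pred X.B c = 0 := by
      rwa [receivedError_eq, hq1] at he
    obtain ⟨h1, h2, h3⟩ := h.exact he'
    have hn : ¬(X.Starts t ∧ m.bad = true) := by simp [h3]
    refine ⟨?_, ?_, ?_, fun _ => ?_⟩
    · rw [h.adv_cache, if_neg hn, h1]
    · rw [advCfg, if_neg hn, h2]
    · rw [h.adv_bad, h3]; simp
    -- With correct predictions no candidate lies in B, while A = B; hence no candidates are left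
    -- between queries.
    · have h4 : X.logErr m.log = 0 := logErr_eq_zero fun x hx => by
        rw [receivedError_eq, Finset.sum_eq_zero_iff] at he'
        exact he' _ (h.log x hx)
      have h5 := h.wrong
      rw [h4, Nat.le_zero, Finset.card_eq_zero, ← h1,
        Finset.inter_eq_left.2 h.cand] at h5
      simp [adv, Memory.advance, h5]

/-- A Belady fault releases 63 = 6 + 36 + 18 + 3: for |A \ B|, for `pending`, for `cur`, and for
serving the request. At the start of a phase the old term 18·`cur` pays 6·2·`cur` for |A \ B| and
3·2·`cur` for the slots whose indicators are switched on, and the term |M \ A| pays for the cleanup.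
-/
theorem Inv.wMid_adv_le {t : ℕ} {m : Memory Page} {c : Config Page} (h : X.Inv t m c)
    (ht : t < X.T) (μ : ℕ) (w : ℝ) :
    X.WMid μ w t (X.ph t).win (X.adv t m) (X.advCfg t m c) ≤ X.W μ w t m c := by
  have hq1 := (Inv.advCfg_queryTimes (X := X) t m c).1
  have e1 : (X.adv t m).pending = m.pending + (X.flt t).toNat := rfl
  have e2 : (X.adv t m).log = m.log := rfl
  have e3 : X.credit (X.advCfg t m c) = X.credit c := by unfold credit; rw [hq1]
  have hB : (((X.adv t m).cache \ X.B (t + 1)).card : ℝ) ≤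
      ((X.adv t m).cache \ X.B t).card + (X.flt t).toNat := by
    exact_mod_cast card_sdiff_B_succ_le ht _
  unfold WMid W
  rw [faultsFrom_eq ht, e1, e2, e3, ph_cur_succ]
  push_cast
  by_cases hs : X.Starts t
  · have hcost : ((X.advCfg t m c).cost : ℝ) ≤ c.cost + (X.M t \ m.cache).card := by
      unfold advCfg
      split_ifs
      · push_cast; exact le_rfl
      · have : (0 : ℝ) ≤ (X.M t \ m.cache).card := by positivity
        linarith
    have hcard : (((X.adv t m).cache \ X.B t).card : ℝ) ≤ 2 * (X.ph t).cur := by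
      exact_mod_cast h.adv_card_start ht hs
    have hcard2 : (X.B t \ (X.adv t m).cache).card = ((X.adv t m).cache \ X.B t).card :=
      Finset.card_sdiff_comm ((X.card_B ht.le).trans (h.advInv ht).card.symm)
    have hpot := pot_new_phase_le (X := X) (μ := μ) (t := t) (cp := (X.ph t).idx)
      (cp' := X.idx t) (cw := (X.ph t).win) (cw' := (X.ph t).win) (e := X.logErr m.log)
      (e' := X.logErr m.log) (A := m.cache) (L := m.dropped) (A' := (X.adv t m).cache)
      (L' := (X.adv t m).dropped) (fun s hs' => idx_ne_of_starts hs hs')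
      (fun s hs' hw => absurd hw (win_ne_of_startsWindow hs.startsWindow hs'))
      (fun s hs' hi => by
        obtain ⟨⟨h1, h2⟩, h3⟩ := mem_slots.1 hs'
        rcases h1.eq_or_lt with rfl | h1
        · exact (Finset.mem_sdiff.1 h3).1
        · exact (Finset.mem_sdiff.1
            (Finset.mem_of_mem_erase (fresh_subset_erase h1 h2 hi h3))).1)
    rw [hcard2] at hpot
    have hM : (X.M (t + 1)).erase (X.r t) \ (X.adv t m).cache = ∅ := by
      rw [M_succ_of_starts hs]; simp
    have hL : (X.adv t m).dropped.card = 0 := by rw [h.adv_dropped, if_pos hs]; rfl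
    rw [hM, hL, if_pos hs]
    simp only [Finset.card_empty, Nat.cast_zero]
    have p1 : (0 : ℝ) ≤ (m.cache \ X.B t).card := by positivity
    have p2 : (0 : ℝ) ≤ m.dropped.card := by positivity
    linarith
  · have hcfg : X.advCfg t m c = c := by unfold advCfg; rw [if_neg (fun h' => hs h'.1)]
    have hcache : (X.adv t m).cache = m.cache := by
      rw [h.adv_cache, if_neg (fun h' => hs h'.1)]
    have hL : (X.adv t m).dropped = m.dropped := by rw [h.adv_dropped, if_neg hs]
    have hi : X.idx t = (X.ph t).idx := by unfold idx; rw [ph_idx_succ, if_neg hs]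
    have hM : (((X.M (t + 1)).erase (X.r t) \ m.cache).card : ℝ) ≤ (X.M t \ m.cache).card := by
      have : (X.M (t + 1)).erase (X.r t) \ m.cache ⊆ X.M t \ m.cache := by
        intro x hx
        rw [M_succ_of_not hs] at hx
        simp only [Finset.mem_sdiff, Finset.mem_erase, Finset.mem_insert] at hx ⊢
        exact ⟨hx.1.2.resolve_left hx.1.1, hx.2⟩
      exact_mod_cast Finset.card_le_card this
    rw [hcache] at hB
    rw [hcfg, hcache, hL, hi, if_neg hs]
    linarith

/-- The configuration after a query for `n` pages. -/
def queryCfg (X : Scenario Page) (t : ℕ) (c : Config Page) (n : ℕ) : Config Page :=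
  { c with
    queries := c.queries + 1
    indices := c.indices + (X.pred.report (t + 1) c.cache n).card
    queryTimes := insert (t + 1) c.queryTimes }

/-- Reported pages of B are absent from the prediction, hence counted by the error. If n pages are
reported, each correct one reduces the n + e misplaced pages. If fewer are reported, then all of A \
P is, so the missed pages lie in P \ B, which has as many elements as B \ P. -/
theorem report_bounds {t n e : ℕ} (ht : t ≤ X.T) {A : Finset Page}
    (hn : (A \ X.B t).card ≤ n + e) :
    (X.pred.report t A n ∩ X.B t).card ≤ min (X.err t) n ∧
    ((A \ X.B t) \ X.pred.report t A n).card ≤ e + min (X.err t) n ∧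
    (X.pred.report t A n).card ≤ n := by
  set R := X.pred.report t A n with hR
  have hsub : R ⊆ A \ X.pred.state t := X.pred.report_subset t A n
  have hcard : R.card = min n (A \ X.pred.state t).card := X.pred.card_report t A n
  have h1 : (R ∩ X.B t).card ≤ X.err t := Finset.card_le_card fun x hx => by
    rw [Finset.mem_inter] at hx
    exact Finset.mem_sdiff.2 ⟨hx.2, (Finset.mem_sdiff.1 (hsub hx.1)).2⟩
  have h2 : (R ∩ X.B t).card ≤ R.card := Finset.card_le_card Finset.inter_subset_left
  have h3 : ((A \ X.B t) \ R).card ≤ (A \ X.B t).card := Finset.card_le_card Finset.sdiff_subset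
  refine ⟨by omega, ?_, by omega⟩
  by_cases hc : n ≤ (A \ X.pred.state t).card
  · have h4 : R \ X.B t ⊆ A \ X.B t := Finset.sdiff_subset_sdiff
      (hsub.trans Finset.sdiff_subset) le_rfl
    have h5 : (A \ X.B t) \ R = (A \ X.B t) \ (R \ X.B t) := by
      ext x; simp only [Finset.mem_sdiff]; tauto
    have h6 := Finset.card_sdiff_add_card_eq_card h4
    have h7 := Finset.card_inter_add_card_sdiff R (X.B t)
    rw [h5]
    omega
  · have h4 : R = A \ X.pred.state t := Finset.eq_of_subset_of_card_le hsub (by omega)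
    have h5 : (A \ X.B t) \ R ⊆ X.pred.state t \ X.B t := by
      rw [h4]
      intro x hx
      simp only [Finset.mem_sdiff, not_and, not_not] at hx ⊢
      exact ⟨hx.2 hx.1.1, hx.1.2⟩
    have h6 : (X.pred.state t \ X.B t).card = X.err t :=
      Finset.card_sdiff_comm ((X.pred.card_state t).trans (X.card_B ht).symm)
    have h7 := Finset.card_le_card h5
    omega

theorem credit_queryCfg {t n : ℕ} {c : Config Page} (ht : t < X.T)
    (h : c.queryTimes ⊆ Finset.Icc 1 t) :
    X.credit (X.queryCfg t c n) + X.err (t + 1) = X.credit c := by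
  have hn : t + 1 ∉ c.queryTimes := fun h' => by
    have := Finset.mem_Icc.1 (h h')
    omega
  have hm : t + 1 ∈ Finset.Icc 1 X.T \ c.queryTimes := by
    simp [hn]; omega
  unfold credit queryCfg
  simp only
  rw [Finset.sdiff_insert]
  exact Finset.sum_erase_add _ _ hm

/-- The invariant after a query. -/
theorem AdvInv.midInv_query {t : ℕ} {m : Memory Page} {c : Config Page} (h : X.AdvInv t m c)
    (ht : t < X.T) (n : ℕ) (l : List (ℕ × ℕ)) (hn : 0 < n)
    (hl : ∀ x ∈ l, x ∈ m.log)
    (hd : (m.cache \ X.B (t + 1)).card ≤ n + X.logErr l)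
    (hq1 : X.asked t + 1 ≤ X.asked (t + 1) + m.pending)
    (hq2 : X.asked t + n ≤ X.asked (t + 1) + 2 * m.pending) :
    X.MidInv t (m.refresh (X.pred.report (t + 1) m.cache n) ((t + 1, n) :: l))
      (X.queryCfg t c n) := by
  obtain ⟨b1, b2, b3⟩ := report_bounds (X := X) (t := t + 1) ht hd
  have hsub := X.pred.report_subset (t + 1) m.cache n
  have e1 : X.logErr ((t + 1, n) :: l) = min (X.err (t + 1)) n + X.logErr l := by
    simp [logErr]
  have hsub' : Finset.Icc 1 t ⊆ Finset.Icc 1 (t + 1) := Finset.Icc_subset_Icc_right (by omega)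
  refine
    { init := h.init
      hist := h.hist
      phase := h.phase
      cache := h.cache
      card := h.card
      cand := hsub.trans Finset.sdiff_subset
      marked := h.marked
      again := h.again
      diff := h.diff
      missed := ?_
      wrong := ?_
      good := h.good
      times := ?_
      log := ?_
      syncs := ?_
      served := h.served
      pending := fun _ => Nat.zero_le _
      queries := ?_
      indices := ?_
      exact := fun he => ?_ }
  · simp only [Memory.refresh, e1]; omega
  · simp only [Memory.refresh, e1]; omega
  · simp only [queryCfg]
    exact Finset.insert_subset (by simp) (h.times.trans hsub')
  · intro x hx
    simp only [Memory.refresh, List.mem_cons] at hx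
    simp only [queryCfg, Finset.mem_insert]
    rcases hx with rfl | hx
    · exact Or.inl rfl
    · exact Or.inr (h.log x (hl x hx))
  · intro τ hτ hs
    simp only [queryCfg, Finset.mem_insert]
    rcases Nat.lt_succ_iff_lt_or_eq.1 hτ with hτ | rfl
    · exact Or.inr (h.syncs τ hτ hs)
    · exact Or.inl rfl
  · have := h.queries
    simp only [Memory.refresh, queryCfg]; omega
  · have := h.indices
    simp only [Memory.refresh, queryCfg, h.cache]; omega
  · rw [receivedError_eq, Finset.sum_eq_zero_iff] at he
    have he1 : X.err (t + 1) = 0 := he _ (Finset.mem_insert_self _ _)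
    have he2 : receivedError X.pred X.B c = 0 := by
      rw [receivedError_eq, Finset.sum_eq_zero_iff]
      exact fun τ hτ => he τ (Finset.mem_insert_of_mem hτ)
    obtain ⟨h1, h2, h3, -⟩ := h.exact he2
    refine ⟨h1, h2, h3, fun hf => ?_⟩
    -- With zero error and equal sizes the prediction equals B (t + 1), so the report lies in B t \
    -- B (t + 1). This set is nonempty at a Belady fault, and n > 0 ensures that something is
    -- reported.
    have hP : X.B (t + 1) = X.pred.state (t + 1) := by
      refine Finset.eq_of_subset_of_card_le ?_ ?_
      · rw [err, Finset.card_eq_zero, Finset.sdiff_eq_empty_iff_subset] at he1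
        exact he1
      · rw [X.pred.card_state, X.card_B ht]
    rw [← hP, h1] at hsub
    refine ⟨?_, by rw [← h1] at hsub ⊢; exact hsub⟩
    have hr : X.r t ∈ X.B (t + 1) \ X.B t :=
      Finset.mem_sdiff.2 ⟨X.lazyRun.mem_succ ht, by simpa [flt] using hf⟩
    have hc : (X.B t \ X.B (t + 1)).card = (X.B (t + 1) \ X.B t).card :=
      Finset.card_sdiff_comm ((X.card_B ht.le).trans (X.card_B ht).symm)
    have hpos := Finset.card_pos.2 ⟨_, hr⟩
    rw [← Finset.card_pos]
    simp only [Memory.refresh]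
    rw [X.pred.card_report, ← hP, h1]
    omega

/-- The query before request `t` is served. -/
theorem AdvInv.exists_midInv {t : ℕ} {m : Memory Page} {c : Config Page} (h : X.AdvInv t m c)
    (ht : t < X.T) :
    ∃ m' c', exec X.pred (t + 1)
        (queryAndServe (decide (X.StartsWindow t)) m (X.r t) (X.flt t)) c =
        exec X.pred (t + 1) (serve m' (X.r t) (X.flt t)) c' ∧ X.MidInv t m' c' ∧
      ∀ μ w, (∀ n, ∑ j ∈ (Finset.Icc 1 X.k).filter (fun j => μ ≤ j ∧ X.lev j = n),
        (1 / j : ℝ) ≤ w) → 0 ≤ w →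
        X.WMid μ w t (X.win t) m' c' ≤ X.WMid μ w t (X.ph t).win m c := by
  have hlen : m.hist.length = t + 1 := by simp [h.hist]
  have hquota : m.quota = X.quota t := by simp only [Memory.quota, h.phase, quota]
  have hsub' : Finset.Icc 1 t ⊆ Finset.Icc 1 (t + 1) := Finset.Icc_subset_Icc_right (by omega)
  have hexec : ∀ n f, exec X.pred (t + 1) (.query n f : Prog Page (Memory Page)) c =
      exec X.pred (t + 1) (f (X.pred.report (t + 1) m.cache n)) (X.queryCfg t c n) := by
    intro n f
    rw [exec, h.cache]
    simp only [queryCfg, h.cache]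
  unfold queryAndServe
  by_cases hw : X.StartsWindow t
  · simp only [hw, decide_true, if_true]
    by_cases hz : X.quota t = 0
    · rw [if_pos (hquota.trans hz)]
      have hd : m.cache \ X.B (t + 1) = ∅ := by
        have := h.diff
        rw [hz] at this
        exact Finset.card_eq_zero.1 (by omega)
      have hsync : ¬X.Sync t := fun h' => by have := h'.2; omega
      have hask : X.asked (t + 1) = X.asked t := by rw [asked_succ, if_neg hsync, add_zero]
      refine ⟨_, _, rfl, ?_, ?_⟩
      · refine
          { init := h.init
            hist := h.hist
            phase := h.phase
            cache := h.cache
            card := h.card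
            cand := Finset.empty_subset _
            marked := h.marked
            again := h.again
            diff := h.diff
            missed := ?_
            wrong := by simp [Memory.refresh]
            good := h.good
            times := h.times.trans hsub'
            log := by simp [Memory.refresh]
            syncs := ?_
            served := h.served
            pending := fun _ => Nat.zero_le _
            queries := ?_
            indices := ?_
            exact := fun he => ?_ }
        · simp [Memory.refresh, hd]
        · intro τ hτ hs
          rcases Nat.lt_succ_iff_lt_or_eq.1 hτ with hτ | rfl
          · exact h.syncs τ hτ hs
          · exact absurd hs hsync
        · have := h.queries
          simp only [Memory.refresh, hask]; omega
        · have := h.indices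
          simp only [Memory.refresh, hask]; omega
        · obtain ⟨h1, h2, h3, -⟩ := h.exact he
          -- The quota already counts a Belady fault at the present request, so quota 0 excludes it.
          refine ⟨h1, h2, h3, fun hf => ?_⟩
          unfold quota at hz
          rw [ph_cur_succ, hf] at hz
          simp at hz
      · intro μ w hw1 hw0
        have hp := pot_refresh_le (X := X) (μ := μ) (t := t) (cp := X.idx t)
          (cw := (X.ph t).win) (cw' := X.win t) (e := X.logErr m.log) (e' := 0) (A := m.cache)
          (L := m.dropped) (fun s hs => win_ne_of_startsWindow hw hs) (fun _ _ => Nat.zero_le _)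
        have : (0 : ℝ) ≤ m.pending := by positivity
        simp only [WMid, Memory.refresh, logErr, List.map_nil, List.sum_nil, Nat.cast_zero] at *
        linarith
    · rw [if_neg (by rwa [hquota]), hexec, hquota, hlen]
      have hsync : X.Sync t := ⟨hw, Nat.pos_of_ne_zero hz⟩
      have hask : X.asked (t + 1) = X.asked t + X.quota t := by rw [asked_succ, if_pos hsync]
      refine ⟨_, _, rfl, ?_, ?_⟩
      · refine h.midInv_query ht (X.quota t) [] (by omega) (by simp) ?_ (by omega) (by omega)
        simpa [logErr] using h.diff
      · intro μ w hw1 hw0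
        have hp := pot_refresh_le (X := X) (μ := μ) (t := t) (cp := X.idx t)
          (cw := (X.ph t).win) (cw' := X.win t) (e := X.logErr m.log)
          (e' := X.logErr [(t + 1, X.quota t)]) (A := m.cache)
          (L := m.dropped) (fun s hs => win_ne_of_startsWindow hw hs) (fun s hs => by
            have : X.err (t + 1) ≤ X.base s := by
              unfold base
              refine Finset.single_le_sum (f := fun τ => X.err (τ + 1))
                (fun _ _ => Nat.zero_le _) ?_
              simp [ht, hsync, hs]
            simp only [logErr, List.map_cons, List.map_nil, List.sum_cons, List.sum_nil]
            omega)
        have hc := credit_queryCfg (n := X.quota t) ht h.times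
        have hc' : (X.credit (X.queryCfg t c (X.quota t)) : ℝ) ≤ X.credit c := by
          exact_mod_cast (by omega)
        have hc'' := mul_le_mul_of_nonneg_left hc' (by positivity : 0 ≤ 36 * w)
        have : (0 : ℝ) ≤ m.pending := by positivity
        have e1 : (X.queryCfg t c (X.quota t)).cost = c.cost := rfl
        simp only [WMid, Memory.refresh, Nat.cast_zero, e1] at *
        linarith
  · simp only [hw, decide_false, Bool.false_eq_true, if_false]
    have hsync : ¬X.Sync t := fun h' => hw h'.1
    have hask : X.asked (t + 1) = X.asked t := by rw [asked_succ, if_neg hsync, add_zero]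
    have hwin : X.win t = (X.ph t).win := by unfold win; rw [ph_win_succ, if_neg hw]
    by_cases hp : m.NeedsPatch (X.r t)
    · rw [if_pos hp, hexec, hlen]
      set n := m.cand.card + m.pending with hn
      obtain ⟨hp1, hp2, hp3⟩ := hp
      refine ⟨_, _, rfl, ?_, ?_⟩
      · refine h.midInv_query ht n m.log (by omega) (fun _ hx => hx) ?_ (by omega) (by omega)
        have h1 := h.missed hw
        have h2 : (m.cache \ X.B (t + 1)).card ≤
            ((m.cache \ X.B (t + 1)) \ m.cand).card + m.cand.card := by
          have := Finset.le_card_sdiff m.cand (m.cache \ X.B (t + 1))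
          omega
        omega
      -- The patch asks for n ≤ 2·`pending` pages and adds an error d = min(err, n). Tripled, the
      -- rise of the slot potential is at most 18d + 36wd: the first part is covered by
      -- 36·`pending`, which is reset to 0, the second by the credit of the prediction queried now.
      · intro μ w hw1 hw0
        have hr := pot_raise_le (X := X) (μ := μ) (t := t) (cw := X.win t) (e := X.logErr m.log)
          (d := min (X.err (t + 1)) n) (A := m.cache) (L := m.dropped) (X.idx t) hw1 hw0
        have e0 : X.logErr ((t + 1, n) :: m.log) = X.logErr m.log + min (X.err (t + 1)) n := by
          simp [logErr, add_comm]
        have hc := credit_queryCfg (n := n) ht h.times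
        have hc' : (X.credit (X.queryCfg t c n) : ℝ) + X.err (t + 1) = X.credit c := by
          exact_mod_cast hc
        have hd1 : ((min (X.err (t + 1)) n : ℕ) : ℝ) ≤ 2 * m.pending := by
          exact_mod_cast (by omega)
        have hd2 : ((min (X.err (t + 1)) n : ℕ) : ℝ) ≤ X.err (t + 1) := by
          exact_mod_cast min_le_left _ _
        have hd3 := mul_le_mul_of_nonneg_left hd2 (by positivity : 0 ≤ 36 * w)
        have e1 : (X.queryCfg t c n).cost = c.cost := rfl
        simp only [WMid, Memory.refresh, Nat.cast_zero, e1, e0, ← hwin] at *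
        rw [← hc']
        linarith
    · rw [if_neg hp]
      refine ⟨_, _, rfl, ?_, fun μ w _ _ => by rw [hwin]⟩
      refine
        { init := h.init
          hist := h.hist
          phase := h.phase
          cache := h.cache
          card := h.card
          cand := h.cand hw
          marked := h.marked
          again := h.again
          diff := h.diff
          missed := h.missed hw
          wrong := h.wrong hw
          good := h.good
          times := h.times.trans hsub'
          log := h.log
          syncs := ?_
          served := h.served
          pending := fun hr => ?_
          queries := by rw [hask]; exact h.queries
          indices := by rw [hask]; exact h.indices
          exact := fun he => ?_ }
      · intro τ hτ hs
        rcases Nat.lt_succ_iff_lt_or_eq.1 hτ with hτ | rfl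
        · exact h.syncs τ hτ hs
        · exact absurd hs hsync
      · by_contra hlt
        exact hp ⟨hr, by omega, by omega⟩
      -- Under correct predictions there are no candidates here, so a Belady fault would have
      -- triggered a patch.
      · obtain ⟨h1, h2, h3, h4⟩ := h.exact he
        refine ⟨h1, h2, h3, fun hf => ?_⟩
        exfalso
        refine hp ⟨?_, ?_, ?_⟩
        · rw [h1]; simpa [flt] using hf
        · have := h.pending; rw [hf] at this; simpa using this
        · rw [h4 hw]; simp

/-- The steps before request `t` is served. -/
theorem Inv.exists_midInv {t : ℕ} {m : Memory Page} {c : Config Page} (h : X.Inv t m c)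
    (ht : t < X.T) :
    ∃ m' c', exec X.pred (t + 1) ((follower Page X.k X.lev).step m (X.r t)) c =
        exec X.pred (t + 1) (serve m' (X.r t) (X.flt t)) c' ∧ X.MidInv t m' c' ∧
      ∀ μ w, (∀ n, ∑ j ∈ (Finset.Icc 1 X.k).filter (fun j => μ ≤ j ∧ X.lev j = n),
        (1 / j : ℝ) ≤ w) → 0 ≤ w → X.WMid μ w t (X.win t) m' c' ≤ X.W μ w t m c := by
  obtain ⟨m', c', h1, h2, h3⟩ := (h.advInv ht).exists_midInv ht
  refine ⟨m', c', ?_, h2, fun μ w hw hw0 => (h3 μ w hw hw0).trans (h.wMid_adv_le ht μ w)⟩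
  rw [← h1]
  have hb : beladyFaults m.init m.hist (X.r t) = X.flt t := by
    rw [h.init, h.hist]; exact beladyFaults_eq X.belady ht
  simp only [follower, hb]
  have hsw : decide (m.phase.StartsWindow X.k X.lev (X.r t)) = decide (X.StartsWindow t) := by
    rw [decide_eq_decide, h.phase]; rfl
  rw [hsw]
  by_cases hs : X.Starts t ∧ m.bad = true
  · have hs' : m.phase.Starts X.k (X.r t) ∧ m.bad = true := by rw [h.phase]; exact hs
    have hM : m.phase.marked = X.M t := by rw [h.phase]; rfl
    rw [if_pos hs', hM, exec_cleanup (M := X.M t) X.pred (t + 1) (hs.1.2.trans h.card.symm) _ c h.cache,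
      advCfg, if_pos hs]
    rfl
  · have hs' : ¬(m.phase.Starts X.k (X.r t) ∧ m.bad = true) := by rw [h.phase]; exact hs
    rw [if_neg hs', advCfg, if_neg hs]
    rfl

end Scenario

end Invariants

/-! ### Serving a request: the expected potential does not increase -/

section Serving

variable {Page : Type u} [DecidableEq Page]

namespace Scenario

variable {X : Scenario Page}

theorem W_nonneg {μ : ℕ} {w : ℝ} (hw : 0 ≤ w) (t : ℕ) (m : Memory Page) (c : Config Page) :
    0 ≤ X.W μ w t m c := by
  have := pot_nonneg (X := X) μ t (X.ph t).idx (X.ph t).win m.cache m.dropped (X.logErr m.log)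
  unfold W
  positivity

theorem MidInv.inv_of_hit {t : ℕ} {m : Memory Page} {c : Config Page} (h : X.MidInv t m c)
    (ht : t < X.T) (hr : X.r t ∈ m.cache) : X.Inv (t + 1) m c := by
  have hM : X.M (t + 1) \ m.cache = (X.M (t + 1)).erase (X.r t) \ m.cache := by
    ext x
    simp only [Finset.mem_sdiff, Finset.mem_erase]
    constructor
    · rintro ⟨h1, h2⟩
      exact ⟨⟨fun e => h2 (e ▸ hr), h1⟩, h2⟩
    · rintro ⟨⟨-, h1⟩, h2⟩
      exact ⟨h1, h2⟩
  refine
    { init := h.init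
      hist := h.hist
      phase := h.phase
      cache := h.cache
      card := h.card
      cand := h.cand
      marked := hM ▸ h.marked
      diff := h.diff
      missed := h.missed
      wrong := h.wrong
      good := fun hb => ?_
      times := h.times
      log := h.log
      syncs := h.syncs
      served := h.served
      queries := h.queries
      indices := h.indices
      exact := fun he => ?_ }
  · have := h.good hb
    rw [hM]; omega
  · obtain ⟨h1, h2, h3, -⟩ := h.exact he
    rw [h1] at hr
    refine ⟨?_, ?_, h3⟩
    · rw [h1, X.lazyRun.hit t ht hr]
    · rw [h2, faults_succ]; simp [hr]

theorem MidInv.W_le_of_hit {t : ℕ} {m : Memory Page} {c : Config Page}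
    (hr : X.r t ∈ m.cache) (μ : ℕ) (w : ℝ) :
    X.W μ w (t + 1) m c ≤ X.WMid μ w t (X.win t) m c := by
  have hM : X.M (t + 1) \ m.cache = (X.M (t + 1)).erase (X.r t) \ m.cache := by
    ext x
    simp only [Finset.mem_sdiff, Finset.mem_erase]
    constructor
    · rintro ⟨h1, h2⟩
      exact ⟨⟨fun e => h2 (e ▸ hr), h1⟩, h2⟩
    · rintro ⟨⟨-, h1⟩, h2⟩
      exact ⟨h1, h2⟩
  have hp := pot_succ_le (X := X) μ t (X.idx t) (X.win t) m.cache m.dropped (X.logErr m.log)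
  have : (0 : ℝ) ≤ (X.flt t).toNat := by positivity
  unfold W WMid
  unfold idx win at *
  rw [hM]
  linarith

theorem MidInv.victims_subset {t : ℕ} {m : Memory Page} {c : Config Page} (h : X.MidInv t m c) :
    m.victims (X.r t) (X.flt t) ⊆ m.cache := by
  unfold Memory.victims
  split_ifs
  · exact h.cand
  · exact Finset.sdiff_subset

/-- The request is marked but not cached, and at most k pages are marked, so some of the k cached
pages is unmarked. -/
theorem MidInv.victims_nonempty {t : ℕ} {m : Memory Page} {c : Config Page} (h : X.MidInv t m c)
    (hr : X.r t ∉ m.cache) : (m.victims (X.r t) (X.flt t)).Nonempty := by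
  unfold Memory.victims
  split_ifs with hu
  · exact hu.1
  · rw [h.phase, ← Finset.card_pos]
    change 0 < (m.cache \ X.M (t + 1)).card
    have h1 := Finset.card_inter_add_card_sdiff m.cache (X.M (t + 1))
    have h2 := Finset.card_inter_add_card_sdiff (X.M (t + 1)) m.cache
    rw [Finset.inter_comm] at h2
    have h3 := card_M_le (X := X) (t + 1)
    have h4 : 0 < (X.M (t + 1) \ m.cache).card :=
      Finset.card_pos.2 ⟨_, Finset.mem_sdiff.2 ⟨mem_M_succ t, hr⟩⟩
    have h5 := h.card
    omega

/-- The configuration after request `t` was served by evicting `q`. -/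
def serveCfg (X : Scenario Page) (t : ℕ) (c : Config Page) (q : Page) : Config Page :=
  { c with cache := insert (X.r t) (c.cache.erase q), cost := c.cost + 1 }

/-- Random evictions spare marked pages, so a marked page outside the cache has been dropped as a
candidate. Under exact predictions the candidate is the page that Belady evicts, which preserves A =
B. -/
theorem MidInv.inv_of_miss {t : ℕ} {m : Memory Page} {c : Config Page} (h : X.MidInv t m c)
    (ht : t < X.T) (hr : X.r t ∉ m.cache) {q : Page}
    (hq : q ∈ m.victims (X.r t) (X.flt t)) :
    X.Inv (t + 1) (m.serveBy (X.r t) (X.flt t) q) (X.serveCfg t c q) := by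
  have hqA := h.victims_subset hq
  have hrB := X.lazyRun.mem_succ ht
  have hqr : q ≠ X.r t := fun e => hr (e ▸ hqA)
  have hqM : ¬m.UsesCand (X.r t) (X.flt t) → q ∉ X.M (t + 1) := fun hu => by
    unfold Memory.victims at hq
    rw [if_neg hu, h.phase] at hq
    exact (Finset.mem_sdiff.1 hq).2
  have hcard : (insert (X.r t) (m.cache.erase q)).card = X.k := by
    rw [Finset.card_insert_of_notMem (fun h' => hr (Finset.mem_of_mem_erase h')),
      Finset.card_erase_add_one hqA, h.card]
  have hsub : insert (X.r t) (m.cache.erase q) \ X.B (t + 1) ⊆ m.cache \ X.B (t + 1) := by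
    intro y hy
    simp only [Finset.mem_sdiff, Finset.mem_insert, Finset.mem_erase] at hy ⊢
    rcases hy with ⟨rfl | hy, hyB⟩
    · exact absurd hrB hyB
    · exact ⟨hy.2, hyB⟩
  refine
    { init := h.init
      hist := h.hist
      phase := h.phase
      cache := ?_
      card := hcard
      cand := ?_
      marked := ?_
      diff := (Finset.card_le_card hsub).trans h.diff
      missed := ?_
      wrong := ?_
      good := fun hb => ?_
      times := h.times
      log := h.log
      syncs := h.syncs
      served := h.served
      queries := h.queries
      indices := h.indices
      exact := fun he => ?_ }
  · simp only [serveCfg, Memory.serveBy, Memory.evict, h.cache]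
  · intro y hy
    simp only [Memory.serveBy, Memory.evict, Finset.mem_erase, Finset.mem_insert] at hy ⊢
    exact Or.inr ⟨hy.1, h.cand hy.2⟩
  · intro y hy
    simp only [Memory.serveBy, Memory.evict, Finset.mem_sdiff, Finset.mem_insert,
      Finset.mem_erase, not_or, not_and] at hy ⊢
    by_cases hyq : y = q
    · subst hyq
      by_cases hu : m.UsesCand (X.r t) (X.flt t)
      · rw [if_pos hu]; exact Finset.mem_insert_self _ _
      · exact absurd hy.1 (hqM hu)
    · have h1 : y ∈ m.dropped.erase (X.r t) := Finset.mem_erase.2 ⟨hy.2.1, h.marked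
        (Finset.mem_sdiff.2 ⟨Finset.mem_erase.2 ⟨hy.2.1, hy.1⟩, hy.2.2 hyq⟩)⟩
      split_ifs
      · exact Finset.mem_insert_of_mem h1
      · exact h1
  · refine (Finset.card_le_card fun y hy => ?_).trans h.missed
    simp only [Memory.serveBy, Memory.evict, Finset.mem_sdiff, Finset.mem_insert,
      Finset.mem_erase, not_and] at hy ⊢
    obtain ⟨⟨h1, h2⟩, h3⟩ := hy
    have h4 : y ≠ X.r t := fun e => h2 (e ▸ hrB)
    have h5 := h1.resolve_left h4
    exact ⟨⟨h5.2, h2⟩, h3 h5.1⟩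
  · refine (Finset.card_le_card fun y hy => ?_).trans h.wrong
    simp only [Memory.serveBy, Memory.evict, Finset.mem_inter, Finset.mem_erase] at hy ⊢
    exact ⟨hy.1.2, hy.2⟩
  · simp only [Memory.serveBy, Memory.evict, Bool.or_eq_false_iff, Bool.not_eq_false'] at hb
    have h1 := h.good hb.1
    rw [hb.2] at h1
    have h2 : X.M (t + 1) \ insert (X.r t) (m.cache.erase q) ⊆
        insert q ((X.M (t + 1)).erase (X.r t) \ m.cache) := by
      intro y hy
      simp only [Finset.mem_sdiff, Finset.mem_insert, Finset.mem_erase, not_or, not_and] at hy ⊢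
      tauto
    have h3 := (Finset.card_le_card h2).trans (Finset.card_insert_le _ _)
    simp only [Bool.toNat_true] at h1
    exact h3.trans h1
  · obtain ⟨h1, h2, h3, h4⟩ := h.exact he
    have hf : X.flt t = true := by
      rw [h1] at hr
      simp [flt, hr]
    obtain ⟨h5, h6⟩ := h4 hf
    have hu : m.UsesCand (X.r t) (X.flt t) := ⟨h5, Or.inl hf⟩
    have hq' : q ∈ X.B t \ X.B (t + 1) := by
      unfold Memory.victims at hq
      rw [if_pos hu] at hq
      exact h6 hq
    rw [h1] at hr
    refine ⟨?_, ?_, ?_⟩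
    · have hsub2 : X.B (t + 1) ⊆ insert (X.r t) (m.cache.erase q) := by
        intro y hy
        rcases Finset.mem_insert.1 (X.lazyRun.succ_subset ht hy) with rfl | hy'
        · exact Finset.mem_insert_self _ _
        · refine Finset.mem_insert_of_mem (Finset.mem_erase.2 ⟨?_, h1 ▸ hy'⟩)
          rintro rfl
          exact (Finset.mem_sdiff.1 hq').2 hy
      exact (Finset.eq_of_subset_of_card_le hsub2 (by rw [hcard, X.card_B ht])).symm
    · simp only [serveCfg, h2, faults_succ, hr, not_false_eq_true, decide_true, Bool.toNat_true]
    · simp [Memory.serveBy, Memory.evict, h3, hf]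

theorem card_evict_sdiff {A B' : Finset Page} {x q : Page} (hx : x ∈ B') (hq : q ∈ A) :
    (insert x (A.erase q) \ B').card + (if q ∈ B' then 0 else 1) = (A \ B').card := by
  have e : insert x (A.erase q) \ B' = (A \ B').erase q := by
    ext y
    simp only [Finset.mem_sdiff, Finset.mem_insert, Finset.mem_erase]
    constructor
    · rintro ⟨rfl | h, h'⟩
      · exact absurd hx h'
      · exact ⟨h.1, h.2, h'⟩
    · rintro ⟨h1, h2, h3⟩
      exact ⟨Or.inr ⟨h1, h2⟩, h3⟩
  rw [e]
  split_ifs with h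
  · rw [Finset.erase_eq_of_notMem (by simp [h])]; rfl
  · exact Finset.card_erase_add_one (Finset.mem_sdiff.2 ⟨hq, h⟩)

/-- A fault that Belady's algorithm avoids is paid for by the potential of its slot if the caches
differ in few pages. -/
theorem MidInv.pot_prepaid {t μ : ℕ} {m : Memory Page} {c : Config Page} (h : X.MidInv t m c)
    (ht : t < X.T) (hr : X.r t ∉ m.cache) (hf : X.flt t = false) (hd : X.r t ∉ m.dropped)
    (hc : X.rem t < μ ∨ (m.cache \ X.B (t + 1)).card ≤ 6 * X.logErr m.log) :
    X.pot μ (t + 1) (X.idx t) (X.win t) m.cache m.dropped (X.logErr m.log) + 1 ≤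
      X.pot μ t (X.idx t) (X.win t) m.cache m.dropped (X.logErr m.log) := by
  have hrB := flt_eq_false_iff.1 hf
  have hB := X.lazyRun.hit t ht hrB
  -- A marked page outside the cache has been dropped, so a request that is neither cached nor
  -- dropped is the first one to its page in the phase.
  have hfr : X.r t ∈ X.fresh t := by
    refine Finset.mem_sdiff.2 ⟨hrB, ?_⟩
    split_ifs with hs
    · simp
    · exact fun hm => hd (h.again hs hm hr)
  have hslot : t ∈ X.slots t := mem_slots.2 ⟨⟨le_rfl, ht⟩, hfr⟩
  refine le_trans ?_ (pot_succ_add_le m.cache m.dropped (X.logErr m.log) hslot)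
  gcongr
  have hq := (h.diff).trans (quota_le_g ht)
  have hcap : (X.fresh t \ m.cache).card ≤ X.cap μ t (X.win t) (X.logErr m.log) := by
    have h1 : (X.fresh t \ m.cache).card ≤ (X.B t \ m.cache).card :=
      Finset.card_le_card (Finset.sdiff_subset_sdiff Finset.sdiff_subset le_rfl)
    have h2 : (X.B t \ m.cache).card = (m.cache \ X.B t).card :=
      Finset.card_sdiff_comm ((X.card_B ht.le).trans h.card.symm)
    rw [hB] at hq hc
    unfold cap
    rw [if_pos rfl]
    split_ifs with hμ
    · omega
    · exact le_min (by omega) (by omega)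
  unfold slotPot
  split_ifs with h1 h2
  · exact le_rfl
  · have : (0 : ℝ) ≤ X.cap μ t (X.win t) (X.logErr m.log) - (X.fresh t \ m.cache).card :=
      sub_nonneg.2 (by exact_mod_cast hcap)
    have : 0 ≤ 2 / (X.rem t : ℝ) *
      (X.cap μ t (X.win t) (X.logErr m.log) - (X.fresh t \ m.cache).card) := by positivity
    linarith
  · exact absurd ⟨hr, hd⟩ h2

/-- Expected change of the potential when a fault is served. -/
theorem MidInv.sum_W_le {t μ : ℕ} {w : ℝ} {m : Memory Page} {c : Config Page}
    (h : X.MidInv t m c) (ht : t < X.T) (hr : X.r t ∉ m.cache) :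
    ∑ q ∈ m.victims (X.r t) (X.flt t),
        X.W μ w (t + 1) (m.serveBy (X.r t) (X.flt t) q) (X.serveCfg t c q) ≤
      (m.victims (X.r t) (X.flt t)).card * X.WMid μ w t (X.win t) m c := by
  have hrB := X.lazyRun.mem_succ ht
  have hp0 := pot_succ_le (X := X) μ t (X.idx t) (X.win t) m.cache m.dropped (X.logErr m.log)
  have hcr : ∀ q, X.credit (X.serveCfg t c q) = X.credit c := fun q => rfl
  have hmiss : ∀ q ∈ m.cache, ((insert (X.r t) (m.cache.erase q) \ X.B (t + 1)).card : ℝ) +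
      (if q ∈ X.B (t + 1) then 0 else 1) = (m.cache \ X.B (t + 1)).card := fun q hq => by
    exact_mod_cast card_evict_sdiff hrB hq
  by_cases hu : m.UsesCand (X.r t) (X.flt t)
  · have hV : m.victims (X.r t) (X.flt t) = m.cand := by
      unfold Memory.victims; rw [if_pos hu]
    rw [hV]
    set P := X.pot μ (t + 1) (X.idx t) (X.win t) m.cache m.dropped (X.logErr m.log) with hP
    -- The 3 is one unit each for the load, the dropped pages and the marked pages outside the
    -- cache. Evicting a page that Belady lacks returns 6.
    have key : ∀ q ∈ m.cand,
        X.W μ w (t + 1) (m.serveBy (X.r t) (X.flt t) q) (X.serveCfg t c q) ≤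
          X.WMid μ w t (X.win t) m c + (3 - 6 * (if q ∈ X.B (t + 1) then 0 else 1) -
            3 * (X.flt t).toNat + 3 * (P - X.pot μ t (X.idx t) (X.win t) m.cache m.dropped
              (X.logErr m.log))) := by
      intro q hq
      have hqA := h.cand hq
      have hpe := pot_evict_cand (X := X) (μ := μ) (t := t) (cw := X.win t)
        (e := X.logErr m.log) (A := m.cache) (L := m.dropped)
        (L' := insert q (m.dropped.erase (X.r t))) hqA (Finset.mem_insert_self _ _)
        (Finset.subset_insert _ _)
      have h1 := hmiss q hqA
      have h2 : ((insert q (m.dropped.erase (X.r t))).card : ℝ) ≤ m.dropped.card + 1 := by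
        have := (Finset.card_insert_le q (m.dropped.erase (X.r t))).trans
          (Nat.succ_le_succ (Finset.card_erase_le))
        exact_mod_cast this
      have h3 : ((X.M (t + 1) \ insert (X.r t) (m.cache.erase q)).card : ℝ) ≤
          ((X.M (t + 1)).erase (X.r t) \ m.cache).card + 1 := by
        have h2 : X.M (t + 1) \ insert (X.r t) (m.cache.erase q) ⊆
            insert q ((X.M (t + 1)).erase (X.r t) \ m.cache) := by
          intro y hy
          simp only [Finset.mem_sdiff, Finset.mem_insert, Finset.mem_erase, not_or,
            not_and] at hy ⊢
          tauto
        exact_mod_cast (Finset.card_le_card h2).trans (Finset.card_insert_le _ _)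
      have e1 : ((X.serveCfg t c q).cost : ℝ) = c.cost + 1 := by simp [serveCfg]
      simp only [W, WMid, Memory.serveBy, Memory.evict, if_pos hu, hcr, e1]
      unfold idx win at *
      linarith
    refine (Finset.sum_le_sum key).trans ?_
    rw [Finset.sum_add_distrib, Finset.sum_const, nsmul_eq_mul]
    rw [add_le_iff_nonpos_right]
    cases hf : X.flt t
    · have hd : X.r t ∉ m.dropped := by
        rcases hu.2 with h' | h'
        · rw [hf] at h'; exact absurd h' (by simp)
        · exact h'
      simp only [Bool.toNat_false, Nat.cast_zero, mul_zero, sub_zero]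
      by_cases hc : X.rem t < μ ∨ (m.cache \ X.B (t + 1)).card ≤ 6 * X.logErr m.log
      · have := h.pot_prepaid ht hr hf hd hc
        refine Finset.sum_nonpos fun q _ => ?_
        have : (0 : ℝ) ≤ if q ∈ X.B (t + 1) then 0 else 1 := by split_ifs <;> norm_num
        linarith
      -- From |A \ B| ≤ 2|cand| + `logErr` and |A \ B| > 6·`logErr` follows |cand| > 2·`logErr`, so
      -- at least half of the candidates are absent from B. On average a candidate returns 6/2 = 3.
      · rw [not_or, not_le] at hc
        have h1 := h.missed
        have h2 := h.wrong
        have h3 := h.pending hr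
        have h4 : (m.cache \ X.B (t + 1)).card ≤
            ((m.cache \ X.B (t + 1)) \ m.cand).card + m.cand.card := by
          have := Finset.le_card_sdiff m.cand (m.cache \ X.B (t + 1))
          omega
        have h5 : 2 * (m.cand ∩ X.B (t + 1)).card ≤ m.cand.card := by omega
        have h6 := Finset.card_inter_add_card_sdiff m.cand (X.B (t + 1))
        have h7 : (m.cand.card : ℝ) ≤ 2 * (m.cand \ X.B (t + 1)).card := by
          exact_mod_cast (by omega)
        have h8 : ∑ q ∈ m.cand, (if q ∈ X.B (t + 1) then (0 : ℝ) else 1) =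
            (m.cand \ X.B (t + 1)).card := by
          have : ∀ q, (if q ∈ X.B (t + 1) then (0 : ℝ) else 1) =
            if q ∉ X.B (t + 1) then 1 else 0 := fun q => by split_ifs <;> simp_all
          simp_rw [this]
          rw [Finset.sum_boole, Finset.sdiff_eq_filter]
        have h9 : ∑ q ∈ m.cand, ((3 : ℝ) - 6 * (if q ∈ X.B (t + 1) then 0 else 1) +
            3 * (P - X.pot μ t (X.idx t) (X.win t) m.cache m.dropped (X.logErr m.log))) ≤
            ∑ q ∈ m.cand, ((3 : ℝ) - 6 * (if q ∈ X.B (t + 1) then 0 else 1)) :=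
          Finset.sum_le_sum fun q _ => by linarith
        refine h9.trans ?_
        rw [Finset.sum_sub_distrib, ← Finset.mul_sum, h8, Finset.sum_const, nsmul_eq_mul]
        linarith
    · refine Finset.sum_nonpos fun q _ => ?_
      have : (0 : ℝ) ≤ if q ∈ X.B (t + 1) then 0 else 1 := by split_ifs <;> norm_num
      simp only [Bool.toNat_true, Nat.cast_one]
      linarith
  · have hV : m.victims (X.r t) (X.flt t) = m.cache \ X.M (t + 1) := by
      unfold Memory.victims; rw [if_neg hu, h.phase]; rfl
    rw [hV]
    set U := m.cache \ X.M (t + 1) with hU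
    set P := X.pot μ (t + 1) (X.idx t) (X.win t) m.cache m.dropped (X.logErr m.log) with hP
    have hroll := pot_evict_random (X := X) (μ := μ) (t := t) (cw := X.win t)
      (e := X.logErr m.log) (A := m.cache) (L := m.dropped) hU
    have hroll' : ∑ u ∈ U, (X.pot μ (t + 1) (X.idx t) (X.win t)
        (insert (X.r t) (m.cache.erase u)) (m.dropped.erase (X.r t)) (X.logErr m.log) - P) ≤ 0 := by
      rw [Finset.sum_sub_distrib, Finset.sum_const, nsmul_eq_mul]
      linarith
    -- The load is paid for by the request leaving the dropped pages, by Belady's own fault, or by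
    -- the slot. In the last case there are no candidates, hence nothing pending, so |A \ B| ≤
    -- `logErr` and the slot is below its cap.
    have hbound : 1 + ((m.dropped.erase (X.r t)).card : ℝ) - m.dropped.card -
        3 * (X.flt t).toNat + 3 * (P - X.pot μ t (X.idx t) (X.win t) m.cache m.dropped
          (X.logErr m.log)) ≤ 0 := by
      by_cases hd : X.r t ∈ m.dropped
      · have h1 := Finset.card_erase_add_one hd
        have h1' : ((m.dropped.erase (X.r t)).card : ℝ) + 1 = m.dropped.card := by
          exact_mod_cast h1
        have : (0 : ℝ) ≤ (X.flt t).toNat := by positivity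
        linarith
      · rw [Finset.erase_eq_of_notMem hd]
        cases hf : X.flt t
        · have hcand : m.cand = ∅ := by
            by_contra hne
            exact hu ⟨Finset.nonempty_iff_ne_empty.2 hne, Or.inr hd⟩
          have h1 := h.missed
          have h3 := h.pending hr
          rw [hcand] at h1 h3
          simp only [Finset.card_empty, Finset.sdiff_empty] at h1 h3
          have := h.pot_prepaid (μ := μ) ht hr hf hd (Or.inr (by omega))
          simp only [Bool.toNat_false, Nat.cast_zero, mul_zero, sub_zero]
          linarith
        · simp only [Bool.toNat_true, Nat.cast_one]
          linarith
    have key : ∀ q ∈ U,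
        X.W μ w (t + 1) (m.serveBy (X.r t) (X.flt t) q) (X.serveCfg t c q) ≤
          X.WMid μ w t (X.win t) m c + 3 * (X.pot μ (t + 1) (X.idx t) (X.win t)
            (insert (X.r t) (m.cache.erase q)) (m.dropped.erase (X.r t))
            (X.logErr m.log) - P) := by
      intro q hq
      rw [hU, Finset.mem_sdiff] at hq
      have h1 := hmiss q hq.1
      have h2 : (0 : ℝ) ≤ if q ∈ X.B (t + 1) then 0 else 1 := by split_ifs <;> norm_num
      have h3 : ((X.M (t + 1) \ insert (X.r t) (m.cache.erase q)).card : ℝ) ≤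
          ((X.M (t + 1)).erase (X.r t) \ m.cache).card := by
        have h2 : X.M (t + 1) \ insert (X.r t) (m.cache.erase q) ⊆
            (X.M (t + 1)).erase (X.r t) \ m.cache := by
          intro y hy
          simp only [Finset.mem_sdiff, Finset.mem_insert, Finset.mem_erase, not_or,
            not_and] at hy ⊢
          have : y ≠ q := fun e => hq.2 (e ▸ hy.1)
          tauto
        exact_mod_cast Finset.card_le_card h2
      have e1 : ((X.serveCfg t c q).cost : ℝ) = c.cost + 1 := by simp [serveCfg]
      simp only [W, WMid, Memory.serveBy, Memory.evict, if_neg hu, hcr, e1]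
      unfold idx win at *
      linarith
    refine (Finset.sum_le_sum key).trans ?_
    rw [Finset.sum_add_distrib, Finset.sum_const, nsmul_eq_mul, ← Finset.mul_sum]
    linarith

theorem exec_serve_swap {t : ℕ} {m : Memory Page} {c : Config Page} (h : X.MidInv t m c)
    (hr : X.r t ∉ m.cache) {q : Page} (hq : q ∈ m.victims (X.r t) (X.flt t)) :
    exec X.pred (t + 1)
      (.swap (X.r t) q (.done (m.serveBy (X.r t) (X.flt t) q)) : Prog Page (Memory Page)) c =
      PMF.pure (m.serveBy (X.r t) (X.flt t) q, X.serveCfg t c q) := by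
  rw [exec, if_pos ⟨by rwa [h.cache], by rw [h.cache]; exact h.victims_subset hq⟩, exec]
  rfl

theorem MidInv.mean_W_le {t μ : ℕ} {w : ℝ} {m : Memory Page} {c : Config Page}
    (h : X.MidInv t m c) (ht : t < X.T) (hw : 0 ≤ w) :
    mean (exec X.pred (t + 1) (serve m (X.r t) (X.flt t)) c)
        (fun y => ENNReal.ofReal (X.W μ w (t + 1) y.1 y.2)) ≤
      ENNReal.ofReal (X.WMid μ w t (X.win t) m c) := by
  unfold serve
  by_cases hr : X.r t ∈ m.cache
  · rw [if_pos hr, exec, mean_pure]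
    exact ENNReal.ofReal_le_ofReal (MidInv.W_le_of_hit hr μ w)
  · have hne := h.victims_nonempty hr
    have hpos : (0 : ℝ) < (m.victims (X.r t) (X.flt t)).card := by
      exact_mod_cast Finset.card_pos.2 hne
    rw [if_neg hr, mean_exec_draw X.pred (t + 1) hne]
    have e : ∀ q ∈ m.victims (X.r t) (X.flt t),
        mean (exec X.pred (t + 1)
          (.swap (X.r t) q (.done (m.serveBy (X.r t) (X.flt t) q)) : Prog Page (Memory Page)) c)
          (fun y => ENNReal.ofReal (X.W μ w (t + 1) y.1 y.2)) =
        ENNReal.ofReal (X.W μ w (t + 1) (m.serveBy (X.r t) (X.flt t) q) (X.serveCfg t c q)) :=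
      fun q hq => by rw [exec_serve_swap h hr hq, mean_pure]
    rw [Finset.sum_congr rfl e, ← ENNReal.ofReal_sum_of_nonneg (fun q _ => W_nonneg hw _ _ _),
      ← ENNReal.ofReal_natCast, ← ENNReal.ofReal_div_of_pos hpos]
    refine ENNReal.ofReal_le_ofReal ?_
    rw [div_le_iff₀ hpos, mul_comm]
    exact h.sum_W_le ht hr

theorem MidInv.support {t : ℕ} {m : Memory Page} {c : Config Page} (h : X.MidInv t m c)
    (ht : t < X.T) {y : Memory Page × Config Page}
    (hy : y ∈ (exec X.pred (t + 1) (serve m (X.r t) (X.flt t)) c).support) :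
    X.Inv (t + 1) y.1 y.2 ∧ X.r t ∈ y.2.cache := by
  unfold serve at hy
  by_cases hr : X.r t ∈ m.cache
  · rw [if_pos hr, exec, PMF.support_pure, Set.mem_singleton_iff] at hy
    subst hy
    exact ⟨h.inv_of_hit ht hr, h.cache ▸ hr⟩
  · rw [if_neg hr] at hy
    obtain ⟨q, hq, hy⟩ := mem_support_exec_draw X.pred (t + 1) (h.victims_nonempty hr) _ _ _ hy
    rw [exec_serve_swap h hr hq, PMF.support_pure, Set.mem_singleton_iff] at hy
    subst hy
    exact ⟨h.inv_of_miss ht hr hq, Finset.mem_insert_self _ _⟩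

end Scenario

end Serving

/-! ### From single steps to whole executions -/

section Run

variable {Page : Type u} [DecidableEq Page]

namespace Scenario

variable (X : Scenario Page)

/-- The distribution of memory and configuration after `t` requests. -/
noncomputable def execution (t : ℕ) : PMF (Memory Page × Config Page) :=
  (follower Page X.k X.lev).run X.pred X.A₀ X.r t

/-- The initial memory. -/
noncomputable def initMem : Memory Page := (follower Page X.k X.lev).init X.A₀

/-- The initial configuration. -/
def initCfg : Config Page := ⟨X.A₀, 0, 0, 0, ∅, 0⟩

variable {X}

theorem inv_init : X.Inv 0 X.initMem X.initCfg := by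
  have hB : X.B 0 = X.A₀ := X.belady.init
  constructor <;> simp [initMem, initCfg, follower, ph, M, hB, X.card_init, asked, faults]

variable (X) in
/-- The distribution of memory and configuration after request `t` is served. -/
noncomputable def stepDist (t : ℕ) (m : Memory Page) (c : Config Page) :
    PMF (Memory Page × Config Page) :=
  exec X.pred (t + 1) ((follower Page X.k X.lev).step m (X.r t)) c

theorem execution_zero : X.execution 0 = PMF.pure (X.initMem, X.initCfg) := rfl

theorem execution_succ (t : ℕ) :
    X.execution (t + 1) = (X.execution t).bind fun x => (X.stepDist t x.1 x.2).map fun y =>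
      (y.1, { y.2 with unserved := y.2.unserved + if X.r t ∈ y.2.cache then 0 else 1 }) := rfl

/-- After its step every request is cached with certainty, so the counter of unserved requests never
moves. -/
theorem stepDist_map {t : ℕ} {m : Memory Page} {c : Config Page} (h : X.Inv t m c)
    (ht : t < X.T) :
    (X.stepDist t m c).map (fun y =>
      (y.1, { y.2 with unserved := y.2.unserved + if X.r t ∈ y.2.cache then 0 else 1 })) =
    X.stepDist t m c := by
  obtain ⟨m', c', h1, h2, -⟩ := h.exists_midInv ht
  replace h1 : X.stepDist t m c = exec X.pred (t + 1) (serve m' (X.r t) (X.flt t)) c' := h1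
  rw [h1, ← PMF.bind_pure_comp]
  conv_rhs => rw [← PMF.bind_pure (exec X.pred (t + 1) (serve m' (X.r t) (X.flt t)) c')]
  ext z
  rw [PMF.bind_apply, PMF.bind_apply]
  refine tsum_congr fun y => ?_
  by_cases hy : y ∈ (exec X.pred (t + 1) (serve m' (X.r t) (X.flt t)) c').support
  · simp only [Function.comp_apply, if_pos (h2.support ht hy).2, add_zero]
  · rw [PMF.mem_support_iff, not_not] at hy
    simp only [hy, zero_mul]

theorem inv_of_mem_support {t : ℕ} (ht : t ≤ X.T) {x : Memory Page × Config Page}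
    (hx : x ∈ (X.execution t).support) : X.Inv t x.1 x.2 := by
  induction t generalizing x with
  | zero =>
    rw [execution_zero, PMF.support_pure, Set.mem_singleton_iff] at hx
    subst hx
    exact inv_init
  | succ t ih =>
    rw [execution_succ, PMF.mem_support_bind_iff] at hx
    obtain ⟨y, hy, hx⟩ := hx
    have hi := ih (by omega) hy
    rw [stepDist_map hi ht] at hx
    obtain ⟨m', c', h1, h2, -⟩ := hi.exists_midInv ht
    replace h1 : X.stepDist t y.1 y.2 = _ := h1
    rw [h1] at hx
    exact (h2.support ht hx).1

/-- The expected potential does not increase. -/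
theorem mean_W_le {μ : ℕ} {w : ℝ} (hw0 : 0 ≤ w)
    (hw : ∀ n, ∑ m ∈ (Finset.Icc 1 X.k).filter (fun m => μ ≤ m ∧ X.lev m = n), (1 / m : ℝ) ≤ w)
    {t : ℕ} (ht : t ≤ X.T) :
    mean (X.execution t) (fun x => ENNReal.ofReal (X.W μ w t x.1 x.2)) ≤
      ENNReal.ofReal (X.W μ w 0 X.initMem X.initCfg) := by
  induction t with
  | zero => rw [execution_zero, mean_pure]
  | succ t ih =>
    rw [execution_succ, mean_bind]
    refine (mean_mono fun x hx => ?_).trans (ih (by omega))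
    have hi := inv_of_mem_support (X := X) (by omega) hx
    rw [stepDist_map hi ht]
    obtain ⟨m', c', h1, h2, h3⟩ := hi.exists_midInv ht
    replace h1 : X.stepDist t x.1 x.2 = _ := h1
    rw [h1]
    exact (h2.mean_W_le ht hw0).trans (ENNReal.ofReal_le_ofReal (h3 μ w hw hw0))

/-- Pages of slots in the first phase have been in Belady's cache from the start, hence also in the
common initial cache, so no indicator is on. -/
theorem pot_init_le (μ : ℕ) :
    X.pot μ 0 (X.ph 0).idx (X.ph 0).win X.A₀ ∅ (X.logErr []) ≤ ∑ s ∈ X.slots 0, X.fund μ s := by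
  refine Finset.sum_le_sum fun s hs => ?_
  rw [mem_slots] at hs
  split_ifs with h
  · refine (slotPot_le_fund μ _ _ fun _ => by simp [logErr]).trans ?_
    have hmem := fresh_subset (Nat.zero_le s) hs.1.2 h hs.2
    rw [Finset.mem_sdiff, X.belady.init] at hmem
    simp [hmem.1]
  · exact le_rfl

theorem W_init_le {μ : ℕ} {H w : ℝ} (hw0 : 0 ≤ w)
    (hH : ∑ m ∈ (Finset.Icc 1 X.k).filter (fun m => m < μ), (1 / m : ℝ) ≤ H)
    (hw : ∀ n, ∑ m ∈ (Finset.Icc 1 X.k).filter (fun m => μ ≤ m ∧ X.lev m = n), (1 / m : ℝ) ≤ w) :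
    X.W μ w 0 X.initMem X.initCfg ≤ (81 + 18 * H) * X.opt + 36 * w * X.syncErr +
      36 * w * (∑ τ ∈ Finset.Icc 1 X.T, X.err τ : ℕ) := by
  have h1 := (pot_init_le (X := X) μ).trans (sum_fund_le hw0 hH hw)
  have h2 : X.faultsFrom 0 = X.opt := by rw [opt_eq, faultsFrom, Finset.range_eq_Ico]
  have h3 : X.B 0 = X.A₀ := X.belady.init
  have h4 : X.credit X.initCfg = ∑ τ ∈ Finset.Icc 1 X.T, X.err τ := by simp [credit, initCfg]
  unfold W
  rw [h2, h4, h3]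
  simp only [initMem, initCfg, follower, Finset.sdiff_self, Finset.card_empty, Nat.cast_zero]
  have h5 : X.M 0 = ∅ := rfl
  have h6 : (X.ph 0).cur = 0 := rfl
  rw [h5, h6, Finset.empty_sdiff, Finset.card_empty, Nat.cast_zero]
  linarith

theorem credit_add_receivedError {t : ℕ} {m : Memory Page} {c : Config Page} (h : X.Inv t m c)
    (ht : t ≤ X.T) :
    X.credit c + receivedError X.pred X.B c = ∑ τ ∈ Finset.Icc 1 X.T, X.err τ := by
  rw [receivedError_eq, credit]
  exact Finset.sum_sdiff (h.times.trans (Finset.Icc_subset_Icc_right ht))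

/-- Window queries depend on the requests and Belady's faults only, so every execution makes all of
them. This bounds a deterministic quantity by the random error received. -/
theorem syncErr_le {m : Memory Page} {c : Config Page} (h : X.Inv X.T m c) :
    X.syncErr ≤ receivedError X.pred X.B c := by
  rw [receivedError_eq, syncErr, ← Finset.sum_image (g := (· + 1)) (f := X.err)
    (fun a _ b _ hab => Nat.succ_injective hab)]
  refine Finset.sum_le_sum_of_subset fun τ hτ => ?_
  obtain ⟨σ, hσ, rfl⟩ := Finset.mem_image.1 hτ
  rw [Finset.mem_filter, Finset.mem_range] at hσ
  exact h.syncs σ hσ.1 hσ.2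

theorem expect_outcome (φ : Config Page → ℕ) :
    expect ((follower Page X.k X.lev).outcome X.pred X.A₀ X.r X.T) φ =
      mean (X.execution X.T) (fun x => (φ x.2 : ℝ≥0∞)) :=
  mean_map _ _ _

theorem exists_inv_of_mem_outcome {c : Config Page}
    (hc : c ∈ ((follower Page X.k X.lev).outcome X.pred X.A₀ X.r X.T).support) :
    ∃ m, X.Inv X.T m c := by
  rw [OnlineAlgorithm.outcome, PMF.mem_support_map_iff] at hc
  obtain ⟨x, hx, rfl⟩ := hc
  exact ⟨x.1, inv_of_mem_support le_rfl hx⟩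

/-- The credit left at the end is the total error minus the received one, so queries consume 36w
times the received error. Another 36w comes from the funds of the slots, which depend on the window
queries. -/
theorem expect_cost_le {μ : ℕ} {H w : ℝ} (hw0 : 0 ≤ w)
    (hH : ∑ m ∈ (Finset.Icc 1 X.k).filter (fun m => m < μ), (1 / m : ℝ) ≤ H)
    (hw : ∀ n, ∑ m ∈ (Finset.Icc 1 X.k).filter (fun m => μ ≤ m ∧ X.lev m = n), (1 / m : ℝ) ≤ w) :
    expect ((follower Page X.k X.lev).outcome X.pred X.A₀ X.r X.T) Config.cost ≤
      ENNReal.ofReal ((81 + 18 * H) * X.opt) + ENNReal.ofReal (72 * w) *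
        expect ((follower Page X.k X.lev).outcome X.pred X.A₀ X.r X.T)
          (receivedError X.pred X.B) := by
  rw [expect_outcome, expect_outcome]
  set ν := X.execution X.T with hν
  set E : Memory Page × Config Page → ℕ := fun x => receivedError X.pred X.B x.2 with hE
  set v : ℝ≥0∞ := ENNReal.ofReal (36 * w) with hv
  have hv2 : ENNReal.ofReal (72 * w) = v + v := by
    rw [hv, ← ENNReal.ofReal_add (by positivity) (by positivity)]; congr 1; ring
  have hinv : ∀ x ∈ ν.support, X.Inv X.T x.1 x.2 := fun x hx => inv_of_mem_support le_rfl hx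
  set tot : ℕ := ∑ τ ∈ Finset.Icc 1 X.T, X.err τ with htot
  have hlow : mean ν (fun x => (x.2.cost : ℝ≥0∞)) + mean ν (fun x => v * X.credit x.2) ≤
      ENNReal.ofReal (X.W μ w 0 X.initMem X.initCfg) := by
    rw [← mean_add]
    refine (mean_mono fun x _ => ?_).trans (mean_W_le hw0 hw le_rfl)
    rw [hv, ← ENNReal.ofReal_natCast, ← ENNReal.ofReal_natCast,
      ← ENNReal.ofReal_mul (by positivity), ← ENNReal.ofReal_add (by positivity) (by positivity)]
    refine ENNReal.ofReal_le_ofReal ?_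
    unfold W
    have := pot_nonneg (X := X) μ X.T (X.ph X.T).idx (X.ph X.T).win x.1.cache x.1.dropped
      (X.logErr x.1.log)
    have h6 : (0 : ℝ) ≤ 6 * (x.1.cache \ X.B X.T).card + x.1.dropped.card +
      (X.M X.T \ x.1.cache).card + 36 * x.1.pending + 18 * (X.ph X.T).cur +
      63 * X.faultsFrom X.T := by positivity
    linarith
  have hH0 : 0 ≤ H := le_trans (Finset.sum_nonneg fun m _ => by positivity) hH
  have hup : ENNReal.ofReal (X.W μ w 0 X.initMem X.initCfg) ≤
      ENNReal.ofReal ((81 + 18 * H) * X.opt) + v * X.syncErr + v * tot := by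
    refine (ENNReal.ofReal_le_ofReal (W_init_le hw0 hH hw)).trans ?_
    rw [ENNReal.ofReal_add (by positivity) (by positivity),
      ENNReal.ofReal_add (by positivity) (by positivity), hv, ← ENNReal.ofReal_natCast,
      ← ENNReal.ofReal_natCast, ← ENNReal.ofReal_mul (by positivity),
      ← ENNReal.ofReal_mul (by positivity)]
  have hs : v * X.syncErr ≤ v * mean ν (fun x => (E x : ℝ≥0∞)) := by
    refine mul_le_mul_right ?_ _
    rw [← mean_const ν (X.syncErr : ℝ≥0∞)]
    exact mean_mono fun x hx => by exact_mod_cast syncErr_le (hinv x hx)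
  have ht : v * tot = mean ν (fun x => v * X.credit x.2) + v * mean ν (fun x => (E x : ℝ≥0∞)) := by
    rw [mean_const_mul, ← mul_add, ← mean_add, ← mean_const ν (tot : ℝ≥0∞)]
    congr 1
    exact mean_congr fun x hx => by
      rw [htot, ← credit_add_receivedError (hinv x hx) le_rfl]
      push_cast; rfl
  -- The unused credit stands on both sides and is cancelled in [0, ∞], which requires it to be
  -- finite.
  have hfin : mean ν (fun x => v * X.credit x.2) ≠ ⊤ := by
    have : mean ν (fun x => v * X.credit x.2) ≤ v * tot := by rw [ht]; exact le_self_add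
    exact ne_top_of_le_ne_top (ENNReal.mul_ne_top ENNReal.ofReal_ne_top (by simp)) this
  refine (ENNReal.add_le_add_iff_right hfin).1 (hlow.trans (hup.trans ?_))
  rw [ht, hv2]
  refine (add_le_add_left (add_le_add_right hs _) _).trans (le_of_eq ?_)
  simp only [hE]
  ring

theorem expect_cost_le_of_exact
    (h : expect ((follower Page X.k X.lev).outcome X.pred X.A₀ X.r X.T)
      (receivedError X.pred X.B) = 0) :
    expect ((follower Page X.k X.lev).outcome X.pred X.A₀ X.r X.T) Config.cost ≤ X.opt := by
  rw [expect_outcome] at h ⊢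
  rw [← mean_const (X.execution X.T) (X.opt : ℝ≥0∞)]
  refine mean_mono fun x hx => ?_
  rw [mean, ENNReal.tsum_eq_zero] at h
  have h2 := (mul_eq_zero.1 (h x)).resolve_left ((PMF.mem_support_iff _ _).1 hx)
  have h3 := ((inv_of_mem_support le_rfl hx).exact (by exact_mod_cast h2)).2.1
  exact_mod_cast h3.le

/-- A window query asks for at least one page, so `asked` bounds window queries and their pages.
Belady's pending faults pay for each patch: one query and at most two pages per pending fault. -/
theorem Inv.counts_le {m : Memory Page} {c : Config Page} (h : X.Inv X.T m c) :
    (c.queries : ℝ) ≤ 5 * (1 + X.lev X.k) * X.opt ∧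
    (c.indices : ℝ) ≤ 5 * (1 + X.lev X.k) * X.opt := by
  have h1 : (X.asked X.T : ℝ) ≤ 3 * (X.lev X.k + 1) * X.opt := by
    rw [asked]; push_cast; exact sum_quota_le
  have h2 : (c.queries : ℝ) + m.pending ≤ X.asked X.T + X.opt := by exact_mod_cast h.queries
  have h3 : (c.indices : ℝ) + 2 * m.pending ≤ X.asked X.T + 2 * X.opt := by
    exact_mod_cast h.indices
  have h4 : (0 : ℝ) ≤ X.lev X.k * X.opt := by positivity
  have h5 : (0 : ℝ) ≤ m.pending := by positivity
  have h6 : (0 : ℝ) ≤ X.opt := by positivity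
  constructor <;> nlinarith

end Scenario

end Run

/-! ### Harmonic sums over levels of a convex function -/

section Levels

theorem sum_one_div_le_one_add_log (n : ℕ) :
    ∑ m ∈ Finset.Icc 1 n, (1 / m : ℝ) ≤ 1 + Real.log n := by
  refine le_trans (le_of_eq ?_) (harmonic_le_one_add_log n)
  rw [harmonic_eq_sum_Icc]
  push_cast
  exact Finset.sum_congr rfl fun m _ => one_div _

theorem log_le_logb_two {x : ℝ} (hx : 1 ≤ x) : Real.log x ≤ Real.logb 2 x := by
  have h2 : Real.log 2 ≤ 1 := by linarith [Real.log_two_lt_d9]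
  rw [Real.logb, le_div_iff₀ (Real.log_pos one_lt_two)]
  exact mul_le_of_le_one_right (Real.log_nonneg hx) h2

theorem sum_one_div_below_le {a : ℝ} (ha : 0 ≤ a) (k : ℕ) :
    ∑ m ∈ (Finset.Icc 1 k).filter (fun m => m < ⌈(2 : ℝ) ^ a⌉₊), (1 / m : ℝ) ≤ 1 + a := by
  -- The largest integer strictly below 2^a, whose binary logarithm is at most a.
  set n := ⌈(2 : ℝ) ^ a⌉₊ - 1 with hn
  refine (Finset.sum_le_sum_of_subset_of_nonneg (t := Finset.Icc 1 n) (fun m hm => ?_)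
    fun m _ _ => by positivity).trans ((sum_one_div_le_one_add_log n).trans ?_)
  · simp only [Finset.mem_filter, Finset.mem_Icc] at hm ⊢
    omega
  · rcases Nat.eq_zero_or_pos n with h0 | h0
    · simp [h0, ha]
    · have h1 : (n : ℝ) < 2 ^ a := Nat.lt_ceil.1 (by omega)
      have h2 : (1 : ℝ) ≤ n := by exact_mod_cast h0
      have h3 : Real.logb 2 n ≤ Real.logb 2 (2 ^ a) :=
        Real.logb_le_logb_of_le one_lt_two (by linarith) h1.le
      rw [Real.logb_rpow two_pos (by norm_num)] at h3
      linarith [log_le_logb_two h2]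

theorem sum_one_div_Ioc_le {m n : ℕ} (hm : 1 ≤ m) (hmn : m ≤ n) :
    ∑ i ∈ Finset.Ioc m n, (1 / i : ℝ) ≤ Real.log n - Real.log m := by
  induction n, hmn using Nat.le_induction with
  | base => simp
  | succ n hn ih =>
    rw [← Finset.insert_Ioc_right_eq_Ioc_add_one hn, Finset.sum_insert (by simp)]
    have hn0 : (0 : ℝ) < n := by exact_mod_cast (by omega : 0 < n)
    have h := Real.one_sub_inv_le_log_of_pos (x := ((n + 1 : ℕ) : ℝ) / n) (by positivity)
    rw [Real.log_div (by positivity) hn0.ne', inv_div] at h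
    have h2 : (1 : ℝ) / ((n + 1 : ℕ) : ℝ) = 1 - n / ((n + 1 : ℕ) : ℝ) := by
      push_cast; field_simp; ring
    linarith

variable {f : ℝ → ℝ}

/-- The level of a number of remaining pages. -/
noncomputable def level (f : ℝ → ℝ) (m : ℕ) : ℕ := ⌊f (Real.logb 2 m)⌋₊

theorem logb_natCast_nonneg {m : ℕ} (hm : 1 ≤ m) : 0 ≤ Real.logb 2 m :=
  Real.logb_nonneg one_lt_two (by exact_mod_cast hm)

theorem logb_natCast_mono {m n : ℕ} (hm : 1 ≤ m) (hmn : m ≤ n) :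
    Real.logb 2 m ≤ Real.logb 2 n :=
  Real.logb_le_logb_of_le one_lt_two (by exact_mod_cast hm) (by exact_mod_cast hmn)

theorem level_mono (hf : StrictMonoOn f (Set.Ici 0)) (m n : ℕ) (hm : 1 ≤ m) (hmn : m ≤ n) :
    level f m ≤ level f n :=
  Nat.floor_le_floor (hf.monotoneOn (logb_natCast_nonneg hm)
    (logb_natCast_nonneg (hm.trans hmn)) (logb_natCast_mono hm hmn))

theorem nonneg_of_strictMonoOn (hf : StrictMonoOn f (Set.Ici 0)) (h0 : f 0 = 0) {x : ℝ}
    (hx : 0 ≤ x) : 0 ≤ f x := by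
  rw [← h0]; exact hf.monotoneOn (Set.self_mem_Ici) hx hx

theorem level_le (hf : StrictMonoOn f (Set.Ici 0)) (h0 : f 0 = 0) {m : ℕ} (hm : 1 ≤ m) :
    (level f m : ℝ) ≤ f (Real.logb 2 m) :=
  Nat.floor_le (nonneg_of_strictMonoOn hf h0 (logb_natCast_nonneg hm))

theorem div_le_div_of_convexOn (hc : ConvexOn ℝ (Set.Ici 0) f) (h0 : f 0 = 0) {x y : ℝ}
    (hx : 0 < x) (hxy : x ≤ y) : f x / x ≤ f y / y := by
  have := hc.secant_mono (a := 0) (x := x) (y := y) Set.self_mem_Ici hx.le (hx.le.trans hxy)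
    hx.ne' (hx.trans_le hxy).ne' hxy
  simpa [h0] using this

/-- The harmonic sum over the numbers above `2 ^ a` of a fixed level. -/
theorem sum_one_div_level_le (hf : StrictMonoOn f (Set.Ici 0)) (hc : ConvexOn ℝ (Set.Ici 0) f)
    (h0 : f 0 = 0) (hexp : ∀ i : ℕ, f i ≤ 2 ^ i - 1) {a : ℝ} (ha : 0 < a) (k n : ℕ) :
    ∑ m ∈ (Finset.Icc 1 k).filter (fun m => ⌈(2 : ℝ) ^ a⌉₊ ≤ m ∧ level f m = n), (1 / m : ℝ) ≤
      3 * (a / f a) := by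
  have hF : 0 < f a := by rw [← h0]; exact hf Set.self_mem_Ici ha.le ha
  set S := (Finset.Icc 1 k).filter (fun m => ⌈(2 : ℝ) ^ a⌉₊ ≤ m ∧ level f m = n) with hS
  rcases S.eq_empty_or_nonempty with he | hne
  · rw [he, Finset.sum_empty]; positivity
  have hmem : ∀ m ∈ S, 1 ≤ m ∧ ⌈(2 : ℝ) ^ a⌉₊ ≤ m ∧ level f m = n := fun m hm => by
    rw [hS, Finset.mem_filter, Finset.mem_Icc] at hm; exact ⟨hm.1.1, hm.2⟩
  set m₀ := S.min' hne
  set m₁ := S.max' hne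
  obtain ⟨hm0, hceil, hl0⟩ := hmem m₀ (S.min'_mem hne)
  obtain ⟨hm1, -, hl1⟩ := hmem m₁ (S.max'_mem hne)
  have h01 : m₀ ≤ m₁ := S.min'_le _ (S.max'_mem hne)
  set x₀ := Real.logb 2 m₀ with hx0
  set x₁ := Real.logb 2 m₁
  have hpos0 : (0 : ℝ) < m₀ := by exact_mod_cast hm0
  have hx01 : x₀ ≤ x₁ := logb_natCast_mono hm0 h01
  have hax : a ≤ x₀ := (Real.le_logb_iff_rpow_le one_lt_two hpos0).2 (Nat.ceil_le.1 hceil)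
  have hx0pos : 0 < x₀ := ha.trans_le hax
  have hslope : f a / a ≤ f x₀ / x₀ := div_le_div_of_convexOn hc h0 ha hax
  have hsum : ∑ m ∈ S, (1 / m : ℝ) ≤ 1 / m₀ + (Real.log m₁ - Real.log m₀) := by
    refine le_trans ?_ (add_le_add_right (sum_one_div_Ioc_le hm0 h01) _)
    rw [← Finset.sum_insert (f := fun i : ℕ => (1 / i : ℝ)) Finset.left_notMem_Ioc,
      Finset.Ioc_insert_left h01]
    exact Finset.sum_le_sum_of_subset_of_nonneg
      (fun m hm => Finset.mem_Icc.2 ⟨S.min'_le _ hm, S.le_max' _ hm⟩) fun m _ _ => by positivity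
  -- By convexity the slope of f beyond x₀ ≥ a is at least f(a)/a, while f grows by at most 1 within
  -- a level. So a level has length at most a/f(a) on the logarithmic scale.
  have hlog : Real.log m₁ - Real.log m₀ ≤ a / f a := by
    have h1 : Real.log m₁ - Real.log m₀ ≤ x₁ - x₀ := by
      have hm1' : (0 : ℝ) < m₁ := by exact_mod_cast hm1
      have := log_le_logb_two (x := (m₁ : ℝ) / m₀)
        ((one_le_div hpos0).2 (by exact_mod_cast h01))
      rwa [Real.log_div hm1'.ne' hpos0.ne', Real.logb_div hm1'.ne' hpos0.ne'] at this
    refine h1.trans ?_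
    rcases hx01.eq_or_lt with h | h
    · rw [h, sub_self]; positivity
    have h2 := hc.slope_mono_adjacent Set.self_mem_Ici (hx0pos.le.trans hx01) hx0pos h
    rw [h0, sub_zero, sub_zero] at h2
    have h3 : f x₁ - f x₀ ≤ 1 := by
      have h4 : f x₁ < n + 1 := by rw [← hl1]; exact Nat.lt_floor_add_one _
      have h5 : (n : ℝ) ≤ f x₀ := by rw [← hl0]; exact level_le hf h0 hm0
      linarith
    have h6 : f a / a * (x₁ - x₀) ≤ 1 := by
      have := (le_div_iff₀ (sub_pos.2 h)).1 (hslope.trans h2)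
      linarith
    rw [le_div_iff₀ hF]
    rw [div_mul_eq_mul_div, div_le_one ha] at h6
    linarith
  -- The exponential bound enters here: a level may contain a single number m₀, and f(x₀) ≤ 2m₀
  -- together with x₀ ≥ 1 gives f(a)/a ≤ f(x₀)/x₀ ≤ 2m₀.
  have hfirst : 1 / (m₀ : ℝ) ≤ 2 * (a / f a) := by
    have hm2 : 2 ≤ m₀ := by
      by_contra h
      have : m₀ = 1 := by omega
      rw [hx0, this] at hx0pos
      simp at hx0pos
    have hx1 : 1 ≤ x₀ := by
      refine (Real.le_logb_iff_rpow_le one_lt_two hpos0).2 ?_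
      rw [Real.rpow_one]; exact_mod_cast hm2
    have hup : f x₀ ≤ 2 * m₀ := by
      have h1 : f x₀ ≤ f ⌈x₀⌉₊ :=
        hf.monotoneOn hx0pos.le (Nat.cast_nonneg (α := ℝ) ⌈x₀⌉₊) (Nat.le_ceil _)
      have h2 : (2 : ℝ) ^ ⌈x₀⌉₊ ≤ 2 ^ (x₀ + 1) := by
        rw [← Real.rpow_natCast]
        exact Real.rpow_le_rpow_of_exponent_le one_le_two (Nat.ceil_lt_add_one hx0pos.le).le
      rw [Real.rpow_add two_pos, Real.rpow_one, hx0,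
        Real.rpow_logb two_pos (by norm_num) hpos0] at h2
      linarith [hexp ⌈x₀⌉₊]
    have h3 : f a / a ≤ 2 * m₀ := by
      refine hslope.trans ((div_le_iff₀ hx0pos).2 (hup.trans ?_))
      exact le_mul_of_one_le_right (by positivity) hx1
    rw [div_le_iff₀ ha] at h3
    rw [← mul_div_assoc, div_le_div_iff₀ hpos0 hF]
    linarith
  linarith

/-- A convex strictly increasing function maps the nonnegative reals onto the nonnegative reals. -/
theorem exists_eq_of_convexOn (hf : StrictMonoOn f (Set.Ici 0)) (hc : ConvexOn ℝ (Set.Ici 0) f)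
    (h0 : f 0 = 0) {y : ℝ} (hy : 0 ≤ y) : ∃ a ∈ Set.Ici (0 : ℝ), f a = y := by
  have h1 : 0 < f 1 := by rw [← h0]; exact hf Set.self_mem_Ici (Set.mem_Ici.2 zero_le_one) zero_lt_one
  have hcont : ContinuousOn f (Set.Ici 0) := by
    intro x hx
    rcases (Set.mem_Ici.1 hx).eq_or_lt with rfl | hx
    -- Convexity gives continuity only in the interior; at 0 the function is squeezed between 0 and
    -- x·f(1).
    · rw [ContinuousWithinAt, h0]
      refine tendsto_of_tendsto_of_tendsto_of_le_of_le' (g := fun _ => (0 : ℝ))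
        (h := fun x => x * f 1) tendsto_const_nhds ?_ ?_ ?_
      · have : ContinuousWithinAt (fun x : ℝ => x * f 1) (Set.Ici 0) 0 := by fun_prop
        simpa [ContinuousWithinAt] using this
      · filter_upwards [self_mem_nhdsWithin] with x hx using nonneg_of_strictMonoOn hf h0 hx
      · filter_upwards [self_mem_nhdsWithin, mem_nhdsWithin_of_mem_nhds (Iio_mem_nhds one_pos)]
          with x hx hx1
        rcases (Set.mem_Ici.1 hx).eq_or_lt with rfl | hx
        · simp [h0]
        · have := div_le_div_of_convexOn hc h0 hx (le_of_lt hx1)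
          rwa [div_one, div_le_iff₀ hx, mul_comm] at this
    · have := hc.continuousOn_interior
      rw [interior_Ici] at this
      exact (this.continuousAt (Ioi_mem_nhds hx)).continuousWithinAt
  set b := max 1 (y / f 1)
  have hb1 : 1 ≤ b := le_max_left _ _
  have hb : y ≤ f b := by
    have h2 := div_le_div_of_convexOn hc h0 one_pos hb1
    rw [div_one, le_div_iff₀ (by linarith)] at h2
    have h3 : y ≤ b * f 1 := (div_le_iff₀ h1).1 (le_max_right _ _)
    linarith
  obtain ⟨a, ha, hfa⟩ := intermediate_value_Icc (zero_le_one.trans hb1)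
    (hcont.mono fun x hx => hx.1) (show y ∈ Set.Icc (f 0) (f b) from ⟨by rwa [h0], hb⟩)
  exact ⟨a, ha.1, hfa⟩

end Levels

end Caching

/-! ### The main theorem: choice of the analysis parameters -/

theorem theorem1 :
    ∃ C : ℝ, ∀ k : ℕ, 2 ≤ k → ∀ f : ℝ → ℝ,
      StrictMonoOn f (Set.Ici 0) → ConvexOn ℝ (Set.Ici 0) f → f 0 = 0 →
      (∀ i : ℕ, f i ≤ 2 ^ i - 1) →
      ∀ (Page : Type u) [DecidableEq Page], ∃ alg : Caching.OnlineAlgorithm Page,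
        ∀ (A₀ : Finset Page), A₀.card = k →
        ∀ (r : ℕ → Page) (T : ℕ) (B : ℕ → Finset Page), Caching.IsBeladyRun r T A₀ B →
        ∀ pred : Caching.Predictor Page k,
          -- every request is served, and the numbers of queries and of reported pages are bounded
          (∀ c ∈ (alg.outcome pred A₀ r T).support,
            c.unserved = 0 ∧
            (c.queries : ℝ) ≤ C * (1 + f (Real.logb 2 k)) * Caching.faults r T B ∧
            (c.indices : ℝ) ≤ C * (1 + f (Real.logb 2 k)) * Caching.faults r T B) ∧
          -- consistency
          (Caching.expect (alg.outcome pred A₀ r T) (Caching.receivedError pred B) = 0 →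
            Caching.expect (alg.outcome pred A₀ r T) Caching.Config.cost
              ≤ Caching.faults r T B) ∧
          -- robustness
          Caching.expect (alg.outcome pred A₀ r T) Caching.Config.cost
            ≤ ENNReal.ofReal (C * Real.logb 2 k * Caching.faults r T B) ∧
          -- smoothness
          (∀ η : ℝ≥0,
            Caching.expect (alg.outcome pred A₀ r T) (Caching.receivedError pred B) ≤ η →
            Caching.expect (alg.outcome pred A₀ r T) Caching.Config.cost
              ≤ ENNReal.ofReal
                  (C * (1 + Function.invFunOn f (Set.Ici 0) (η / Caching.faults r T B))
                    * Caching.faults r T B)) := by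
  -- Smoothness needs 81 + 18(1 + a) + 72·3a = 99 + 234a, which is at most 234(1 + a); the other
  -- bounds need less.
  refine ⟨234, fun k hk f hf hc h0 hexp Page _ =>
    ⟨Caching.follower Page k (Caching.level f), fun A₀ hA₀ r T B hB pred => ?_⟩⟩
  let X : Caching.Scenario Page :=
    ⟨k, Caching.level f, r, T, A₀, B, pred, hk, hA₀, hB, Caching.level_mono hf⟩
  have hk1 : 1 ≤ k := by omega
  have hopt : X.opt = Caching.faults r T B := rfl
  rw [← hopt]
  have hopt0 : (0 : ℝ) ≤ X.opt := Nat.cast_nonneg _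
  have hlogk : 1 ≤ Real.logb 2 k := by
    rw [Real.le_logb_iff_rpow_le one_lt_two (by exact_mod_cast hk1), Real.rpow_one]
    exact_mod_cast hk
  have hcons := X.expect_cost_le_of_exact
  have hrob : Caching.expect ((Caching.follower Page k (Caching.level f)).outcome pred A₀ r T)
      Caching.Config.cost ≤ ENNReal.ofReal (234 * Real.logb 2 k * X.opt) := by
    -- No number up to k reaches the threshold k + 1, so w = 0 is admissible and the error has no
    -- influence.
    have h := X.expect_cost_le (μ := k + 1) (H := 1 + Real.log k) (w := 0) le_rfl
      (by
        refine (Finset.sum_le_sum_of_subset_of_nonneg (Finset.filter_subset _ _)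
          fun m _ _ => by positivity).trans (Caching.sum_one_div_le_one_add_log k))
      (fun n => by
        rw [Finset.filter_eq_empty_iff.2, Finset.sum_empty]
        intro m hm h
        have h1 := (Finset.mem_Icc.1 hm).2
        have h2 : k + 1 ≤ m := h.1
        have h3 : m ≤ k := h1
        omega)
    rw [mul_zero, ENNReal.ofReal_zero, zero_mul, add_zero] at h
    refine h.trans (ENNReal.ofReal_le_ofReal (mul_le_mul_of_nonneg_right ?_ hopt0))
    linarith [Caching.log_le_logb_two (x := (k : ℝ)) (by exact_mod_cast hk1)]
  refine ⟨fun c hcm => ?_, hcons, hrob, fun η hη => ?_⟩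
  · obtain ⟨m, hm⟩ := X.exists_inv_of_mem_outcome hcm
    have hle : 5 * (1 + X.lev X.k : ℝ) * X.opt ≤ 234 * (1 + f (Real.logb 2 k)) * X.opt := by
      have h1 : (X.lev X.k : ℝ) ≤ f (Real.logb 2 k) := Caching.level_le hf h0 hk1
      have h2 : (0 : ℝ) ≤ X.lev X.k := Nat.cast_nonneg _
      exact mul_le_mul_of_nonneg_right (by linarith) hopt0
    exact ⟨hm.served, hm.counts_le.1.trans hle, hm.counts_le.2.trans hle⟩
  · obtain ⟨hmem, heq⟩ : Function.invFunOn f (Set.Ici 0) (η / X.opt) ∈ Set.Ici (0 : ℝ) ∧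
        f (Function.invFunOn f (Set.Ici 0) (η / X.opt)) = η / X.opt := by
      have h := Caching.exists_eq_of_convexOn hf hc h0 (y := η / X.opt) (by positivity)
      exact ⟨Function.invFunOn_mem h, Function.invFunOn_eq h⟩
    generalize Function.invFunOn f (Set.Ici 0) (η / X.opt) = a at hmem heq
    replace hmem : 0 ≤ a := hmem
    -- Division by OPT = 0 gives 0 by convention; the robust bound already shows that the cost
    -- vanishes.
    rcases Nat.eq_zero_or_pos X.opt with ho | ho
    · refine hrob.trans ?_
      simp [ho]
    have ho' : (0 : ℝ) < X.opt := by exact_mod_cast ho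
    -- For η = 0 one has a = 0, and a/f(a) is meaningless; consistency covers this case.
    rcases eq_or_ne η 0 with rfl | hη0
    · refine (hcons (by simpa using hη)).trans ?_
      rw [← ENNReal.ofReal_natCast]
      exact ENNReal.ofReal_le_ofReal (le_mul_of_one_le_left hopt0 (by linarith))
    have hηpos : (0 : ℝ) < η := by exact_mod_cast pos_iff_ne_zero.2 hη0
    have ha : 0 < a := by
      refine hmem.lt_of_ne fun h => ?_
      rw [← h, h0] at heq
      exact (div_pos hηpos ho').ne heq
    have hw0 : 0 ≤ 3 * (a / f a) := by rw [heq]; positivity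
    refine (X.expect_cost_le (H := 1 + a) hw0 (Caching.sum_one_div_below_le hmem k)
      (Caching.sum_one_div_level_le hf hc h0 hexp ha k)).trans ?_
    refine (add_le_add_right (mul_le_mul_right hη _) _).trans ?_
    rw [← ENNReal.ofReal_coe_nnreal, ← ENNReal.ofReal_mul (by positivity),
      ← ENNReal.ofReal_add (by positivity) (by positivity)]
    refine ENNReal.ofReal_le_ofReal ?_
    -- Since f(a) = η/OPT, the error term 72·w·η with w = 3a/f(a) becomes linear in a·OPT.
    have h1 : 72 * (3 * (a / f a)) * (η : ℝ) = 216 * a * X.opt := by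
      rw [heq]; field_simp; ring
    rw [h1]
    nlinarith [mul_nonneg hmem hopt0]
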